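/- **Setting.** Let $Z$ be a compact oriented Riemannian manifold of dimension $n\ge 1$ with smooth boundary $\partial Z$, where $\partial Z$ carries the induced metric and the Stokes orientation. Write $\Omega^k$ for smooth $k$-forms, $\ast$ for the Hodge stars of $Z$ and of $\partial Z$, $|_{\partial Z}$ for pull-back to $\partial Z$, and $\langle\beta|\alpha\rangle=\int\beta\wedge\alpha$ (over $Z$ or $\partial Z$). Let $p,q\le n$ with $p+q=n+1$, let $\epsilon,\mu\in\mathbb R\setminus\{0\}$, and let $G$, $R$ be smooth fields of linear endomorphisms of the $(n-p)$-covectors and the $(n-q)$-covectors of $Z$ that are symmetric for the metric: $G\alpha\wedge\ast\beta=\alpha\wedge\ast G\beta$, and likewise for $R$. *Port-Hamiltonian system.* For $\alpha_p\in\Omega^p(Z)$, $\alpha_q\in\Omega^q(Z)$ let $H(\alpha_p,\alpha_q)=\frac12\int_Z(\epsilon^{-1}\alpha_p\wedge\ast\alpha_p+\mu^{-1}\alpha_q\wedge\ast\alpha_q)$. Its variational derivative $(\delta_pH,\delta_qH)\in\Omega^{n-p}(Z)\times\Omega^{n-q}(Z)$ is defined by $dH(w_p,w_q)=\int_Z(\delta_pH\wedge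 w_p+\delta_qH\wedge w_q)$. With $r=pq+1$, the system is $$-\dot\alpha_p=\ast G\,\delta_pH+(-1)^r d\,\delta_qH,\quad -\dot\alpha_q=d\,\delta_pH+\ast R\,\delta_qH,\quad f_b=\delta_pH|_{\partial Z},\quad e_b=-(-1)^{n-q}\delta_qH|_{\partial Z}.$$ *Brayton–Moser equations.* For $u=(e_p,e_q)\in\Omega^{n-p}(Z)\times\Omega^{n-q}(Z)$ let $U=(e_p,e_q,e_p|_{\partial Z},e_q|_{\partial Z})$ and $$P(u)=\int_Z\Big(e_q\wedge de_p+\tfrac12 Re_q\wedge\ast e_q-\tfrac12 Ge_p\wedge\ast e_p\Big).$$ The variational derivative $\delta_UP=(\delta_1,\delta_2,\delta_3,\delta_4)\in\mathcal E=\Omega^p(Z)\times\Omega^q(Z)\times\Omega^{n-q}(\partial Z)\times\Omega^{n-p}(\partial Z)$ is defined by: for all smooth $w_p,w_q$ the first variation of $P$ at $u$ in direction $(w_p,w_q)$ is $\int_Z(\delta_1\wedge w_p+\delta_2\wedge w_q)+\int_{\partial Z}(\delta_3\wedge w_p+\delta_4\wedge w_q)$. On $\mathcal F=\Omega^{n-p}(Z)\times\Omega^{n-q}(Z)\times\Omega^{n-p}(\partial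 Z)\times\Omega^{n-q}(\partial Z)$ put $A=\mathrm{diag}(\epsilon,-\mu)$, $\mathcal A=\mathrm{diag}(\epsilon,-\mu,0,0)$ and $Bv=(0,0,v,0)$, $B^\top f=f_3$. The Brayton–Moser equations are $$\mathcal A U_t=\ast\,\delta_UP+B\ast e_b,\qquad \dot f_b=B^\top U_t .$$ *Dirac structure.* Put $\mathcal D=\{(f,f_y,e,e_u)\in\mathcal F\times\Omega^{n-q}(\partial Z)\times\mathcal E\times\Omega^{n-p}(\partial Z):\ -\mathcal Af=\ast e+Be_u,\ f_y=\ast B^\top f\}$, and on this product space $$\langle\langle x^1,x^2\rangle\rangle=\langle e^1|f^2\rangle+\langle e^2|f^1\rangle+\int_{Z+\partial Z}(f^1\wedge\ast\mathcal Af^2+f^2\wedge\ast\mathcal Af^1)+\langle e_u^1|f_y^2\rangle+\langle e_u^2|f_y^1\rangle .$$ **Proposition.** 1. For all smooth $e_p,e_q$, the variational derivative $\delta_UP$ at $(e_p,e_q)$ exists and is unique. With $\alpha_p=\ast\epsilon e_p$ and $\alpha_q=\ast\mu e_q$, the variational derivative of $H$ at $(\alpha_p,\alpha_q)$ exists, is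 unique and equals $(e_p,e_q)$. 2. $\mathcal D$ is a (noncanonical) Dirac structure: $\mathcal D=\mathcal D^\perp$ with respect to $\langle\langle\cdot,\cdot\rangle\rangle$. 3. Let $J\subset\mathbb R$ be open, and let $e_p(t)\in\Omega^{n-p}(Z)$, $e_q(t)\in\Omega^{n-q}(Z)$, $f_b(t)\in\Omega^{n-p}(\partial Z)$, $e_b(t)\in\Omega^{n-q}(\partial Z)$, $t\in J$, depend smoothly on time and space jointly. For $t\in J$ put $x(t)=(f,f_y,e,e_u)=(-U_t,\,-\ast\dot f_b,\,\delta_UP,\,\ast e_b)$. - The forms $\alpha_p=\ast\epsilon e_p$, $\alpha_q=\ast\mu e_q$, $f_b$, $e_b$ satisfy the port-Hamiltonian system on $J$ if and only if $e_p,e_q,f_b,e_b$ satisfy the Brayton–Moser equations on $J$ and $f_b=e_p|_{\partial Z}$ on $J$. - $e_p,e_q,f_b,e_b$ satisfy the Brayton–Moser equations on $J$ if and only if $x(t)\in\mathcal D$ for all $t\in J$. - For every $t\in J$ (along solutions or not), $\mathcal P(t):=P(e_p(t),e_q(t))$ is differentiable at $t$ and $$\langle\langle x(t),x(t)\rangle\rangle=2\Big(\int_Z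 u_t\wedge\ast Au_t-\int_{\partial Z}e_b\wedge\dot f_b-\dot{\mathcal P}(t)\Big).$$ - If the Brayton–Moser equations hold on $J$, then for every $t\in J$ one has $\langle\langle x(t),x(t)\rangle\rangle=0$, and the power balance holds: $$\dot{\mathcal P}=\int_Z u_t\wedge\ast Au_t-\int_{\partial Z}e_b\wedge\dot f_b .$$ -/

import Mathlib

open scoped ContDiff Manifold

/-! ### Exterior algebra on a finite-dimensional space -/

section Fibre

variable {V : Type*} [AddCommGroup V] [Module ℝ V] [TopologicalSpace V]

/-- The multilinear map `v ↦ α (v₁, …, v_k) * β (v_{k+1}, …, v_{k+l})`. -/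
noncomputable def tensorForm {k l m : ℕ} (h : k + l = m)
    (α : V [⋀^Fin k]→L[ℝ] ℝ) (β : V [⋀^Fin l]→L[ℝ] ℝ) :
    ContinuousMultilinearMap ℝ (fun _ : Fin m => V) ℝ where
  toMultilinearMap :=
    ((LinearMap.mul' ℝ ℝ).compMultilinearMap
      (α.toMultilinearMap.domCoprod β.toMultilinearMap)).domDomCongr
        (finSumFinEquiv.trans (finCongr h))
  cont := by
    have : Continuous fun v : Fin m → V =>
        α (fun i => v (Fin.cast h (Fin.castAdd l i))) *
          β (fun i => v (Fin.cast h (Fin.natAdd k i))) := by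
      refine (α.cont.comp ?_).mul (β.cont.comp ?_) <;> fun_prop
    exact this

/-- The wedge product `α ∧ β` of a `k`-form and an `l`-form, `k + l = m`:
`(α ∧ β)(v) = 1/(k! l!) ∑_σ sign σ α(v_σ(1), …, v_σ(k)) β(v_σ(k+1), …, v_σ(m))`. -/
noncomputable def wedge {k l m : ℕ} (h : k + l = m)
    [IsTopologicalAddGroup V] [ContinuousConstSMul ℝ V]
    (α : V [⋀^Fin k]→L[ℝ] ℝ) (β : V [⋀^Fin l]→L[ℝ] ℝ) : V [⋀^Fin m]→L[ℝ] ℝ :=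
  ((k.factorial * l.factorial : ℝ)⁻¹) •
    ContinuousMultilinearMap.alternatization (tensorForm h α β)

/-- Insertion of the vectors `w` into the first `k` slots of the form `η`. -/
noncomputable def contract {k l m : ℕ} (h : k + l = m) (w : Fin k → V)
    (η : V [⋀^Fin m]→L[ℝ] ℝ) : V [⋀^Fin l]→L[ℝ] ℝ where
  toMultilinearMap :=
    (η.toMultilinearMap.domDomCongr (finSumFinEquiv.trans (finCongr h)).symm).currySum w
  cont := by
    have : Continuous fun v : Fin l → V =>
        η (fun i => Sum.rec w v ((finSumFinEquiv.trans (finCongr h)).symm i)) := by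
      refine η.cont.comp (continuous_pi fun i => ?_)
      rcases (finSumFinEquiv.trans (finCongr h)).symm i with a | a
      · exact continuous_const
      · exact continuous_apply a
    exact this
  map_eq_zero_of_eq' := by
    intro v i j hij hne
    refine η.map_eq_zero_of_eq
      (fun s => Sum.rec w v ((finSumFinEquiv.trans (finCongr h)).symm s))
      (i := (finSumFinEquiv.trans (finCongr h)) (Sum.inr i))
      (j := (finSumFinEquiv.trans (finCongr h)) (Sum.inr j)) ?_ ?_
    · simpa only [Equiv.symm_apply_apply] using hij
    · intro hc
      exact hne (Sum.inr_injective ((finSumFinEquiv.trans (finCongr h)).injective hc))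

/-- `b` is an orthonormal family for the scalar product `g`. -/
def IsOrthonormalFrame {m : ℕ} (g : V → V → ℝ) (b : Fin m → V) : Prop :=
  ∀ i j, g (b i) (b j) = if i = j then 1 else 0

/-- Some `g`-orthonormal family of `m` vectors (a basis if `V` has dimension `m`). -/
noncomputable def someFrame (m : ℕ) (g : V → V → ℝ) : Fin m → V :=
  @Classical.epsilon (Fin m → V) ⟨0⟩ (fun b => IsOrthonormalFrame g b)

/-- The Hodge star of a `k`-form on an oriented Euclidean space of dimension `m = k + l` with
scalar product `g` and volume form `vol`:
`(∗α)(v) = 1/k! ∑_{i₁,…,i_k} α(b_{i₁}, …, b_{i_k}) vol(b_{i₁}, …, b_{i_k}, v₁, …, v_l)`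
for an orthonormal basis `b` (the value does not depend on `b`), so that
`α ∧ ∗β = ⟨α, β⟩ vol`. -/
noncomputable def hodge {k l m : ℕ} (h : k + l = m)
    [IsTopologicalAddGroup V] [ContinuousConstSMul ℝ V]
    (g : V → V → ℝ) (vol : V [⋀^Fin m]→L[ℝ] ℝ)
    (α : V [⋀^Fin k]→L[ℝ] ℝ) : V [⋀^Fin l]→L[ℝ] ℝ :=
  ((k.factorial : ℝ)⁻¹) • ∑ s : Fin k → Fin m,
    α (fun i => someFrame m g (s i)) • contract h (fun i => someFrame m g (s i)) vol

end Fibre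

/-! ### Differential forms on a manifold (possibly with boundary) -/

section Forms

variable {m : ℕ} {H : Type*} [TopologicalSpace H]
  (I : ModelWithCorners ℝ (EuclideanSpace ℝ (Fin m)) H)
  {M : Type*} [TopologicalSpace M] [ChartedSpace H M]

/-- Differential `k`-forms on `M`, with no regularity imposed. -/
abbrev DForm (M : Type*) [TopologicalSpace M] [ChartedSpace H M] (k : ℕ) : Type _ :=
  ∀ x : M, TangentSpace I x [⋀^Fin k]→L[ℝ] ℝ

/-- Pull-back of a form at the point with coordinates `y` to the coordinate space of the
preferred chart at `x₀`. -/
noncomputable def chartPull {k : ℕ} (x₀ : M) (y : EuclideanSpace ℝ (Fin m))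
    (α : TangentSpace I ((extChartAt I x₀).symm y) [⋀^Fin k]→L[ℝ] ℝ) :
    EuclideanSpace ℝ (Fin m) [⋀^Fin k]→L[ℝ] ℝ :=
  α.compContinuousLinearMap
    (mfderivWithin 𝓘(ℝ, EuclideanSpace ℝ (Fin m)) I (extChartAt I x₀).symm (Set.range I) y)

/-- The expression of the form `η` in the preferred chart at `x₀`. -/
noncomputable def chartRep {k : ℕ} (η : DForm I M k) (x₀ : M) (y : EuclideanSpace ℝ (Fin m)) :
    EuclideanSpace ℝ (Fin m) [⋀^Fin k]→L[ℝ] ℝ :=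
  chartPull I x₀ y (η ((extChartAt I x₀).symm y))

/-- `η` is a smooth form, that is, `η ∈ Ω^k(M)`. -/
def SmoothForm {k : ℕ} (η : DForm I M k) : Prop :=
  ∀ x₀ : M, ContDiffOn ℝ ∞ (chartRep I η x₀) (extChartAt I x₀).target

/-- `t ↦ η t` is a curve of `k`-forms depending smoothly on `(t, x)`, for `t ∈ J`. -/
def SmoothCurve {k : ℕ} (J : Set ℝ) (η : ℝ → DForm I M k) : Prop :=
  ∀ x₀ : M, ContDiffOn ℝ ∞
    (fun z : ℝ × EuclideanSpace ℝ (Fin m) => chartRep I (η z.1) x₀ z.2)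
    (J ×ˢ (extChartAt I x₀).target)

/-- The time derivative `∂η/∂t` of a curve of forms. -/
noncomputable def timeDeriv {k : ℕ} (η : ℝ → DForm I M k) (t : ℝ) : DForm I M k :=
  fun x => deriv (fun s => η s x) t

/-- A smooth field of linear endomorphisms of the spaces of `k`-covectors. -/
def SmoothEndo {k : ℕ}
    (T : ∀ x : M, (TangentSpace I x [⋀^Fin k]→L[ℝ] ℝ) →ₗ[ℝ]
      (TangentSpace I x [⋀^Fin k]→L[ℝ] ℝ)) : Prop :=
  ∀ (x₀ : M) (β : EuclideanSpace ℝ (Fin m) [⋀^Fin k]→L[ℝ] ℝ),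
    ContDiffOn ℝ ∞
      (fun y => chartPull I x₀ y (T ((extChartAt I x₀).symm y)
        (β.compContinuousLinearMap
          (mfderiv I 𝓘(ℝ, EuclideanSpace ℝ (Fin m)) (extChartAt I x₀)
            ((extChartAt I x₀).symm y)))))
      (extChartAt I x₀).target

/-- The exterior derivative of a `k`-form, computed at `x` in the preferred chart at `x`. -/
noncomputable def extD {k l : ℕ} (h : k + 1 = l) (η : DForm I M k) : DForm I M l :=
  fun x => h ▸ (extDerivWithin (chartRep I η x) (Set.range I)
    (extChartAt I x x)).compContinuousLinearMap
      (mfderiv I 𝓘(ℝ, EuclideanSpace ℝ (Fin m)) (extChartAt I x) x)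

/-- The wedge product of differential forms. -/
noncomputable def wedgeForm {k l j : ℕ} (h : k + l = j) (α : DForm I M k) (β : DForm I M l) :
    DForm I M j :=
  fun x => wedge h (α x) (β x)

/-- A smooth partition of unity subordinate to the domains of the preferred charts. -/
noncomputable def chartPartition (M : Type*) [TopologicalSpace M] [ChartedSpace H M]
    [IsManifold I ∞ M] [T2Space M] [SigmaCompactSpace M] :
    SmoothPartitionOfUnity M I M Set.univ :=
  Classical.choose (SmoothPartitionOfUnity.exists_isSubordinate_chartAt_source I M)

/-- The integral of a form of top degree over `M` with the orientation given by the nowhere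
vanishing top form `vol`: with a partition of unity `ρ`, it is the sum over the charts of the
integrals of `ρ η` in coordinates, each coordinate frame being counted with the sign of `vol`. -/
noncomputable def integralForm [IsManifold I ∞ M] [T2Space M] [SigmaCompactSpace M]
    (vol η : DForm I M m) : ℝ :=
  ∑ᶠ x₀ : M, ∫ y in (extChartAt I x₀).target,
    chartPartition I M x₀ ((extChartAt I x₀).symm y) *
      (Real.sign (chartRep I vol x₀ y (fun i => EuclideanSpace.single i 1)) *
        chartRep I η x₀ y (fun i => EuclideanSpace.single i 1))

end Forms

/-! ### Oriented Riemannian manifolds with boundary -/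

section Geometry

variable (n : ℕ) [NeZero n]
  (Z : Type*) [TopologicalSpace Z] [ChartedSpace (EuclideanHalfSpace n) Z]
  [IsManifold (𝓡∂ n) ∞ Z]
  (B : Type*) [TopologicalSpace B] [ChartedSpace (EuclideanSpace ℝ (Fin (n - 1))) B]

/-- The structure of an oriented Riemannian `n`-manifold with boundary on `Z`, the orientation
being given by its Riemannian volume form, and the identification of the `(n-1)`-manifold `B` with
the boundary `∂Z`, as an embedded submanifold of `Z`. -/
structure RiemannianDomain where
  /-- the Riemannian metric -/
  g : Bundle.ContMDiffRiemannianMetric (𝓡∂ n) ∞ (EuclideanSpace ℝ (Fin n))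
    (fun x : Z => TangentSpace (𝓡∂ n) x)
  /-- the Riemannian volume form -/
  vol : DForm (𝓡∂ n) Z n
  vol_smooth : SmoothForm (𝓡∂ n) vol
  vol_unit : ∀ (x : Z) (b : Fin n → TangentSpace (𝓡∂ n) x),
    IsOrthonormalFrame (fun v w => g.inner x v w) b → |vol x b| = 1
  /-- the inclusion of the boundary -/
  incl : B → Z
  incl_smooth : ContMDiff (𝓡 (n - 1)) (𝓡∂ n) ∞ incl
  incl_embedding : Topology.IsEmbedding incl
  incl_immersion : ∀ x : B,
    Function.Injective (mfderiv (𝓡 (n - 1)) (𝓡∂ n) incl x)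
  range_incl : Set.range incl = (𝓡∂ n).boundary Z

variable {n Z B}

namespace RiemannianDomain

variable (X : RiemannianDomain n Z B)

/-- The differential of the inclusion of the boundary. -/
noncomputable def dincl (x : B) :
    TangentSpace (𝓡 (n - 1)) x →L[ℝ] TangentSpace (𝓡∂ n) (X.incl x) :=
  mfderiv (𝓡 (n - 1)) (𝓡∂ n) X.incl x

/-- The induced metric of the boundary. -/
noncomputable def bdryMetric (x : B) :
    TangentSpace (𝓡 (n - 1)) x → TangentSpace (𝓡 (n - 1)) x → ℝ :=
  fun v w => X.g.inner (X.incl x) (X.dincl x v) (X.dincl x w)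

/-- `ν` is the outward unit normal at the boundary point `x`. In a boundary chart, `Z` is the
half space of points with nonnegative coordinate of index `0`. -/
def IsOutwardUnitNormal (x : B) (ν : TangentSpace (𝓡∂ n) (X.incl x)) : Prop :=
  X.g.inner (X.incl x) ν ν = 1 ∧
  (∀ w : TangentSpace (𝓡 (n - 1)) x, X.g.inner (X.incl x) ν (X.dincl x w) = 0) ∧
  (show EuclideanSpace ℝ (Fin n) from
    mfderiv (𝓡∂ n) 𝓘(ℝ, EuclideanSpace ℝ (Fin n)) (extChartAt (𝓡∂ n) (X.incl x)) (X.incl x) ν)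
      0 < 0

/-- The outward unit normal at the boundary point `x`. -/
noncomputable def normal (x : B) : TangentSpace (𝓡∂ n) (X.incl x) :=
  @Classical.epsilon _ ⟨0⟩ (X.IsOutwardUnitNormal x)

/-- The restriction (pull-back) of a form on `Z` to the boundary. -/
noncomputable def restrict {k : ℕ} (η : DForm (𝓡∂ n) Z k) : DForm (𝓡 (n - 1)) B k :=
  fun x => (η (X.incl x)).compContinuousLinearMap (X.dincl x)

/-- The volume form of the boundary with the induced (Stokes) orientation:
the outward unit normal is inserted in the first slot of the volume form of `Z`. -/
noncomputable def bdryVol : DForm (𝓡 (n - 1)) B (n - 1) :=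
  fun x => (contract (Nat.add_sub_cancel' (NeZero.one_le (n := n))) (fun _ : Fin 1 => X.normal x)
    (X.vol (X.incl x))).compContinuousLinearMap (X.dincl x)

/-- The Hodge star of `Z`. -/
noncomputable def star {k l : ℕ} (h : k + l = n) (η : DForm (𝓡∂ n) Z k) : DForm (𝓡∂ n) Z l :=
  fun x => hodge h (fun v w => X.g.inner x v w) (X.vol x) (η x)

/-- The Hodge star of the boundary. -/
noncomputable def starB {k l : ℕ} (h : k + l = n - 1) (η : DForm (𝓡 (n - 1)) B k) :
    DForm (𝓡 (n - 1)) B l :=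
  fun x => hodge h (X.bdryMetric x) (X.bdryVol x) (η x)

/-- The pairing `⟨β | α⟩ = ∫_Z β ∧ α`. -/
noncomputable def pair [T2Space Z] [CompactSpace Z] {k l : ℕ} (h : k + l = n)
    (β : DForm (𝓡∂ n) Z k) (α : DForm (𝓡∂ n) Z l) : ℝ :=
  integralForm (𝓡∂ n) X.vol (wedgeForm (𝓡∂ n) h β α)

/-- The pairing `⟨β | α⟩ = ∫_{∂Z} β ∧ α`. -/
noncomputable def pairB [IsManifold (𝓡 (n - 1)) ∞ B] [T2Space B] [CompactSpace B]
    {k l : ℕ} (h : k + l = n - 1)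
    (β : DForm (𝓡 (n - 1)) B k) (α : DForm (𝓡 (n - 1)) B l) : ℝ :=
  integralForm (𝓡 (n - 1)) X.bdryVol (wedgeForm (𝓡 (n - 1)) h β α)

end RiemannianDomain

end Geometry

/-! ### The port-Hamiltonian system, its Brayton–Moser form and the Dirac structure -/

section System

variable {n : ℕ} [NeZero n]
  {Z : Type*} [TopologicalSpace Z] [ChartedSpace (EuclideanHalfSpace n) Z]
  [IsManifold (𝓡∂ n) ∞ Z]
  {B : Type*} [TopologicalSpace B] [ChartedSpace (EuclideanSpace ℝ (Fin (n - 1))) B]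

/-- The data of the system: degrees `p, q ≤ n` of the energy variables with `p + q = n + 1`,
nonzero constants `ε, μ` relating energy and co-energy variables, and the linear symmetric
dissipation maps `G` on `(n-p)`-forms and `R` on `(n-q)`-forms. -/
structure SystemData (X : RiemannianDomain n Z B) where
  p : ℕ
  q : ℕ
  hp : p ≤ n
  hq : q ≤ n
  hpq : p + q = n + 1
  ε : ℝ
  μ : ℝ
  hε : ε ≠ 0
  hμ : μ ≠ 0
  G : ∀ x : Z, (TangentSpace (𝓡∂ n) x [⋀^Fin (n - p)]→L[ℝ] ℝ) →ₗ[ℝ]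
    (TangentSpace (𝓡∂ n) x [⋀^Fin (n - p)]→L[ℝ] ℝ)
  R : ∀ x : Z, (TangentSpace (𝓡∂ n) x [⋀^Fin (n - q)]→L[ℝ] ℝ) →ₗ[ℝ]
    (TangentSpace (𝓡∂ n) x [⋀^Fin (n - q)]→L[ℝ] ℝ)
  G_smooth : SmoothEndo (𝓡∂ n) G
  R_smooth : SmoothEndo (𝓡∂ n) R
  G_symm : ∀ x α β, wedge (Nat.sub_add_cancel hp) (G x α)
      (hodge (Nat.sub_add_cancel hp) (fun v w => X.g.inner x v w) (X.vol x) β) =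
    wedge (Nat.sub_add_cancel hp) α
      (hodge (Nat.sub_add_cancel hp) (fun v w => X.g.inner x v w) (X.vol x) (G x β))
  R_symm : ∀ x α β, wedge (Nat.sub_add_cancel hq) (R x α)
      (hodge (Nat.sub_add_cancel hq) (fun v w => X.g.inner x v w) (X.vol x) β) =
    wedge (Nat.sub_add_cancel hq) α
      (hodge (Nat.sub_add_cancel hq) (fun v w => X.g.inner x v w) (X.vol x) (R x β))

namespace SystemData

variable {X : RiemannianDomain n Z B} (S : SystemData X)

lemma np_p : n - S.p + S.p = n := Nat.sub_add_cancel S.hp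
lemma p_np : S.p + (n - S.p) = n := Nat.add_sub_cancel' S.hp
lemma nq_q : n - S.q + S.q = n := Nat.sub_add_cancel S.hq
lemma q_nq : S.q + (n - S.q) = n := Nat.add_sub_cancel' S.hq
lemma np_succ : n - S.p + 1 = S.q := by have := S.hp; have := S.hpq; omega
lemma nq_succ : n - S.q + 1 = S.p := by have := S.hq; have := S.hpq; omega
lemma np_nq : (n - S.p) + (n - S.q) = n - 1 := by
  have := S.hp; have := S.hq; have := S.hpq; omega
lemma nq_np : (n - S.q) + (n - S.p) = n - 1 := by
  have := S.hp; have := S.hq; have := S.hpq; omega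

/-- The space of flows
`ℱ = Ω^{n-p}(Z) × Ω^{n-q}(Z) × Ω^{n-p}(∂Z) × Ω^{n-q}(∂Z)` (smoothness is imposed separately). -/
abbrev Flow (_S : SystemData X) : Type _ :=
  DForm (𝓡∂ n) Z (n - _S.p) × DForm (𝓡∂ n) Z (n - _S.q) ×
    DForm (𝓡 (n - 1)) B (n - _S.p) × DForm (𝓡 (n - 1)) B (n - _S.q)

/-- The space of efforts `ℰ = ℱ* = Ω^p(Z) × Ω^q(Z) × Ω^{n-q}(∂Z) × Ω^{n-p}(∂Z)`. -/
abbrev Effort (_S : SystemData X) : Type _ :=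
  DForm (𝓡∂ n) Z _S.p × DForm (𝓡∂ n) Z _S.q ×
    DForm (𝓡 (n - 1)) B (n - _S.q) × DForm (𝓡 (n - 1)) B (n - _S.p)

/-- Smoothness of a flow. -/
def SmoothFlow (f : S.Flow) : Prop :=
  SmoothForm (𝓡∂ n) f.1 ∧ SmoothForm (𝓡∂ n) f.2.1 ∧
    SmoothForm (𝓡 (n - 1)) f.2.2.1 ∧ SmoothForm (𝓡 (n - 1)) f.2.2.2

/-- Smoothness of an effort. -/
def SmoothEffort (e : S.Effort) : Prop :=
  SmoothForm (𝓡∂ n) e.1 ∧ SmoothForm (𝓡∂ n) e.2.1 ∧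
    SmoothForm (𝓡 (n - 1)) e.2.2.1 ∧ SmoothForm (𝓡 (n - 1)) e.2.2.2

/-- `∗ : ℰ → ℱ`, componentwise. -/
noncomputable def starE (e : S.Effort) : S.Flow :=
  (X.star S.p_np e.1, X.star S.q_nq e.2.1, X.starB S.nq_np e.2.2.1, X.starB S.np_nq e.2.2.2)

/-- `∗ : ℱ → ℰ`, componentwise. -/
noncomputable def starF (f : S.Flow) : S.Effort :=
  (X.star S.np_p f.1, X.star S.nq_q f.2.1, X.starB S.np_nq f.2.2.1, X.starB S.nq_np f.2.2.2)

/-- The operator `𝒜 = diag(ε, -μ, 0, 0) : ℱ → ℱ`. -/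
noncomputable def opA (f : S.Flow) : S.Flow := (S.ε • f.1, (-S.μ) • f.2.1, 0, 0)

/-- The operator `B = [0 0 I 0]ᵀ`. -/
noncomputable def opB (v : DForm (𝓡 (n - 1)) B (n - S.p)) : S.Flow := (0, 0, v, 0)

/-- The operator `Bᵀ`. -/
def opBT (f : S.Flow) : DForm (𝓡 (n - 1)) B (n - S.p) := f.2.2.1

/-- Elements `(f, f_y, e, e_u)` of `ℱ × 𝒴 × ℰ × 𝒮` with `𝒴 = Ω^{n-q}(∂Z)` and
`𝒮 = Ω^{n-p}(∂Z)`. -/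
structure Bond (_S : SystemData X) where
  f : _S.Flow
  fy : DForm (𝓡 (n - 1)) B (n - _S.q)
  e : _S.Effort
  eu : DForm (𝓡 (n - 1)) B (n - _S.p)

/-- All components are smooth forms. -/
def SmoothBond (x : S.Bond) : Prop :=
  S.SmoothFlow x.f ∧ SmoothForm (𝓡 (n - 1)) x.fy ∧ S.SmoothEffort x.e ∧
    SmoothForm (𝓡 (n - 1)) x.eu

/-- The subspace `𝒟 = {(f, f_y, e, e_u) : -𝒜f = ∗e + B e_u, f_y = ∗Bᵀf}`. -/
def dirac : Set S.Bond :=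
  {x | S.SmoothBond x ∧ -S.opA x.f = S.starE x.e + S.opB x.eu ∧
    x.fy = X.starB S.np_nq (S.opBT x.f)}

variable [T2Space Z] [CompactSpace Z] [IsManifold (𝓡 (n - 1)) ∞ B] [T2Space B] [CompactSpace B]

/-- The pairing `⟨e | f⟩` of efforts and flows, `∫_{Z + ∂Z} e ∧ f`. -/
noncomputable def pairEF (e : S.Effort) (f : S.Flow) : ℝ :=
  X.pair S.p_np e.1 f.1 + X.pair S.q_nq e.2.1 f.2.1 +
    X.pairB S.nq_np e.2.2.1 f.2.2.1 + X.pairB S.np_nq e.2.2.2 f.2.2.2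

/-- The integral `∫_{Z + ∂Z} f ∧ e`. -/
noncomputable def pairFE (f : S.Flow) (e : S.Effort) : ℝ :=
  X.pair S.np_p f.1 e.1 + X.pair S.nq_q f.2.1 e.2.1 +
    X.pairB S.np_nq f.2.2.1 e.2.2.1 + X.pairB S.nq_np f.2.2.2 e.2.2.2

/-- The noncanonical bilinear form
`⟨e¹|f²⟩ + ⟨e²|f¹⟩ + ∫_{Z+∂Z} (f¹ ∧ ∗𝒜f² + f² ∧ ∗𝒜f¹) + ⟨e_u¹|f_y²⟩ + ⟨e_u²|f_y¹⟩`. -/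
noncomputable def bilin (x y : S.Bond) : ℝ :=
  S.pairEF x.e y.f + S.pairEF y.e x.f +
    (S.pairFE x.f (S.starF (S.opA y.f)) + S.pairFE y.f (S.starF (S.opA x.f))) +
    X.pairB S.np_nq x.eu y.fy + X.pairB S.np_nq y.eu x.fy

/-- The orthogonal complement of a set with respect to the noncanonical bilinear form. -/
def orthogonal (D : Set S.Bond) : Set S.Bond :=
  {x | S.SmoothBond x ∧ ∀ y ∈ D, S.bilin x y = 0}

/-- The mixed potential
`P(e_p, e_q) = ∫_Z (e_q ∧ d e_p + ½ R e_q ∧ ∗e_q - ½ G e_p ∧ ∗e_p)`. -/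
noncomputable def mixedPotential (ep : DForm (𝓡∂ n) Z (n - S.p))
    (eq : DForm (𝓡∂ n) Z (n - S.q)) : ℝ :=
  integralForm (𝓡∂ n) X.vol
    (wedgeForm (𝓡∂ n) S.nq_q eq (extD (𝓡∂ n) S.np_succ ep) +
      (1 / 2 : ℝ) • wedgeForm (𝓡∂ n) S.nq_q (fun x => S.R x (eq x)) (X.star S.nq_q eq) -
      (1 / 2 : ℝ) • wedgeForm (𝓡∂ n) S.np_p (fun x => S.G x (ep x)) (X.star S.np_p ep))

/-- The Hamiltonian
`H(α_p, α_q) = ½ ∫_Z (ε⁻¹ α_p ∧ ∗α_p + μ⁻¹ α_q ∧ ∗α_q)`, for which the co-energy variables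
`e_p = δ_p H` and `e_q = δ_q H` satisfy `α_p = ∗ ε e_p` and `α_q = ∗ μ e_q`. -/
noncomputable def hamiltonian (αp : DForm (𝓡∂ n) Z S.p) (αq : DForm (𝓡∂ n) Z S.q) : ℝ :=
  (1 / 2 : ℝ) * (S.ε⁻¹ * X.pair S.p_np αp (X.star S.p_np αp) +
    S.μ⁻¹ * X.pair S.q_nq αq (X.star S.q_nq αq))

/-- `δ` is the variational derivative at `(e_p, e_q)` of the functional `Φ`, including its
boundary components: for all smooth variations `w_p, w_q`, the first variation of `Φ` is
`∫_Z (δ_{e_p}Φ ∧ w_p + δ_{e_q}Φ ∧ w_q) + ∫_{∂Z} (δ_{e_p|∂}Φ ∧ w_p + δ_{e_q|∂}Φ ∧ w_q)`. -/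
def IsVarDeriv (Φ : DForm (𝓡∂ n) Z (n - S.p) → DForm (𝓡∂ n) Z (n - S.q) → ℝ)
    (ep : DForm (𝓡∂ n) Z (n - S.p)) (eq : DForm (𝓡∂ n) Z (n - S.q)) (δ : S.Effort) : Prop :=
  S.SmoothEffort δ ∧
  ∀ (wp : DForm (𝓡∂ n) Z (n - S.p)) (wq : DForm (𝓡∂ n) Z (n - S.q)),
    SmoothForm (𝓡∂ n) wp → SmoothForm (𝓡∂ n) wq →
    HasDerivAt (fun s : ℝ => Φ (ep + s • wp) (eq + s • wq))
      (S.pairEF δ (wp, wq, X.restrict wp, X.restrict wq)) 0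

/-- The variational derivative `δ_U P` of the mixed potential at `(e_p, e_q)`. -/
noncomputable def varDerivP (ep : DForm (𝓡∂ n) Z (n - S.p)) (eq : DForm (𝓡∂ n) Z (n - S.q)) :
    S.Effort :=
  @Classical.epsilon S.Effort ⟨0⟩ (S.IsVarDeriv S.mixedPotential ep eq)

/-- `δ = (δ_p H, δ_q H)` is the variational derivative of the Hamiltonian at `(α_p, α_q)`. -/
def IsVarDerivH (αp : DForm (𝓡∂ n) Z S.p) (αq : DForm (𝓡∂ n) Z S.q)
    (δ : DForm (𝓡∂ n) Z (n - S.p) × DForm (𝓡∂ n) Z (n - S.q)) : Prop :=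
  SmoothForm (𝓡∂ n) δ.1 ∧ SmoothForm (𝓡∂ n) δ.2 ∧
  ∀ (wp : DForm (𝓡∂ n) Z S.p) (wq : DForm (𝓡∂ n) Z S.q),
    SmoothForm (𝓡∂ n) wp → SmoothForm (𝓡∂ n) wq →
    HasDerivAt (fun s : ℝ => S.hamiltonian (αp + s • wp) (αq + s • wq))
      (X.pair S.np_p δ.1 wp + X.pair S.nq_q δ.2 wq) 0

/-- The variational derivative of the Hamiltonian. -/
noncomputable def varDerivH (αp : DForm (𝓡∂ n) Z S.p) (αq : DForm (𝓡∂ n) Z S.q) :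
    DForm (𝓡∂ n) Z (n - S.p) × DForm (𝓡∂ n) Z (n - S.q) :=
  @Classical.epsilon _ ⟨0⟩ (S.IsVarDerivH αp αq)

/-- The port-Hamiltonian system on the Stokes–Dirac structure, with `r = pq + 1`:
`-∂α_p/∂t = ∗G δ_pH + (-1)^r d δ_qH`, `-∂α_q/∂t = d δ_pH + ∗R δ_qH`,
`f_b = δ_pH|_{∂Z}`, `e_b = -(-1)^{n-q} δ_qH|_{∂Z}`. -/
def IsPortHamiltonian (J : Set ℝ)
    (αp : ℝ → DForm (𝓡∂ n) Z S.p) (αq : ℝ → DForm (𝓡∂ n) Z S.q)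
    (fb : ℝ → DForm (𝓡 (n - 1)) B (n - S.p)) (eb : ℝ → DForm (𝓡 (n - 1)) B (n - S.q)) : Prop :=
  ∀ t ∈ J,
    -timeDeriv (𝓡∂ n) αp t =
        X.star S.np_p (fun x => S.G x ((S.varDerivH (αp t) (αq t)).1 x)) +
          (-1 : ℝ) ^ (S.p * S.q + 1) •
            extD (𝓡∂ n) S.nq_succ (S.varDerivH (αp t) (αq t)).2 ∧
    -timeDeriv (𝓡∂ n) αq t =
        extD (𝓡∂ n) S.np_succ (S.varDerivH (αp t) (αq t)).1 +
          X.star S.nq_q (fun x => S.R x ((S.varDerivH (αp t) (αq t)).2 x)) ∧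
    fb t = X.restrict (S.varDerivH (αp t) (αq t)).1 ∧
    eb t = (-(-1 : ℝ) ^ (n - S.q)) • X.restrict (S.varDerivH (αp t) (αq t)).2

/-- `U_t`, the time derivative of `U = (e_p, e_q, e_p|_{∂Z}, e_q|_{∂Z})`. -/
noncomputable def timeDerivU (ep : ℝ → DForm (𝓡∂ n) Z (n - S.p))
    (eq : ℝ → DForm (𝓡∂ n) Z (n - S.q)) (t : ℝ) : S.Flow :=
  (timeDeriv (𝓡∂ n) ep t, timeDeriv (𝓡∂ n) eq t,
    timeDeriv (𝓡 (n - 1)) (fun s => X.restrict (ep s)) t,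
    timeDeriv (𝓡 (n - 1)) (fun s => X.restrict (eq s)) t)

/-- The Brayton–Moser equations with boundary ports:
`𝒜 U_t = ∗ δ_U P + B ∗ e_b` and `ḟ_b = Bᵀ U_t`. -/
def IsBraytonMoser (J : Set ℝ)
    (ep : ℝ → DForm (𝓡∂ n) Z (n - S.p)) (eq : ℝ → DForm (𝓡∂ n) Z (n - S.q))
    (fb : ℝ → DForm (𝓡 (n - 1)) B (n - S.p)) (eb : ℝ → DForm (𝓡 (n - 1)) B (n - S.q)) : Prop :=
  ∀ t ∈ J,
    S.opA (S.timeDerivU ep eq t) =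
        S.starE (S.varDerivP (ep t) (eq t)) + S.opB (X.starB S.nq_np (eb t)) ∧
    timeDeriv (𝓡 (n - 1)) fb t = S.opBT (S.timeDerivU ep eq t)

/-- The setting `(f, f_y, e, e_u) = (-U_t, -∗ḟ_b, δ_U P, ∗e_b)`. -/
noncomputable def bondOf
    (ep : ℝ → DForm (𝓡∂ n) Z (n - S.p)) (eq : ℝ → DForm (𝓡∂ n) Z (n - S.q))
    (fb : ℝ → DForm (𝓡 (n - 1)) B (n - S.p)) (eb : ℝ → DForm (𝓡 (n - 1)) B (n - S.q))
    (t : ℝ) : S.Bond where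
  f := -S.timeDerivU ep eq t
  fy := -X.starB S.np_nq (timeDeriv (𝓡 (n - 1)) fb t)
  e := S.varDerivP (ep t) (eq t)
  eu := X.starB S.nq_np (eb t)

/-- The supplied power
`∫_Z u_t ∧ ∗A u_t - ∫_{∂Z} e_b ∧ ḟ_b` with `u = (e_p, e_q)` and `A = diag(ε, -μ)`. -/
noncomputable def power
    (ep : ℝ → DForm (𝓡∂ n) Z (n - S.p)) (eq : ℝ → DForm (𝓡∂ n) Z (n - S.q))
    (fb : ℝ → DForm (𝓡 (n - 1)) B (n - S.p)) (eb : ℝ → DForm (𝓡 (n - 1)) B (n - S.q))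
    (t : ℝ) : ℝ :=
  (X.pair S.np_p (timeDeriv (𝓡∂ n) ep t) (X.star S.np_p (S.ε • timeDeriv (𝓡∂ n) ep t)) +
    X.pair S.nq_q (timeDeriv (𝓡∂ n) eq t)
      (X.star S.nq_q ((-S.μ) • timeDeriv (𝓡∂ n) eq t))) -
    X.pairB S.nq_np (eb t) (timeDeriv (𝓡 (n - 1)) fb t)

end SystemData

end System

/-! The theorem rests on three facts about a compact oriented Riemannian manifold with boundary: the
pointwise algebra of the Hodge star (`∗∗ = (-1)^{kl}`, symmetry of `α ∧ ∗β`, `α ∧ ∗α = |α|² vol`),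
Stokes' theorem, and the fundamental lemma of the calculus of variations in the interior and on the
boundary. All objects are defined through choices: the star through an arbitrary orthonormal frame
at each point, `d` and the outward normal in the preferred chart of the point itself, the integral
through a chosen partition of unity. A large part of the proof therefore shows that smoothness and
the expected formulas hold in every chart. For the star this is `IsVolumeForm.hodge_eq_hodgeGram`,
for `d` it is `chartRep_extD`, for the normal `RiemannianDomain.isOutwardUnitNormal_iff`, and for
the integral `integralForm_eq_chart`.

Variational derivatives. The first variation of the mixed potential contains `∫ e_q ∧ d w_p`;
integration by parts (`RiemannianDomain.pair_extD_left`, that is Stokes and the Leibniz rule) moves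
`d` to `e_q` and creates the boundary component. The symmetry of `G`, `R` and of the star absorbs
the factors `1/2`. This yields the explicit derivative `SystemData.gradP`. It is unique because
variations that vanish on the boundary determine the bulk components, after which boundary values of
arbitrary variations determine the boundary components (`SystemData.effort_ext`). The Hamiltonian is
quadratic without derivatives, so only the fundamental lemma is needed there.

Dirac structure. Let `defect x` measure the failure of `-𝒜f = ∗e + B e_u`. For `y` in `𝒟` the
bilinear form collapses to `⟨defect x | f_y-flow⟩` plus the pairing of the input of `y` with the
failure of the output equation of `x` (`SystemData.bilin_eq_of_mem_dirac`). Flow and input of an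
element of `𝒟` can be prescribed freely (`SystemData.exists_mem_dirac`), so orthogonality to `𝒟` is
equivalent to the vanishing of both failures, i.e. to membership in `𝒟`.

Trajectories. After substituting `gradP`, the components of the Brayton–Moser equation are, up to
applying a star and tracking signs, the port-Hamiltonian equations
(`SystemData.braytonMoser_components`); the equation for `ḟ_b` is the time derivative of `f_b =
e_p|_{∂Z}`. Membership of the trajectory in `𝒟` is the same equation with `f = -U_t`. Since the
chain rule gives `Ṗ = ⟨δ_U P | U_t⟩`, the value of the bilinear form on the trajectory is twice the
defect in the power balance, and it vanishes on `𝒟` because `𝒟` is its own orthogonal. -/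

open scoped Topology
open MeasureTheory
set_option linter.unusedSectionVars false

/-! ### Algebra of the wedge product -/

section WedgeAlgebra

open Equiv

variable {V : Type*} [AddCommGroup V] [Module ℝ V] [TopologicalSpace V]
  {W : Type*} [AddCommGroup W] [Module ℝ W] [TopologicalSpace W]

lemma tensorForm_apply {k l m : ℕ} (h : k + l = m)
    (α : V [⋀^Fin k]→L[ℝ] ℝ) (β : V [⋀^Fin l]→L[ℝ] ℝ) (v : Fin m → V) :
    tensorForm h α β v = α (fun i => v (Fin.cast h (Fin.castAdd l i))) *
      β (fun i => v (Fin.cast h (Fin.natAdd k i))) := rfl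

lemma ContinuousAlternatingMap.apply_comp_perm {ι : Type*} [Fintype ι] [DecidableEq ι]
    (η : V [⋀^ι]→L[ℝ] ℝ) (v : ι → V) (σ : Perm ι) :
    η (fun i => v (σ i)) = ((Perm.sign σ : ℤ) : ℝ) * η v := by
  have := η.toAlternatingMap.map_perm v σ
  rw [Units.smul_def, zsmul_eq_mul] at this
  exact this

lemma sign_mul_self_real {ι : Type*} [Fintype ι] [DecidableEq ι] (σ : Perm ι) :
    ((Perm.sign σ : ℤ) : ℝ) * ((Perm.sign σ : ℤ) : ℝ) = 1 := by
  rcases Int.units_eq_one_or (Perm.sign σ) with h | h <;> simp [h]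

/-- The block transposition as a permutation. -/
def blockSwap {k l m : ℕ} (h : k + l = m) (h' : l + k = m) : Perm (Fin m) :=
  (finCongr h).symm.trans (finAddFlip.trans (finCongr h'))

lemma blockSwap_left {k l m : ℕ} (h : k + l = m) (h' : l + k = m) (i : Fin k) :
    blockSwap h h' (Fin.cast h (Fin.castAdd l i)) = Fin.cast h' (Fin.natAdd l i) := by
  subst h; simp [blockSwap]

lemma blockSwap_right {k l m : ℕ} (h : k + l = m) (h' : l + k = m) (i : Fin l) :
    blockSwap h h' (Fin.cast h (Fin.natAdd k i)) = Fin.cast h' (Fin.castAdd k i) := by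
  subst h; simp [blockSwap]

lemma finRotate_pow_val (N l : ℕ) (i : Fin (N + 1)) :
    (((finRotate (N + 1)) ^ l) i : ℕ) = (i + l) % (N + 1) := by
  induction l with
  | zero => simp [Nat.mod_eq_of_lt i.2]
  | succ l ih =>
    rw [pow_succ', Perm.mul_apply, finRotate_apply, Fin.val_add, ih]
    simp [← add_assoc]

/-- The block transposition is the `l`-th power of the cyclic rotation of `N + 1 = k + l` letters,
of sign `(-1)^N`; the exponents `N l` and `k l` differ by the even number `l (l - 1)`. -/
lemma sign_blockSwap {k l m : ℕ} (h : k + l = m) (h' : l + k = m) :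
    ((Perm.sign (blockSwap h h') : ℤ) : ℝ) = (-1) ^ (k * l) := by
  cases m with
  | zero =>
    have hk : k = 0 := by omega
    rw [show blockSwap h h' = 1 from Subsingleton.elim _ _]
    simp [hk]
  | succ N =>
    have : blockSwap h h' = (finRotate (N + 1)) ^ l := by
      ext i
      rw [finRotate_pow_val]
      obtain ⟨j, rfl⟩ : ∃ j, Fin.cast h j = i := ⟨Fin.cast h.symm i, by simp⟩
      induction j using Fin.addCases with
      | left j =>
        rw [blockSwap_left]
        have := j.2
        rw [Nat.mod_eq_of_lt] <;> simp <;> omega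
      | right j =>
        rw [blockSwap_right]
        have := j.2
        have e : (↑(Fin.cast h (Fin.natAdd k j)) + l) = (j : ℕ) + (N + 1) := by simp; omega
        rw [e, Nat.add_mod_right, Nat.mod_eq_of_lt] <;> simp; omega
    rw [this, map_pow, sign_finRotate]
    simp only [Nat.add_sub_cancel, Units.val_pow_eq_pow_val, Units.val_neg, Units.val_one,
      Int.cast_pow, Int.cast_neg, Int.cast_one, ← pow_mul]
    rcases Nat.eq_zero_or_pos l with rfl | hl
    · simp
    · obtain ⟨l, rfl⟩ : ∃ a, l = a + 1 := ⟨l - 1, by omega⟩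
      have : N = k + l := by omega
      subst this
      have e : Even (l * (l + 1)) := Nat.even_mul_succ_self l
      rw [add_mul, pow_add, e.neg_one_pow, mul_one]

variable [IsTopologicalAddGroup V] [ContinuousConstSMul ℝ V]
  [IsTopologicalAddGroup W] [ContinuousConstSMul ℝ W]

lemma wedge_apply {k l m : ℕ} (h : k + l = m)
    (α : V [⋀^Fin k]→L[ℝ] ℝ) (β : V [⋀^Fin l]→L[ℝ] ℝ) (v : Fin m → V) :
    wedge h α β v = ((k.factorial * l.factorial : ℝ)⁻¹) * ∑ σ : Perm (Fin m),
      ((Perm.sign σ : ℤ) : ℝ) * (α (fun i => v (σ (Fin.cast h (Fin.castAdd l i)))) *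
      β (fun i => v (σ (Fin.cast h (Fin.natAdd k i))))) := by
  simp only [wedge, ContinuousAlternatingMap.smul_apply, smul_eq_mul,
    ContinuousMultilinearMap.alternatization_apply_apply, tensorForm_apply, Units.smul_def,
    zsmul_eq_mul, Function.comp_apply]

lemma wedge_add_left {k l m : ℕ} (h : k + l = m)
    (α α' : V [⋀^Fin k]→L[ℝ] ℝ) (β : V [⋀^Fin l]→L[ℝ] ℝ) :
    wedge h (α + α') β = wedge h α β + wedge h α' β := by
  ext v
  simp only [wedge_apply, ContinuousAlternatingMap.add_apply, ← mul_add, ← Finset.sum_add_distrib,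
    add_mul]

lemma wedge_add_right {k l m : ℕ} (h : k + l = m)
    (α : V [⋀^Fin k]→L[ℝ] ℝ) (β β' : V [⋀^Fin l]→L[ℝ] ℝ) :
    wedge h α (β + β') = wedge h α β + wedge h α β' := by
  ext v
  simp only [wedge_apply, ContinuousAlternatingMap.add_apply, ← mul_add, ← Finset.sum_add_distrib]

lemma wedge_smul_left {k l m : ℕ} (h : k + l = m) (c : ℝ)
    (α : V [⋀^Fin k]→L[ℝ] ℝ) (β : V [⋀^Fin l]→L[ℝ] ℝ) :
    wedge h (c • α) β = c • wedge h α β := by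
  ext v
  simp only [wedge_apply, ContinuousAlternatingMap.smul_apply, smul_eq_mul]
  rw [mul_left_comm c, Finset.mul_sum (a := c)]
  exact congrArg _ (Finset.sum_congr rfl fun σ _ => by ring)

lemma wedge_smul_right {k l m : ℕ} (h : k + l = m) (c : ℝ)
    (α : V [⋀^Fin k]→L[ℝ] ℝ) (β : V [⋀^Fin l]→L[ℝ] ℝ) :
    wedge h α (c • β) = c • wedge h α β := by
  ext v
  simp only [wedge_apply, ContinuousAlternatingMap.smul_apply, smul_eq_mul]
  rw [mul_left_comm c, Finset.mul_sum (a := c)]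
  exact congrArg _ (Finset.sum_congr rfl fun σ _ => by ring)

/-- The wedge product as a bilinear map. -/
noncomputable def wedgeBilin (V : Type*) [AddCommGroup V] [Module ℝ V] [TopologicalSpace V]
    [IsTopologicalAddGroup V] [ContinuousConstSMul ℝ V] {k l m : ℕ} (h : k + l = m) :
    (V [⋀^Fin k]→L[ℝ] ℝ) →ₗ[ℝ] (V [⋀^Fin l]→L[ℝ] ℝ) →ₗ[ℝ] (V [⋀^Fin m]→L[ℝ] ℝ) :=
  LinearMap.mk₂ ℝ (wedge h) (wedge_add_left h) (wedge_smul_left h) (wedge_add_right h)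
    (wedge_smul_right h)

lemma wedge_comp {k l m : ℕ} (h : k + l = m) (f : W →L[ℝ] V)
    (α : V [⋀^Fin k]→L[ℝ] ℝ) (β : V [⋀^Fin l]→L[ℝ] ℝ) :
    (wedge h α β).compContinuousLinearMap f =
      wedge h (α.compContinuousLinearMap f) (β.compContinuousLinearMap f) := by
  ext v
  simp only [wedge_apply, ContinuousAlternatingMap.compContinuousLinearMap_apply]
  rfl

/-- Reindexing the sum over permutations by right translation with `blockSwap` exchanges the two
blocks in every summand and brings out the sign of the transposition. -/
lemma wedge_comm {k l m : ℕ} (h : k + l = m) (h' : l + k = m)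
    (α : V [⋀^Fin k]→L[ℝ] ℝ) (β : V [⋀^Fin l]→L[ℝ] ℝ) :
    wedge h α β = (-1 : ℝ) ^ (k * l) • wedge h' β α := by
  ext v
  simp only [wedge_apply, ContinuousAlternatingMap.smul_apply, smul_eq_mul]
  rw [mul_left_comm, mul_comm (k.factorial : ℝ)]
  congr 1
  rw [Finset.mul_sum, ← sign_blockSwap h h',
    ← Equiv.sum_comp (Equiv.mulRight (blockSwap h h'))]
  refine Finset.sum_congr rfl fun σ _ => ?_
  simp only [Equiv.coe_mulRight, Perm.mul_apply, blockSwap_left, blockSwap_right, map_mul,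
    Units.val_mul, Int.cast_mul]
  ring

end WedgeAlgebra

/-! ### The Hodge star relative to a basis -/

section HodgeAlgebra

open Equiv

variable {V : Type*} [AddCommGroup V] [Module ℝ V] [TopologicalSpace V]
  {W : Type*} [AddCommGroup W] [Module ℝ W] [TopologicalSpace W]

lemma contract_apply {k l m : ℕ} (h : k + l = m) (w : Fin k → V)
    (η : V [⋀^Fin m]→L[ℝ] ℝ) (v : Fin l → V) :
    contract h w η v = η (fun i => Fin.append w v (Fin.cast h.symm i)) := by
  subst h
  have : (contract rfl w η v : ℝ) = η (fun i => Sum.rec (motive := fun _ => V) w v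
    ((finSumFinEquiv.trans (finCongr rfl)).symm i)) := rfl
  rw [this]
  congr 1
  ext i
  induction i using Fin.addCases <;> simp

lemma contract_apply_append {k l m : ℕ} (h : k + l = m) {ι : Type*} (b : ι → V) (s : Fin k → ι)
    (t : Fin l → ι) (η : V [⋀^Fin m]→L[ℝ] ℝ) :
    contract h (fun i => b (s i)) η (fun i => b (t i)) =
      η (fun i => b (Fin.append s t (Fin.cast h.symm i))) := by
  subst h
  rw [contract_apply]
  congr 1
  ext i
  induction i using Fin.addCases <;> simp

lemma contract_add {k l m : ℕ} (h : k + l = m) (w : Fin k → V) (η η' : V [⋀^Fin m]→L[ℝ] ℝ)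
    [IsTopologicalAddGroup V] :
    contract h w (η + η') = contract h w η + contract h w η' := by
  ext v; simp [contract_apply]

lemma contract_smul {k l m : ℕ} (h : k + l = m) (w : Fin k → V) (c : ℝ) (η : V [⋀^Fin m]→L[ℝ] ℝ)
    [ContinuousConstSMul ℝ V] :
    contract h w (c • η) = c • contract h w η := by
  ext v; simp [contract_apply]

lemma contract_comp {k l m : ℕ} (h : k + l = m) (f : W →L[ℝ] V) (w : Fin k → W)
    (η : V [⋀^Fin m]→L[ℝ] ℝ) :
    (contract h (fun i => f (w i)) η).compContinuousLinearMap f =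
      contract h w (η.compContinuousLinearMap f) := by
  ext v
  subst h
  simp only [ContinuousAlternatingMap.compContinuousLinearMap_apply, contract_apply]
  congr 1
  ext i
  induction i using Fin.addCases <;> simp

variable [IsTopologicalAddGroup V] [ContinuousConstSMul ℝ V]
  [IsTopologicalAddGroup W] [ContinuousConstSMul ℝ W]

/-- The Hodge star computed with the family `b`. -/
noncomputable def hodgeWith {k l m : ℕ} (h : k + l = m) (b : Fin m → V)
    (vol : V [⋀^Fin m]→L[ℝ] ℝ) (α : V [⋀^Fin k]→L[ℝ] ℝ) : V [⋀^Fin l]→L[ℝ] ℝ :=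
  ((k.factorial : ℝ)⁻¹) • ∑ s : Fin k → Fin m,
    α (fun i => b (s i)) • contract h (fun i => b (s i)) vol

lemma hodge_eq_hodgeWith {k l m : ℕ} (h : k + l = m) (g : V → V → ℝ)
    (vol : V [⋀^Fin m]→L[ℝ] ℝ) (α : V [⋀^Fin k]→L[ℝ] ℝ) :
    hodge h g vol α = hodgeWith h (someFrame m g) vol α := rfl

lemma hodgeWith_apply {k l m : ℕ} (h : k + l = m) (b : Fin m → V)
    (vol : V [⋀^Fin m]→L[ℝ] ℝ) (α : V [⋀^Fin k]→L[ℝ] ℝ) (v : Fin l → V) :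
    hodgeWith h b vol α v = ((k.factorial : ℝ)⁻¹) * ∑ s : Fin k → Fin m,
      α (fun i => b (s i)) * contract h (fun i => b (s i)) vol v := by
  simp [hodgeWith, ContinuousAlternatingMap.sum_apply]

lemma contract_perm {k l m : ℕ} (h : k + l = m) (w : Fin k → V) (v : Fin l → V)
    (η : V [⋀^Fin m]→L[ℝ] ℝ) (π : Perm (Fin k)) :
    contract h (fun i => w (π i)) η v = ((Perm.sign π : ℤ) : ℝ) * contract h w η v := by
  subst h
  have key : ((Perm.sign π : ℤ) : ℝ) =
      ((Perm.sign (finSumFinEquiv.permCongr (Perm.sumCongr π (1 : Perm (Fin l)))) : ℤ) : ℝ) := by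
    rw [Perm.sign_permCongr, Perm.sign_sumCongr]; simp
  rw [contract_apply, contract_apply, key, ← ContinuousAlternatingMap.apply_comp_perm]
  congr 1
  ext i
  induction i using Fin.addCases <;> simp [Equiv.permCongr_apply]

/-- In the sum defining the star, the second block of `σ` is already occupied, so only the `k!`
enumerations of the first block survive. They contribute equally, since the signs from the form and
from `vol` cancel, and `k!` cancels the normalisation. All identities for the star are derived from
this evaluation. -/
lemma hodgeWith_apply_perm {k l m : ℕ} (h : k + l = m) (b : Fin m → V)
    (vol : V [⋀^Fin m]→L[ℝ] ℝ) (β : V [⋀^Fin k]→L[ℝ] ℝ) (σ : Perm (Fin m)) :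
    hodgeWith h b vol β (fun j => b (σ (Fin.cast h (Fin.natAdd k j)))) =
      ((Perm.sign σ : ℤ) : ℝ) * vol b * β (fun i => b (σ (Fin.cast h (Fin.castAdd l i)))) := by
  subst h
  simp only [Fin.cast_eq_self]
  rw [hodgeWith_apply]
  have key : ∑ s : Fin k → Fin (k + l), β (fun i => b (s i)) *
        contract rfl (fun i => b (s i)) vol (fun j => b (σ (Fin.natAdd k j))) =
      ∑ _π : Perm (Fin k), ((Perm.sign σ : ℤ) : ℝ) * vol b *
        β (fun i => b (σ (Fin.castAdd l i))) := by
    symm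
    refine Fintype.sum_of_injective (fun π : Perm (Fin k) => fun i => σ (Fin.castAdd l (π i)))
      ?_ _ _ ?_ ?_
    · intro π π' hππ
      ext i
      have := congrFun hππ i
      simpa [Fin.ext_iff] using this
    · intro s hs
      by_contra hne
      apply hs
      -- A nonzero summand needs distinct arguments in `vol`; hence `s` is injective and avoids the
      -- second block of `σ`.
      have hinj : Function.Injective
          (Fin.append s (fun j => σ (Fin.natAdd k j))) := by
        intro i j hij
        by_contra hij'
        apply hne
        rw [contract_apply_append rfl b s (fun j => σ (Fin.natAdd k j)),
          vol.map_eq_zero_of_eq _ (i := i) (j := j) (by simp [hij]) hij', mul_zero]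
      have h1 : ∀ i, ∃ a, Fin.castAdd l a = σ.symm (s i) := by
        intro i
        induction hx : σ.symm (s i) using Fin.addCases with
        | left a => exact ⟨a, rfl⟩
        | right a =>
          have := @hinj (Fin.castAdd l i) (Fin.natAdd k a) (by
            rw [Fin.append_left, Fin.append_right, ← hx, Equiv.apply_symm_apply])
          simp [Fin.ext_iff] at this
          omega
      choose π hπ using h1
      have hπinj : Function.Injective π := by
        intro i j hij
        have h2 : s i = s j := by
          have := (hπ i).symm.trans ((congrArg (Fin.castAdd l) hij).trans (hπ j))
          exact σ.symm.injective this
        have := @hinj (Fin.castAdd l i) (Fin.castAdd l j) (by simpa using h2)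
        simpa using this
      refine ⟨Equiv.ofBijective π (Finite.injective_iff_bijective.1 hπinj), ?_⟩
      ext i
      simp [hπ]
    · intro π
      rw [contract_perm rfl (fun i => b (σ (Fin.castAdd l i))),
        ContinuousAlternatingMap.apply_comp_perm β (fun i => b (σ (Fin.castAdd l i))) π,
        contract_apply_append rfl b (fun i => σ (Fin.castAdd l i)) (fun j => σ (Fin.natAdd k j))]
      have : (fun i => b (Fin.append (fun i => σ (Fin.castAdd l i)) (fun j => σ (Fin.natAdd k j))
          (Fin.cast rfl i))) = fun i => b (σ i) := by
        ext i
        induction i using Fin.addCases <;> simp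
      rw [this, ContinuousAlternatingMap.apply_comp_perm]
      linear_combination (-((Perm.sign σ : ℤ) : ℝ) * vol b *
        β (fun i => b (σ (Fin.castAdd l i)))) * sign_mul_self_real π
  rw [key, Finset.sum_const, Finset.card_univ, Fintype.card_perm, Fintype.card_fin, nsmul_eq_mul]
  have : (k.factorial : ℝ) ≠ 0 := by exact_mod_cast k.factorial_ne_zero
  field_simp

/-- Alternating forms are determined by injective tuples of basis vectors, and every injection `Fin
k → Fin m` is the first block of a permutation. The test tuples then have the shape treated in
`hodgeWith_apply_perm`. -/
lemma ContinuousAlternatingMap.ext_perm {k l m : ℕ} (h : k + l = m) (b : Module.Basis (Fin m) ℝ V)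
    {α β : V [⋀^Fin k]→L[ℝ] ℝ}
    (hαβ : ∀ σ : Perm (Fin m), α (fun i => b (σ (Fin.cast h (Fin.castAdd l i)))) =
      β (fun i => b (σ (Fin.cast h (Fin.castAdd l i))))) : α = β := by
  apply ContinuousAlternatingMap.toAlternatingMap_injective
  refine Module.Basis.ext_alternating b fun s hs => ?_
  have hc : Function.Injective fun i : Fin k => Fin.cast h (Fin.castAdd l i) := by
    intro i j hij; simpa using hij
  let e := (Equiv.ofInjective _ hc).symm.trans (Equiv.ofInjective s hs)
  have he : ∀ i, e.extendSubtype (Fin.cast h (Fin.castAdd l i)) = s i := by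
    intro i
    rw [Equiv.extendSubtype_apply_of_mem (e := e) _ (Set.mem_range_self i)]
    simp only [e, Equiv.trans_apply]
    have := Equiv.ofInjective_symm_apply hc i
    simp only [this, Equiv.ofInjective_apply]
  have := hαβ e.extendSubtype
  simp only [he] at this
  exact this

lemma ContinuousAlternatingMap.top_ext {m : ℕ} (b : Module.Basis (Fin m) ℝ V)
    {α β : V [⋀^Fin m]→L[ℝ] ℝ} (hαβ : α b = β b) : α = β := by
  refine ContinuousAlternatingMap.ext_perm (l := 0) rfl b fun σ => ?_
  have h1 : (fun i => b (σ (Fin.cast rfl (Fin.castAdd 0 i)))) = fun i => b (σ i) := by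
    ext i; simp
  rw [h1]
  exact (ContinuousAlternatingMap.apply_comp_perm (ι := Fin m) α b σ).trans
    ((congrArg _ hαβ).trans (ContinuousAlternatingMap.apply_comp_perm (ι := Fin m) β b σ).symm)

/-- Two evaluations by `hodgeWith_apply_perm`; the outer one is read with the blocks exchanged, and
the sign of `blockSwap` is the sign of `∗∗`. -/
lemma hodgeWith_hodgeWith {k l m : ℕ} (h : k + l = m) (h' : l + k = m)
    (b : Module.Basis (Fin m) ℝ V)
    (vol : V [⋀^Fin m]→L[ℝ] ℝ) (α : V [⋀^Fin k]→L[ℝ] ℝ) :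
    hodgeWith h' b vol (hodgeWith h b vol α) = ((-1) ^ (k * l) * (vol b * vol b)) • α := by
  refine ContinuousAlternatingMap.ext_perm h b fun σ => ?_
  have e1 := hodgeWith_apply_perm h' b vol (hodgeWith h b vol α) (σ * blockSwap h' h)
  simp only [Perm.mul_apply, blockSwap_right, blockSwap_left, hodgeWith_apply_perm h b vol α σ,
    map_mul, Units.val_mul, Int.cast_mul, sign_blockSwap] at e1
  rw [e1, ContinuousAlternatingMap.smul_apply, smul_eq_mul, mul_comm l k]
  linear_combination ((-1) ^ (k * l) * (vol b * vol b) *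
    α (fun i => b (σ (Fin.cast h (Fin.castAdd l i))))) * sign_mul_self_real σ

/-- The scalar product of two `k`-forms for which `b` is orthonormal. -/
noncomputable def formInner {k l m : ℕ} (h : k + l = m) (b : Fin m → V)
    (α β : V [⋀^Fin k]→L[ℝ] ℝ) : ℝ :=
  ((k.factorial * l.factorial : ℝ)⁻¹) * ∑ σ : Perm (Fin m),
    α (fun i => b (σ (Fin.cast h (Fin.castAdd l i)))) *
      β (fun i => b (σ (Fin.cast h (Fin.castAdd l i))))

lemma formInner_comm {k l m : ℕ} (h : k + l = m) (b : Fin m → V)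
    (α β : V [⋀^Fin k]→L[ℝ] ℝ) : formInner h b α β = formInner h b β α := by
  simp only [formInner, mul_comm (α _)]

lemma formInner_self_nonneg {k l m : ℕ} (h : k + l = m) (b : Fin m → V)
    (α : V [⋀^Fin k]→L[ℝ] ℝ) : 0 ≤ formInner h b α α :=
  mul_nonneg (by positivity) (Finset.sum_nonneg fun _ _ => mul_self_nonneg _)

lemma eq_zero_of_formInner_self {k l m : ℕ} (h : k + l = m) (b : Module.Basis (Fin m) ℝ V)
    {α : V [⋀^Fin k]→L[ℝ] ℝ} (hα : formInner h b α α = 0) : α = 0 := by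
  refine ContinuousAlternatingMap.ext_perm h b fun σ => ?_
  rw [formInner, mul_eq_zero, or_iff_right (by positivity),
    Finset.sum_eq_zero_iff_of_nonneg fun _ _ => mul_self_nonneg _] at hα
  simpa using hα σ (Finset.mem_univ _)

/-- Top forms need only be compared on `b`. There each permutation brings its sign twice, once from
the wedge and once from the star, and what remains is the sum defining `formInner`. -/
lemma wedge_hodgeWith {k l m : ℕ} (h : k + l = m) (b : Module.Basis (Fin m) ℝ V)
    (vol : V [⋀^Fin m]→L[ℝ] ℝ) (α β : V [⋀^Fin k]→L[ℝ] ℝ) :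
    wedge h α (hodgeWith h b vol β) = formInner h b α β • vol := by
  refine ContinuousAlternatingMap.top_ext b ?_
  rw [wedge_apply, ContinuousAlternatingMap.smul_apply, formInner, smul_eq_mul, mul_assoc,
    Finset.sum_mul]
  congr 1
  refine Finset.sum_congr rfl fun σ _ => ?_
  rw [hodgeWith_apply_perm h b vol β σ]
  linear_combination (α (fun i => b (σ (Fin.cast h (Fin.castAdd l i)))) *
      β (fun i => b (σ (Fin.cast h (Fin.castAdd l i)))) * vol b) * sign_mul_self_real σ

end HodgeAlgebra

/-! ### Orthonormal frames of a scalar product -/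

section Frames

/-- `g` is a scalar product. -/
structure IsScalarProduct {V : Type*} [AddCommGroup V] [Module ℝ V] (g : V → V → ℝ) : Prop where
  add_left : ∀ u v w, g (u + v) w = g u w + g v w
  smul_left : ∀ (c : ℝ) v w, g (c • v) w = c * g v w
  symm : ∀ v w, g v w = g w v
  pos : ∀ v, v ≠ 0 → 0 < g v v

variable {V : Type*} [AddCommGroup V] [Module ℝ V] {g : V → V → ℝ}

lemma IsScalarProduct.sum_smul_left (hg : IsScalarProduct g) {ι : Type*} (s : Finset ι)
    (c : ι → ℝ) (v : ι → V) (w : V) :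
    g (∑ i ∈ s, c i • v i) w = ∑ i ∈ s, c i * g (v i) w := by
  let L : V →ₗ[ℝ] ℝ := ⟨⟨fun u => g u w, fun u v => hg.add_left u v w⟩,
    fun c v => hg.smul_left c v w⟩
  have : L (∑ i ∈ s, c i • v i) = ∑ i ∈ s, c i * L (v i) := by simp
  exact this

lemma IsScalarProduct.sum_smul_right (hg : IsScalarProduct g) {ι : Type*} (s : Finset ι)
    (c : ι → ℝ) (v : ι → V) (w : V) :
    g w (∑ i ∈ s, c i • v i) = ∑ i ∈ s, c i * g w (v i) := by
  rw [hg.symm, hg.sum_smul_left]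
  simp only [hg.symm w]

/-- Since `g` is a bare function, it is packaged as an inner product core, whose standard
orthonormal basis is the frame. -/
lemma IsScalarProduct.exists_frame (hg : IsScalarProduct g) {m : ℕ} [FiniteDimensional ℝ V]
    (hm : Module.finrank ℝ V = m) : ∃ b : Fin m → V, IsOrthonormalFrame g b := by
  let c : InnerProductSpace.Core ℝ V :=
    { inner := g
      conj_inner_symm := fun x y => by simp [hg.symm y x]
      re_inner_nonneg := fun x => by
        rcases eq_or_ne x 0 with rfl | hx
        · have := hg.smul_left 0 (0 : V) 0
          simp at this
          simp [this]
        · simpa using (hg.pos x hx).le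
      definite := fun x hx => by
        by_contra h
        exact (hg.pos x h).ne' hx
      add_left := hg.add_left
      smul_left := fun x y r => by simp [hg.smul_left] }
  let _ : NormedAddCommGroup V := c.toNormedAddCommGroup
  let _ : InnerProductSpace ℝ V := InnerProductSpace.ofCore c.toCore
  let b := (stdOrthonormalBasis ℝ V).reindex (finCongr hm)
  refine ⟨b, fun i j => ?_⟩
  exact (orthonormal_iff_ite.1 b.orthonormal) i j

lemma IsScalarProduct.linearIndependent (hg : IsScalarProduct g) {m : ℕ} {b : Fin m → V}
    (hb : IsOrthonormalFrame g b) : LinearIndependent ℝ b := by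
  rw [Fintype.linearIndependent_iff]
  intro c hc i
  have h0 : g 0 (b i) = 0 := by simpa using hg.smul_left 0 0 (b i)
  have := hg.sum_smul_left Finset.univ c b (b i)
  rw [hc, h0] at this
  simpa [hb _ i] using this.symm

lemma IsScalarProduct.exists_basis [FiniteDimensional ℝ V] (hg : IsScalarProduct g) {m : ℕ}
    {b : Fin m → V} (hm : Module.finrank ℝ V = m) (hb : IsOrthonormalFrame g b) :
    ∃ B : Module.Basis (Fin m) ℝ V, ⇑B = b :=
  ⟨Module.Basis.mk (hg.linearIndependent hb)
    ((hg.linearIndependent hb).span_eq_top_of_card_eq_finrank' (by simp [hm])).ge,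
    Module.Basis.coe_mk _ _⟩

end Frames

/-! ### The Hodge star of an oriented Euclidean space -/

section OrientedEuclidean

variable {V : Type*} [AddCommGroup V] [Module ℝ V] [TopologicalSpace V]
  {W : Type*} [AddCommGroup W] [Module ℝ W] [TopologicalSpace W]

/-- `vol` is one of the two volume forms of the scalar product `g` on the `m`-dimensional
space `V`. -/
structure IsVolumeForm {m : ℕ} (g : V → V → ℝ) (vol : V [⋀^Fin m]→L[ℝ] ℝ) : Prop where
  scalar : IsScalarProduct g
  finite : FiniteDimensional ℝ V
  finrank : Module.finrank ℝ V = m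
  unit : ∀ b : Fin m → V, IsOrthonormalFrame g b → |vol b| = 1

variable {m : ℕ} {g : V → V → ℝ} {vol : V [⋀^Fin m]→L[ℝ] ℝ}

lemma IsVolumeForm.orthonormal_someFrame (H : IsVolumeForm g vol) :
    IsOrthonormalFrame g (someFrame m g) := by
  have := H.finite
  exact Classical.epsilon_spec (H.scalar.exists_frame H.finrank)

lemma IsVolumeForm.exists_basis (H : IsVolumeForm g vol) :
    ∃ B : Module.Basis (Fin m) ℝ V, ⇑B = someFrame m g := by
  have := H.finite
  exact H.scalar.exists_basis H.finrank H.orthonormal_someFrame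

lemma IsVolumeForm.apply_someFrame_mul_self (H : IsVolumeForm g vol) :
    vol (someFrame m g) * vol (someFrame m g) = 1 := by
  have := H.unit _ H.orthonormal_someFrame
  rw [← abs_mul_abs_self, this, one_mul]

variable [IsTopologicalAddGroup V] [ContinuousConstSMul ℝ V]
  [IsTopologicalAddGroup W] [ContinuousConstSMul ℝ W]

/-- A top form vanishing on one basis is zero, whereas `vol` has absolute value one on an
orthonormal frame. -/
lemma IsVolumeForm.apply_basis_ne_zero (H : IsVolumeForm g vol) (b : Module.Basis (Fin m) ℝ V) :
    vol b ≠ 0 := by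
  intro h
  have h0 : vol = 0 := ContinuousAlternatingMap.top_ext b (by simpa using h)
  have := H.apply_someFrame_mul_self
  simp [h0] at this

lemma IsVolumeForm.hodge_hodge (H : IsVolumeForm g vol) {k l : ℕ} (h : k + l = m) (h' : l + k = m)
    (α : V [⋀^Fin k]→L[ℝ] ℝ) : hodge h' g vol (hodge h g vol α) = (-1 : ℝ) ^ (k * l) • α := by
  obtain ⟨B, hB⟩ := H.exists_basis
  rw [hodge_eq_hodgeWith, hodge_eq_hodgeWith, ← hB, hodgeWith_hodgeWith, hB,
    H.apply_someFrame_mul_self, mul_one]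

lemma IsVolumeForm.wedge_hodge (H : IsVolumeForm g vol) {k l : ℕ} (h : k + l = m)
    (α β : V [⋀^Fin k]→L[ℝ] ℝ) :
    wedge h α (hodge h g vol β) = formInner h (someFrame m g) α β • vol := by
  obtain ⟨B, hB⟩ := H.exists_basis
  rw [hodge_eq_hodgeWith, ← hB, wedge_hodgeWith]

lemma IsVolumeForm.wedge_hodge_comm (H : IsVolumeForm g vol) {k l : ℕ} (h : k + l = m)
    (α β : V [⋀^Fin k]→L[ℝ] ℝ) :
    wedge h α (hodge h g vol β) = wedge h β (hodge h g vol α) := by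
  rw [H.wedge_hodge, H.wedge_hodge, formInner_comm]

/-- The symmetry of `α ∧ ∗β` produces `∗∗α`, whose sign is the one of graded commutativity. This
serves to strip stars from both sides of a pairing. -/
lemma IsVolumeForm.wedge_hodge_hodge (H : IsVolumeForm g vol) {k l : ℕ} (h : k + l = m)
    (h' : l + k = m) (α : V [⋀^Fin k]→L[ℝ] ℝ) (β : V [⋀^Fin l]→L[ℝ] ℝ) :
    wedge h' (hodge h g vol α) (hodge h' g vol β) = wedge h α β := by
  rw [H.wedge_hodge_comm, H.hodge_hodge, wedge_smul_right, wedge_comm h h']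

lemma IsVolumeForm.eq_zero_of_formInner_self (H : IsVolumeForm g vol) {k l : ℕ} (h : k + l = m)
    {α : V [⋀^Fin k]→L[ℝ] ℝ} (hα : formInner h (someFrame m g) α α = 0) : α = 0 := by
  obtain ⟨B, hB⟩ := H.exists_basis
  rw [← hB] at hα
  exact _root_.eq_zero_of_formInner_self h B hα

lemma hodge_add {k l : ℕ} (h : k + l = m) (α β : V [⋀^Fin k]→L[ℝ] ℝ) :
    hodge h g vol (α + β) = hodge h g vol α + hodge h g vol β := by
  simp only [hodge, ContinuousAlternatingMap.add_apply, add_smul, Finset.sum_add_distrib, smul_add]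

lemma hodge_smul {k l : ℕ} (h : k + l = m) (c : ℝ) (α : V [⋀^Fin k]→L[ℝ] ℝ) :
    hodge h g vol (c • α) = c • hodge h g vol α := by
  simp only [hodge, ContinuousAlternatingMap.smul_apply, smul_assoc, ← Finset.smul_sum]
  rw [smul_comm]

/-- The Hodge star as a linear map. -/
noncomputable def hodgeLin {k l : ℕ} (h : k + l = m) (g : V → V → ℝ) (vol : V [⋀^Fin m]→L[ℝ] ℝ) :
    (V [⋀^Fin k]→L[ℝ] ℝ) →ₗ[ℝ] (V [⋀^Fin l]→L[ℝ] ℝ) :=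
  ⟨⟨hodge h g vol, hodge_add h⟩, hodge_smul h⟩

lemma IsVolumeForm.hodge_injective (H : IsVolumeForm g vol) {k l : ℕ} (h : k + l = m) :
    Function.Injective (hodge (k := k) (l := l) h g vol) := by
  intro α β hαβ
  have := congrArg (hodge ((add_comm l k).trans h) g vol) hαβ
  rw [H.hodge_hodge, H.hodge_hodge] at this
  exact smul_right_injective _ (pow_ne_zero _ (by norm_num)) this

/-- The Hodge star in terms of an arbitrary basis `e` and the inverse `P` of its Gram matrix. -/
noncomputable def hodgeGram {k l : ℕ} (h : k + l = m) (P : Matrix (Fin m) (Fin m) ℝ)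
    (e : Fin m → V) (vol : V [⋀^Fin m]→L[ℝ] ℝ) (α : V [⋀^Fin k]→L[ℝ] ℝ) : V [⋀^Fin l]→L[ℝ] ℝ :=
  ((k.factorial : ℝ)⁻¹) • ∑ s : Fin k → Fin m, ∑ t : Fin k → Fin m,
    ((∏ a, P (s a) (t a)) * α (fun i => e (s i))) • contract h (fun i => e (t i)) vol

lemma contract_sum_smul {k l : ℕ} (h : k + l = m) {ι : Type*} [Fintype ι] (c : Fin k → ι → ℝ)
    (e : ι → V) (vol : V [⋀^Fin m]→L[ℝ] ℝ) (v : Fin l → V) :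
    contract h (fun a => ∑ i, c a i • e i) vol v =
      ∑ t : Fin k → ι, (∏ a, c a (t a)) * contract h (fun a => e (t a)) vol v := by
  classical
  let T := (vol.toMultilinearMap.domDomCongr (finSumFinEquiv.trans (finCongr h)).symm).currySum
  have : T (fun a => ∑ i, c a i • e i) = ∑ t : Fin k → ι, (∏ a, c a (t a)) • T (fun a => e (t a)) := by
    rw [MultilinearMap.map_sum]
    exact Finset.sum_congr rfl fun t _ => T.map_smul_univ _ _
  change T (fun a => ∑ i, c a i • e i) v = _
  rw [this, sum_apply]
  rfl

lemma ContinuousAlternatingMap.apply_sum_smul {k : ℕ} {ι : Type*} [Fintype ι] (c : Fin k → ι → ℝ)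
    (e : ι → V) (α : V [⋀^Fin k]→L[ℝ] ℝ) :
    α (fun a => ∑ i, c a i • e i) = ∑ t : Fin k → ι, (∏ a, c a (t a)) * α (fun a => e (t a)) := by
  classical
  have : α.toMultilinearMap (fun a => ∑ i, c a i • e i) =
      ∑ t : Fin k → ι, (∏ a, c a (t a)) • α.toMultilinearMap (fun a => e (t a)) := by
    rw [MultilinearMap.map_sum]
    exact Finset.sum_congr rfl fun t _ => α.toMultilinearMap.map_smul_univ _ _
  simpa using this

/-- The frame in the definition of the star is chosen point by point and has no regularity. This
formula contains only a basis, its Gram matrix and `vol`, so in a coordinate frame it exhibits the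
star as smooth. -/
lemma IsVolumeForm.hodge_eq_hodgeGram (H : IsVolumeForm g vol) {k l : ℕ} (h : k + l = m)
    (e : Module.Basis (Fin m) ℝ V) (α : V [⋀^Fin k]→L[ℝ] ℝ) :
    hodge h g vol α = hodgeGram h (Matrix.of fun i j => g (e i) (e j))⁻¹ e vol α := by
  set G : Matrix (Fin m) (Fin m) ℝ := Matrix.of fun i j => g (e i) (e j) with hG
  let C : Matrix (Fin m) (Fin m) ℝ := Matrix.of fun a i => e.repr (someFrame m g a) i
  have hC : ∀ a, someFrame m g a = ∑ i, C a i • e i := fun a => (e.sum_repr _).symm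
  -- `C` holds the coordinates of the orthonormal frame, and orthonormality reads `C G Cᵀ = 1`.
  -- Hence `G⁻¹ = Cᵀ C`, which is the only way in which the frame enters the star.
  have h1 : C * (G * C.transpose) = 1 := by
    ext a b
    have := H.orthonormal_someFrame a b
    rw [hC a, hC b, H.scalar.sum_smul_left] at this
    simp only [H.scalar.sum_smul_right] at this
    rw [Matrix.one_apply, ← this, Matrix.mul_apply]
    refine Finset.sum_congr rfl fun i _ => ?_
    rw [Matrix.mul_apply]
    congr 1
    refine Finset.sum_congr rfl fun j _ => ?_
    simp [hG, mul_comm]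
  have h2 : G⁻¹ = C.transpose * C := by
    apply Matrix.inv_eq_left_inv
    rw [← mul_assoc] at h1
    rw [mul_assoc]
    exact mul_eq_one_comm.1 h1
  ext v
  rw [hodge_eq_hodgeWith, hodgeWith_apply]
  simp only [hodgeGram, ContinuousAlternatingMap.smul_apply, ContinuousAlternatingMap.sum_apply,
    smul_eq_mul]
  congr 1
  simp only [hC, contract_sum_smul, ContinuousAlternatingMap.apply_sum_smul, Finset.sum_mul_sum]
  rw [Finset.sum_comm]
  refine Finset.sum_congr rfl fun s _ => ?_
  rw [Finset.sum_comm]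
  refine Finset.sum_congr rfl fun t _ => ?_
  have : ∏ a, G⁻¹ (s a) (t a) = ∑ u : Fin k → Fin m, ∏ a, (C (u a) (s a) * C (u a) (t a)) := by
    simp only [h2, Matrix.mul_apply, Matrix.transpose_apply]
    rw [Finset.prod_univ_sum]
    simp
  rw [this, Finset.sum_mul, Finset.sum_mul]
  refine Finset.sum_congr rfl fun u _ => ?_
  rw [Finset.prod_mul_distrib]
  ring

lemma hodgeGram_comp {k l : ℕ} (h : k + l = m) (P : Matrix (Fin m) (Fin m) ℝ) (f : W →L[ℝ] V)
    (e : Fin m → W) (vol : V [⋀^Fin m]→L[ℝ] ℝ) (α : V [⋀^Fin k]→L[ℝ] ℝ) :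
    (hodgeGram h P (fun i => f (e i)) vol α).compContinuousLinearMap f =
      hodgeGram h P e (vol.compContinuousLinearMap f) (α.compContinuousLinearMap f) := by
  ext v
  simp only [hodgeGram, ContinuousAlternatingMap.compContinuousLinearMap_apply,
    ContinuousAlternatingMap.smul_apply, ContinuousAlternatingMap.sum_apply, ← contract_comp]
  rfl

end OrientedEuclidean

/-! ### Alternatization of a wedge product -/

section LeibnizAlgebra

open Equiv

/-- A permutation of `m + 1` letters amounts to the image `i` of `0` and a permutation of the rest;
injectivity and a count of cardinalities suffice. -/
lemma sum_perm_succ {m : ℕ} (F : Perm (Fin (m + 1)) → ℝ) :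
    ∑ τ, F τ = ∑ i : Fin (m + 1), ∑ σ : Perm (Fin m),
      F (i.cycleRange.symm * Perm.decomposeFin.symm (0, σ)) := by
  rw [← Fintype.sum_prod_type']
  symm
  let f : Fin (m + 1) × Perm (Fin m) → Perm (Fin (m + 1)) :=
    fun x => x.1.cycleRange.symm * Perm.decomposeFin.symm (0, x.2)
  have hf : Function.Injective f := by
    rintro ⟨i, σ⟩ ⟨j, τ⟩ h
    have h0 : i = j := by
      have := DFunLike.congr_fun h 0
      simpa [f] using this
    subst h0
    have := mul_left_cancel h
    simpa using this
  have hb : Function.Bijective f := by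
    rw [Fintype.bijective_iff_injective_and_card]
    exact ⟨hf, by simp [Fintype.card_perm, Nat.factorial_succ]⟩
  exact hb.sum_comp F

lemma cycleRange_mul_decomposeFin_zero {m : ℕ} (i : Fin (m + 1)) (σ : Perm (Fin m)) :
    (i.cycleRange.symm * Perm.decomposeFin.symm (0, σ)) 0 = i := by
  simp

lemma cycleRange_mul_decomposeFin_succ {m : ℕ} (i : Fin (m + 1)) (σ : Perm (Fin m)) (j : Fin m) :
    (i.cycleRange.symm * Perm.decomposeFin.symm (0, σ)) j.succ = i.succAbove (σ j) := by
  simp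

lemma sign_cycleRange_mul_decomposeFin {m : ℕ} (i : Fin (m + 1)) (σ : Perm (Fin m)) :
    ((Perm.sign (i.cycleRange.symm * Perm.decomposeFin.symm (0, σ)) : ℤ) : ℝ) =
      (-1) ^ (i : ℕ) * ((Perm.sign σ : ℤ) : ℝ) := by
  rw [map_mul, Perm.sign_symm, Fin.sign_cycleRange, Perm.decomposeFin.symm_sign]
  simp

/-- The permutation of the first block that moves its entry `0` to the place `i`. -/
def blockCycle {k l m : ℕ} (h : k + 1 + l = m) (i : Fin (k + 1)) : Perm (Fin m) :=
  (finSumFinEquiv.trans (finCongr h)).permCongr (Perm.sumCongr i.cycleRange.symm 1)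

lemma blockCycle_zero {k l m : ℕ} (h : k + 1 + l = m) (i : Fin (k + 1)) :
    blockCycle h i (Fin.cast h (Fin.castAdd l 0)) = Fin.cast h (Fin.castAdd l i) := by
  subst h; simp [blockCycle, permCongr_apply]

lemma blockCycle_succ {k l m : ℕ} (h : k + 1 + l = m) (i : Fin (k + 1)) (j : Fin k) :
    blockCycle h i (Fin.cast h (Fin.castAdd l j.succ)) =
      Fin.cast h (Fin.castAdd l (i.succAbove j)) := by
  subst h; simp [blockCycle, permCongr_apply]

lemma blockCycle_right {k l m : ℕ} (h : k + 1 + l = m) (i : Fin (k + 1)) (j : Fin l) :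
    blockCycle h i (Fin.cast h (Fin.natAdd (k + 1) j)) = Fin.cast h (Fin.natAdd (k + 1) j) := by
  subst h; simp [blockCycle, permCongr_apply]

lemma sign_blockCycle {k l m : ℕ} (h : k + 1 + l = m) (i : Fin (k + 1)) :
    ((Perm.sign (blockCycle h i) : ℤ) : ℝ) = (-1) ^ (i : ℕ) := by
  rw [blockCycle, Perm.sign_permCongr, Perm.sign_sumCongr, Perm.sign_symm, Fin.sign_cycleRange]
  simp

variable {E : Type*} [NormedAddCommGroup E] [NormedSpace ℝ E]

lemma neg_one_pow_zsmul_real (i : ℕ) (x : ℝ) : ((-1 : ℤ) ^ i) • x = (-1 : ℝ) ^ i * x := by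
  simp [zsmul_eq_mul]

/-- Both sides are multiples of one sum `F` over the permutations of `m + 1` letters, in which the
letter `0` is the slot of differentiation. This is the algebraic content of `d(α ∧ β)` when only the
first factor varies. -/
lemma alternatizeUncurryFin_wedge_left {k l m : ℕ} (h : k + l = m) (h' : k + 1 + l = m + 1)
    (A : E →L[ℝ] E [⋀^Fin k]→L[ℝ] ℝ) (β : E [⋀^Fin l]→L[ℝ] ℝ)
    (A' : E →L[ℝ] E [⋀^Fin m]→L[ℝ] ℝ) (hA' : ∀ v, A' v = wedge h (A v) β) :
    ContinuousAlternatingMap.alternatizeUncurryFin A' =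
      wedge h' (ContinuousAlternatingMap.alternatizeUncurryFin A) β := by
  ext v
  have i0 : Fin.cast h' (Fin.castAdd l 0) = 0 := by ext; simp
  have i1 : ∀ j, Fin.cast h' (Fin.castAdd l j.succ) = (Fin.cast h (Fin.castAdd l j)).succ :=
    fun j => by ext; simp
  have i2 : ∀ j, Fin.cast h' (Fin.natAdd (k + 1) j) = (Fin.cast h (Fin.natAdd k j)).succ :=
    fun j => by ext; simp; omega
  set F : Perm (Fin (m + 1)) → ℝ := fun τ => ((Perm.sign τ : ℤ) : ℝ) *
    (A (v (τ 0)) (fun a => v (τ (Fin.cast h (Fin.castAdd l a)).succ)) *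
      β (fun a => v (τ (Fin.cast h (Fin.natAdd k a)).succ))) with hF
  have e1 : ContinuousAlternatingMap.alternatizeUncurryFin A' v =
      ((k.factorial * l.factorial : ℝ)⁻¹) * ∑ τ, F τ := by
    rw [ContinuousAlternatingMap.alternatizeUncurryFin_apply, sum_perm_succ, Finset.mul_sum]
    refine Finset.sum_congr rfl fun i _ => ?_
    rw [hA', wedge_apply, neg_one_pow_zsmul_real, mul_left_comm, Finset.mul_sum]
    congr 1
    refine Finset.sum_congr rfl fun σ _ => ?_
    simp only [hF, cycleRange_mul_decomposeFin_zero, cycleRange_mul_decomposeFin_succ,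
      sign_cycleRange_mul_decomposeFin, Fin.removeNth]
    ring
  -- Each of the `k + 1` positions of the differentiated slot gives the whole sum: `blockCycle`
  -- exchanges that position for `0` at the price of `(-1)^i`. The resulting factor `k + 1` is
  -- absorbed by `(k + 1)!`.
  have e2 : ∀ i : Fin (k + 1), ∑ σ : Perm (Fin (m + 1)), ((Perm.sign σ : ℤ) : ℝ) *
      ((-1) ^ (i : ℕ) * A (v (σ (Fin.cast h' (Fin.castAdd l i))))
        (fun a => v (σ (Fin.cast h' (Fin.castAdd l (i.succAbove a))))) *
      β (fun a => v (σ (Fin.cast h' (Fin.natAdd (k + 1) a))))) = ∑ τ, F τ := by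
    intro i
    rw [← Equiv.sum_comp (Equiv.mulRight (blockCycle h' i)) F]
    refine Finset.sum_congr rfl fun σ _ => ?_
    simp only [hF, Equiv.coe_mulRight, Perm.mul_apply, ← i0, ← i1, ← i2, blockCycle_zero,
      blockCycle_succ, blockCycle_right, map_mul, Units.val_mul, Int.cast_mul, sign_blockCycle]
    ring
  rw [e1, wedge_apply]
  simp only [ContinuousAlternatingMap.alternatizeUncurryFin_apply, Finset.sum_mul, Finset.mul_sum,
    neg_one_pow_zsmul_real]
  rw [Finset.sum_comm]
  simp only [← Finset.mul_sum]
  refine Eq.trans ?_ (congrArg _ (Finset.sum_congr rfl fun i _ => (e2 i).symm))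
  rw [Finset.sum_const, Finset.card_univ, Fintype.card_fin, nsmul_eq_mul, Nat.factorial_succ]
  have h1 : (k.factorial : ℝ) ≠ 0 := by exact_mod_cast k.factorial_ne_zero
  have h2 : (l.factorial : ℝ) ≠ 0 := by exact_mod_cast l.factorial_ne_zero
  have h3 : ((k + 1 : ℕ) : ℝ) ≠ 0 := by exact_mod_cast k.succ_ne_zero
  push_cast at h3 ⊢
  field_simp

/-- Reduced to the previous lemma by commuting the factors before and after; the exponents `k l` and
`(l + 1) k` add up to `k` modulo two. -/
lemma alternatizeUncurryFin_wedge_right {k l m : ℕ} (h : k + l = m) (h' : k + (l + 1) = m + 1)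
    (α : E [⋀^Fin k]→L[ℝ] ℝ) (A : E →L[ℝ] E [⋀^Fin l]→L[ℝ] ℝ)
    (A' : E →L[ℝ] E [⋀^Fin m]→L[ℝ] ℝ) (hA' : ∀ v, A' v = wedge h α (A v)) :
    ContinuousAlternatingMap.alternatizeUncurryFin A' =
      (-1 : ℝ) ^ k • wedge h' α (ContinuousAlternatingMap.alternatizeUncurryFin A) := by
  have hc : l + k = m := by omega
  have hc' : l + 1 + k = m + 1 := by omega
  have h2 : ∀ c : ℕ, (-1 : ℝ) ^ c * (-1) ^ c = 1 := fun c => by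
    rw [← mul_pow]; simp
  have := alternatizeUncurryFin_wedge_left hc hc' A α ((-1 : ℝ) ^ (k * l) • A') (fun v => by
    rw [_root_.smul_apply, hA', wedge_comm h hc, smul_smul, h2, one_smul])
  rw [ContinuousAlternatingMap.alternatizeUncurryFin_smul, wedge_comm hc' h'] at this
  have h3 := congrArg (fun x => (-1 : ℝ) ^ (k * l) • x) this
  simp only [smul_smul, h2, one_smul] at h3
  rw [h3, ← pow_add]
  congr 1
  have : k * l + (l + 1) * k = k + 2 * (k * l) := by ring
  rw [this, pow_add, pow_mul]
  simp

end LeibnizAlgebra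

/-! ### Smoothness of form-valued maps, by components -/

section FiniteDim

variable {m : ℕ}

/-- The standard basis of the coordinate space. -/
noncomputable def stdB (m : ℕ) : Module.Basis (Fin m) ℝ (EuclideanSpace ℝ (Fin m)) :=
  (EuclideanSpace.basisFun (Fin m) ℝ).toBasis

@[simp] lemma stdB_apply (i : Fin m) : stdB m i = EuclideanSpace.single i (1 : ℝ) := by
  simp [stdB]

lemma coe_stdB : ⇑(stdB m) = fun i => EuclideanSpace.single i (1 : ℝ) := by
  ext1 i; exact stdB_apply i

lemma sum_coord_smul_single (v : EuclideanSpace ℝ (Fin m)) :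
    v = ∑ i, v i • EuclideanSpace.single i (1 : ℝ) := by
  have := (stdB m).sum_repr v
  simp only [stdB_apply] at this
  exact this.symm

/-- The components of an alternating form in the standard basis. -/
noncomputable def components (m k : ℕ) :
    (EuclideanSpace ℝ (Fin m) [⋀^Fin k]→L[ℝ] ℝ) →ₗ[ℝ] ((Fin k → Fin m) → ℝ) where
  toFun α s := α (fun i => EuclideanSpace.single (s i) 1)
  map_add' _ _ := rfl
  map_smul' _ _ := rfl

lemma components_apply {k : ℕ} (α : EuclideanSpace ℝ (Fin m) [⋀^Fin k]→L[ℝ] ℝ)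
    (s : Fin k → Fin m) : components m k α s = α (fun i => EuclideanSpace.single (s i) 1) := rfl

lemma components_injective (m k : ℕ) : Function.Injective (components m k) := by
  intro α β h
  apply ContinuousAlternatingMap.toAlternatingMap_injective
  refine Module.Basis.ext_alternating (stdB m) fun s _ => ?_
  simpa [components_apply] using congrFun h s

instance finiteDimensional_continuousAlternatingMap (m k : ℕ) :
    FiniteDimensional ℝ (EuclideanSpace ℝ (Fin m) [⋀^Fin k]→L[ℝ] ℝ) :=
  FiniteDimensional.of_injective _ (components_injective m k)

/-- A form is recovered from its components by a continuous linear map, so smoothness may be tested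
component by component. -/
lemma exists_components_leftInverse (m k : ℕ) :
    ∃ L : ((Fin k → Fin m) → ℝ) →L[ℝ] (EuclideanSpace ℝ (Fin m) [⋀^Fin k]→L[ℝ] ℝ),
      ∀ α, L (components m k α) = α := by
  obtain ⟨L, hL⟩ := LinearMap.exists_leftInverse_of_injective (components m k)
    (LinearMap.ker_eq_bot.2 (components_injective m k))
  exact ⟨LinearMap.toContinuousLinearMap L, fun α => LinearMap.congr_fun hL α⟩

variable {X : Type*} [NormedAddCommGroup X] [NormedSpace ℝ X] {r : WithTop ℕ∞} {s : Set X}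

/-- Evaluation of a form at fixed vectors. -/
noncomputable def evalCLM {k : ℕ} (v : Fin k → EuclideanSpace ℝ (Fin m)) :
    (EuclideanSpace ℝ (Fin m) [⋀^Fin k]→L[ℝ] ℝ) →L[ℝ] ℝ :=
  LinearMap.toContinuousLinearMap ⟨⟨fun α => α v, fun _ _ => rfl⟩, fun _ _ => rfl⟩

lemma contDiffOn_form_iff {k : ℕ} {f : X → EuclideanSpace ℝ (Fin m) [⋀^Fin k]→L[ℝ] ℝ} :
    ContDiffOn ℝ r f s ↔
      ∀ t : Fin k → Fin m, ContDiffOn ℝ r (fun y => f y fun i => EuclideanSpace.single (t i) 1) s := by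
  constructor
  · intro hf t
    exact (evalCLM _).contDiff.comp_contDiffOn hf
  · intro hf
    obtain ⟨L, hL⟩ := exists_components_leftInverse m k
    have h1 : ContDiffOn ℝ r (fun y => components m k (f y)) s := contDiffOn_pi.2 hf
    have := L.contDiff.comp_contDiffOn h1
    exact this.congr fun y _ => (hL _).symm

lemma ContDiffOn.linearMap_comp {F G : Type*} [NormedAddCommGroup F] [NormedSpace ℝ F]
    [FiniteDimensional ℝ F] [NormedAddCommGroup G] [NormedSpace ℝ G] {f : X → F}
    (hf : ContDiffOn ℝ r f s) (L : F →ₗ[ℝ] G) : ContDiffOn ℝ r (fun y => L (f y)) s :=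
  (LinearMap.toContinuousLinearMap L).contDiff.comp_contDiffOn hf

lemma ContDiffOn.bilinear_comp {F F' G : Type*} [NormedAddCommGroup F] [NormedSpace ℝ F]
    [FiniteDimensional ℝ F] [NormedAddCommGroup F'] [NormedSpace ℝ F'] [FiniteDimensional ℝ F']
    [NormedAddCommGroup G] [NormedSpace ℝ G] {f : X → F} {f' : X → F'}
    (hf : ContDiffOn ℝ r f s) (hf' : ContDiffOn ℝ r f' s) (L : F →ₗ[ℝ] F' →ₗ[ℝ] G) :
    ContDiffOn ℝ r (fun y => L (f y) (f' y)) s :=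
  L.toContinuousBilinearMap.isBoundedBilinearMap.contDiff.comp_contDiffOn (hf.prodMk hf')

lemma ContDiffOn.wedge {k l j : ℕ} (h : k + l = j)
    {f : X → EuclideanSpace ℝ (Fin m) [⋀^Fin k]→L[ℝ] ℝ}
    {f' : X → EuclideanSpace ℝ (Fin m) [⋀^Fin l]→L[ℝ] ℝ}
    (hf : ContDiffOn ℝ r f s) (hf' : ContDiffOn ℝ r f' s) :
    ContDiffOn ℝ r (fun y => _root_.wedge h (f y) (f' y)) s :=
  hf.bilinear_comp hf' (wedgeBilin _ h)

lemma ContDiffOn.euclidean_apply {f : X → EuclideanSpace ℝ (Fin m)} (hf : ContDiffOn ℝ r f s)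
    (i : Fin m) : ContDiffOn ℝ r (fun y => f y i) s :=
  (EuclideanSpace.proj (𝕜 := ℝ) i).contDiff.comp_contDiffOn hf

lemma ContDiffOn.form_apply {k : ℕ} {f : X → EuclideanSpace ℝ (Fin m) [⋀^Fin k]→L[ℝ] ℝ}
    (hf : ContDiffOn ℝ r f s) {v : X → Fin k → EuclideanSpace ℝ (Fin m)}
    (hv : ∀ i, ContDiffOn ℝ r (fun y => v y i) s) : ContDiffOn ℝ r (fun y => f y (v y)) s := by
  have : ∀ y, f y (v y) = ∑ t : Fin k → Fin m, (∏ a, v y a (t a)) *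
      f y (fun a => EuclideanSpace.single (t a) (1 : ℝ)) := fun y => by
    rw [← ContinuousAlternatingMap.apply_sum_smul (fun a i => v y a i)
      (fun i => EuclideanSpace.single i (1 : ℝ)) (f y)]
    simp only [← sum_coord_smul_single]
  simp only [this]
  refine ContDiffOn.sum fun t _ => ContDiffOn.mul (contDiffOn_prod fun a _ => ?_) ?_
  · exact (hv a).euclidean_apply (t a)
  · exact contDiffOn_form_iff.1 hf t

lemma ContDiffOn.form_comp {k m' : ℕ} {f : X → EuclideanSpace ℝ (Fin m) [⋀^Fin k]→L[ℝ] ℝ}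
    (hf : ContDiffOn ℝ r f s)
    {L : X → EuclideanSpace ℝ (Fin m') →L[ℝ] EuclideanSpace ℝ (Fin m)}
    (hL : ContDiffOn ℝ r L s) :
    ContDiffOn ℝ r (fun y => (f y).compContinuousLinearMap (L y)) s :=
  contDiffOn_form_iff.2 fun t => hf.form_apply (v := fun y i => L y (EuclideanSpace.single (t i) 1))
    fun _ => hL.clm_apply contDiffOn_const

lemma ContDiffOn.hodgeGram {k l : ℕ} (h : k + l = m) {P : X → Matrix (Fin m) (Fin m) ℝ}
    (hP : ∀ i j, ContDiffOn ℝ r (fun y => P y i j) s) (e : Fin m → EuclideanSpace ℝ (Fin m))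
    {vol : X → EuclideanSpace ℝ (Fin m) [⋀^Fin m]→L[ℝ] ℝ} (hvol : ContDiffOn ℝ r vol s)
    {f : X → EuclideanSpace ℝ (Fin m) [⋀^Fin k]→L[ℝ] ℝ} (hf : ContDiffOn ℝ r f s) :
    ContDiffOn ℝ r (fun y => _root_.hodgeGram h (P y) e (vol y) (f y)) s := by
  refine ContDiffOn.const_smul _ (ContDiffOn.sum fun a _ => ContDiffOn.sum fun b _ =>
    ContDiffOn.smul (ContDiffOn.mul (contDiffOn_prod fun _ _ => hP _ _) ?_) ?_)
  · exact (evalCLM _).contDiff.comp_contDiffOn hf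
  · exact hvol.linearMap_comp ⟨⟨contract h fun i => e (b i), fun η η' => contract_add h _ η η'⟩,
      fun c η => contract_smul h _ c η⟩

/-- By Cramer's rule the entries are quotients of polynomials in the entries of `P`. -/
lemma ContDiffOn.matrix_inv {P : X → Matrix (Fin m) (Fin m) ℝ}
    (hP : ∀ i j, ContDiffOn ℝ r (fun y => P y i j) s) (hdet : ∀ y ∈ s, (P y).det ≠ 0)
    (i j : Fin m) : ContDiffOn ℝ r (fun y => (P y)⁻¹ i j) s := by
  have hd : ∀ Q : X → Matrix (Fin m) (Fin m) ℝ, (∀ i j, ContDiffOn ℝ r (fun y => Q y i j) s) →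
      ContDiffOn ℝ r (fun y => (Q y).det) s := by
    intro Q hQ
    simp only [Matrix.det_apply']
    exact ContDiffOn.sum fun σ _ => contDiffOn_const.mul (contDiffOn_prod fun a _ => hQ _ _)
  simp only [Matrix.inv_def, Matrix.smul_apply, smul_eq_mul, Ring.inverse_eq_inv',
    Matrix.adjugate_apply]
  refine ((hd P hP).inv hdet).mul (hd _ fun a b => ?_)
  by_cases hb : a = j
  · subst hb; simp only [Matrix.updateRow_self]; exact contDiffOn_const
  · simp only [Matrix.updateRow_ne hb]; exact hP _ _

end FiniteDim

/-! ### The Leibniz rule in coordinates -/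

section LeibnizAnalytic

variable {m : ℕ}

lemma extDerivWithin_wedge {k l j : ℕ} (h : k + l = j) (h1 : k + 1 + l = j + 1)
    (h2 : k + (l + 1) = j + 1) {s : Set (EuclideanSpace ℝ (Fin m))} {y : EuclideanSpace ℝ (Fin m)}
    {a : EuclideanSpace ℝ (Fin m) → EuclideanSpace ℝ (Fin m) [⋀^Fin k]→L[ℝ] ℝ}
    {b : EuclideanSpace ℝ (Fin m) → EuclideanSpace ℝ (Fin m) [⋀^Fin l]→L[ℝ] ℝ}
    (hs : UniqueDiffWithinAt ℝ s y)
    (ha : DifferentiableWithinAt ℝ a s y) (hb : DifferentiableWithinAt ℝ b s y) :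
    extDerivWithin (fun z => wedge h (a z) (b z)) s y =
      wedge h1 (extDerivWithin a s y) (b y) + (-1 : ℝ) ^ k • wedge h2 (a y) (extDerivWithin b s y) := by
  let L := (wedgeBilin (EuclideanSpace ℝ (Fin m)) h).toContinuousBilinearMap
  have hd := (L.hasFDerivWithinAt_of_bilinear ha.hasFDerivWithinAt hb.hasFDerivWithinAt).fderivWithin hs
  have e : extDerivWithin (fun z => wedge h (a z) (b z)) s y =
    ContinuousAlternatingMap.alternatizeUncurryFin (fderivWithin ℝ (fun z => L (a z) (b z)) s y) := rfl
  rw [e, hd, ContinuousAlternatingMap.alternatizeUncurryFin_add,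
    alternatizeUncurryFin_wedge_right h h2 (a y) (fderivWithin ℝ b s y) _ (fun v => rfl),
    alternatizeUncurryFin_wedge_left h h1 (fderivWithin ℝ a s y) (b y) _ (fun v => rfl)]
  exact add_comm _ _

end LeibnizAnalytic

/-! ### Forms and exterior derivative under change of charts -/

section ChartCalculus

variable {m : ℕ} {H : Type*} [TopologicalSpace H]
  (I : ModelWithCorners ℝ (EuclideanSpace ℝ (Fin m)) H)
  {M : Type*} [TopologicalSpace M] [ChartedSpace H M]

instance finiteDimensional_tangentSpace (x : M) : FiniteDimensional ℝ (TangentSpace I x) :=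
  inferInstanceAs (FiniteDimensional ℝ (EuclideanSpace ℝ (Fin m)))

/-- The differential of the inverse of the preferred chart at `x₀`. -/
noncomputable def chartD (x₀ : M) (y : EuclideanSpace ℝ (Fin m)) :
    EuclideanSpace ℝ (Fin m) →L[ℝ] TangentSpace I ((extChartAt I x₀).symm y) :=
  mfderivWithin 𝓘(ℝ, EuclideanSpace ℝ (Fin m)) I (extChartAt I x₀).symm (Set.range I) y

/-- The differential of the preferred chart at `x₀`. -/
noncomputable def chartDinv (x₀ x : M) :
    TangentSpace I x →L[ℝ] EuclideanSpace ℝ (Fin m) :=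
  mfderiv I 𝓘(ℝ, EuclideanSpace ℝ (Fin m)) (extChartAt I x₀) x

/-- The transition map between two preferred charts. -/
noncomputable def chartTrans (x₀ x₁ : M) (y : EuclideanSpace ℝ (Fin m)) :
    EuclideanSpace ℝ (Fin m) := extChartAt I x₁ ((extChartAt I x₀).symm y)

lemma chartPull_eq {k : ℕ} (x₀ : M) (y : EuclideanSpace ℝ (Fin m))
    (α : TangentSpace I ((extChartAt I x₀).symm y) [⋀^Fin k]→L[ℝ] ℝ) :
    chartPull I x₀ y α = α.compContinuousLinearMap (chartD I x₀ y) := rfl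

lemma chartPull_add {k : ℕ} (x₀ : M) (y : EuclideanSpace ℝ (Fin m))
    (α β : TangentSpace I ((extChartAt I x₀).symm y) [⋀^Fin k]→L[ℝ] ℝ) :
    chartPull I x₀ y (α + β) = chartPull I x₀ y α + chartPull I x₀ y β := rfl

lemma chartPull_smul {k : ℕ} (x₀ : M) (y : EuclideanSpace ℝ (Fin m)) (c : ℝ)
    (α : TangentSpace I ((extChartAt I x₀).symm y) [⋀^Fin k]→L[ℝ] ℝ) :
    chartPull I x₀ y (c • α) = c • chartPull I x₀ y α := rfl

lemma chartRep_add {k : ℕ} (η η' : DForm I M k) (x₀ : M) (y : EuclideanSpace ℝ (Fin m)) :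
    chartRep I (η + η') x₀ y = chartRep I η x₀ y + chartRep I η' x₀ y := rfl

lemma chartRep_smul {k : ℕ} (c : ℝ) (η : DForm I M k) (x₀ : M) (y : EuclideanSpace ℝ (Fin m)) :
    chartRep I (c • η) x₀ y = c • chartRep I η x₀ y := rfl

lemma chartRep_fun_smul {k : ℕ} (f : M → ℝ) (η : DForm I M k) (x₀ : M)
    (y : EuclideanSpace ℝ (Fin m)) :
    chartRep I (fun x => f x • η x) x₀ y =
      f ((extChartAt I x₀).symm y) • chartRep I η x₀ y := rfl

lemma chartRep_wedge {k l j : ℕ} (h : k + l = j) (α : DForm I M k) (β : DForm I M l) (x₀ : M)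
    (y : EuclideanSpace ℝ (Fin m)) :
    chartRep I (wedgeForm I h α β) x₀ y = wedge h (chartRep I α x₀ y) (chartRep I β x₀ y) :=
  wedge_comp h (chartD I x₀ y) _ _

variable [IsManifold I ∞ M]

lemma chartDinv_chartD {x₀ : M} {y : EuclideanSpace ℝ (Fin m)}
    (hy : y ∈ (extChartAt I x₀).target) (v : EuclideanSpace ℝ (Fin m)) :
    chartDinv I x₀ ((extChartAt I x₀).symm y) (chartD I x₀ y v) = v := by
  have := IsManifold.of_le (I := I) (M := M) (m := 1) (n := ∞) (by norm_num)
  exact DFunLike.congr_fun (mfderiv_extChartAt_comp_mfderivWithin_extChartAt_symm (I := I) hy) v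

lemma chartD_bijective {x₀ : M} {y : EuclideanSpace ℝ (Fin m)}
    (hy : y ∈ (extChartAt I x₀).target) : Function.Bijective (chartD I x₀ y) := by
  have := IsManifold.of_le (I := I) (M := M) (m := 1) (n := ∞) (by norm_num)
  exact (isInvertible_mfderivWithin_extChartAt_symm (I := I) hy).bijective

lemma chartD_chartDinv {x₀ : M} {y : EuclideanSpace ℝ (Fin m)}
    (hy : y ∈ (extChartAt I x₀).target) (v : TangentSpace I ((extChartAt I x₀).symm y)) :
    chartD I x₀ y (chartDinv I x₀ ((extChartAt I x₀).symm y) v) = v := by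
  obtain ⟨w, rfl⟩ := (chartD_bijective I hy).2 v
  rw [chartDinv_chartD I hy]

lemma form_eq_chartRep {k : ℕ} (η : DForm I M k) {x₀ : M} {y : EuclideanSpace ℝ (Fin m)}
    (hy : y ∈ (extChartAt I x₀).target) :
    η ((extChartAt I x₀).symm y) = (chartRep I η x₀ y).compContinuousLinearMap
      (chartDinv I x₀ ((extChartAt I x₀).symm y)) := by
  ext v
  change _ = η _ (fun i => chartD I x₀ y (chartDinv I x₀ _ (v i)))
  simp only [chartD_chartDinv I hy]

lemma form_eq_chartRep_at {k : ℕ} (η : DForm I M k) {x₀ x : M}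
    (hx : x ∈ (extChartAt I x₀).source) :
    η x = (chartRep I η x₀ (extChartAt I x₀ x)).compContinuousLinearMap (chartDinv I x₀ x) := by
  obtain ⟨y, hy, rfl⟩ : ∃ y ∈ (extChartAt I x₀).target, (extChartAt I x₀).symm y = x :=
    ⟨_, (extChartAt I x₀).map_source hx, (extChartAt I x₀).left_inv hx⟩
  rw [(extChartAt I x₀).right_inv hy]
  exact form_eq_chartRep I η hy

lemma contDiffOn_chartTrans (x₀ x₁ : M) : ContDiffOn ℝ ∞ (chartTrans I x₀ x₁)
    ((extChartAt I x₀).target ∩ (extChartAt I x₀).symm ⁻¹' (extChartAt I x₁).source) := by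
  have := contDiffOn_ext_coord_change (n := ∞) (I := I) x₁ x₀
  rwa [PartialEquiv.trans_source, PartialEquiv.symm_source] at this

/-- Because of this, derivatives on chart overlaps can all be taken within the single set `Set.range
I`. -/
lemma target_inter_mem_nhdsWithin {x₀ x₁ : M} {y : EuclideanSpace ℝ (Fin m)}
    (hy : y ∈ (extChartAt I x₀).target)
    (hy' : (extChartAt I x₀).symm y ∈ (extChartAt I x₁).source) :
    (extChartAt I x₀).target ∩ (extChartAt I x₀).symm ⁻¹' (extChartAt I x₁).source ∈
      𝓝[Set.range I] y := by
  refine Filter.inter_mem (extChartAt_target_mem_nhdsWithin_of_mem hy) ?_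
  have h1 := (continuousOn_extChartAt_symm (I := I) x₀) y hy
  have h2 := h1.preimage_mem_nhdsWithin ((isOpen_extChartAt_source (I := I) x₁).mem_nhds hy')
  exact nhdsWithin_le_of_mem (extChartAt_target_mem_nhdsWithin_of_mem hy) h2

lemma contDiffWithinAt_chartTrans {x₀ x₁ : M} {y : EuclideanSpace ℝ (Fin m)}
    (hy : y ∈ (extChartAt I x₀).target)
    (hy' : (extChartAt I x₀).symm y ∈ (extChartAt I x₁).source) :
    ContDiffWithinAt ℝ ∞ (chartTrans I x₀ x₁) (Set.range I) y :=
  ((contDiffOn_chartTrans I x₀ x₁) y ⟨hy, hy'⟩).mono_of_mem_nhdsWithin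
    (target_inter_mem_nhdsWithin I hy hy')

lemma uniqueDiffWithinAt_range_of_target {x₀ : M} {y : EuclideanSpace ℝ (Fin m)}
    (hy : y ∈ (extChartAt I x₀).target) : UniqueDiffWithinAt ℝ (Set.range I) y :=
  I.uniqueDiffOn y (extChartAt_target_subset_range x₀ hy)

lemma chartDinv_comp_chartD {x₀ x₁ : M} {y : EuclideanSpace ℝ (Fin m)}
    (hy : y ∈ (extChartAt I x₀).target)
    (hy' : (extChartAt I x₀).symm y ∈ (extChartAt I x₁).source) :
    (chartDinv I x₁ ((extChartAt I x₀).symm y)).comp (chartD I x₀ y) =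
      fderivWithin ℝ (chartTrans I x₀ x₁) (Set.range I) y := by
  have := IsManifold.of_le (I := I) (M := M) (m := 1) (n := ∞) (by norm_num)
  rw [← mfderivWithin_eq_fderivWithin]
  have h1 := mdifferentiableAt_extChartAt (I := I) (x := x₁) (by simpa using hy')
  have h2 := mdifferentiableWithinAt_extChartAt_symm (I := I) hy
  exact (mfderiv_comp_mfderivWithin y h1 h2
    (uniqueMDiffWithinAt_iff_uniqueDiffWithinAt.2 (uniqueDiffWithinAt_range_of_target I hy))).symm

/-- The change of coordinates of a form. -/
lemma chartRep_trans {k : ℕ} (η : DForm I M k) {x₀ x₁ : M} {y : EuclideanSpace ℝ (Fin m)}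
    (hy : y ∈ (extChartAt I x₀).target)
    (hy' : (extChartAt I x₀).symm y ∈ (extChartAt I x₁).source) :
    chartRep I η x₀ y = (chartRep I η x₁ (chartTrans I x₀ x₁ y)).compContinuousLinearMap
      (fderivWithin ℝ (chartTrans I x₀ x₁) (Set.range I) y) := by
  rw [← chartDinv_comp_chartD I hy hy', chartRep, chartPull_eq, form_eq_chartRep_at I η hy']
  rfl

lemma SmoothForm.contDiffWithinAt {k : ℕ} {η : DForm I M k} (hη : SmoothForm I η) {x₀ : M}
    {y : EuclideanSpace ℝ (Fin m)} (hy : y ∈ (extChartAt I x₀).target) :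
    ContDiffWithinAt ℝ ∞ (chartRep I η x₀) (Set.range I) y :=
  (hη x₀ y hy).mono_of_mem_nhdsWithin (extChartAt_target_mem_nhdsWithin_of_mem hy)

lemma mem_target_chartTrans {x₀ x₁ : M} {y : EuclideanSpace ℝ (Fin m)}
    (hy' : (extChartAt I x₀).symm y ∈ (extChartAt I x₁).source) :
    chartTrans I x₀ x₁ y ∈ (extChartAt I x₁).target := (extChartAt I x₁).map_source hy'

/-- The exterior derivative can be computed in every chart. -/
lemma chartRep_extD {k : ℕ} {η : DForm I M k} (hη : SmoothForm I η) {x₀ : M}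
    {y : EuclideanSpace ℝ (Fin m)} (hy : y ∈ (extChartAt I x₀).target) :
    chartRep I (extD I rfl η) x₀ y = extDerivWithin (chartRep I η x₀) (Set.range I) y := by
  set z := (extChartAt I x₀).symm y with hz
  have hy' : (extChartAt I x₀).symm y ∈ (extChartAt I z).source := mem_extChartAt_source z
  have e1 : chartRep I (extD I rfl η) x₀ y = (extDerivWithin (chartRep I η z) (Set.range I)
      (chartTrans I x₀ z y)).compContinuousLinearMap
        ((chartDinv I z ((extChartAt I x₀).symm y)).comp (chartD I x₀ y)) := rfl
  have e2 : chartRep I η x₀ =ᶠ[𝓝[Set.range I] y] fun y' =>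
      (chartRep I η z (chartTrans I x₀ z y')).compContinuousLinearMap
        (fderivWithin ℝ (chartTrans I x₀ z) (Set.range I) y') := by
    filter_upwards [target_inter_mem_nhdsWithin I hy hy'] with y' h
    exact chartRep_trans I η h.1 h.2
  have hyr := extChartAt_target_subset_range x₀ hy
  rw [e1, e2.extDerivWithin_eq_of_mem hyr, chartDinv_comp_chartD I hy hy']
  symm
  -- Naturality of the exterior derivative under the transition map. It uses the symmetry of second
  -- derivatives, which persists at the boundary because `Set.range I` lies in the closure of its
  -- interior.
  refine extDerivWithin_pullback (r := ∞) (t := Set.range I) ?_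
    (contDiffWithinAt_chartTrans I hy hy') ?_ I.uniqueDiffOn
    (I.range_subset_closure_interior hyr) hyr ?_
  · exact (hη.contDiffWithinAt I (mem_target_chartTrans I hy')).differentiableWithinAt (by simp)
  · rw [minSmoothness_of_isRCLikeNormedField]
    exact WithTop.coe_le_coe.2 (le_top : (2 : ℕ∞) ≤ ⊤)
  · intro y' _
    exact ⟨_, rfl⟩

end ChartCalculus

/-! ### Smooth forms and smooth curves of forms -/

section Curves

variable {m : ℕ} {H : Type*} [TopologicalSpace H]
  {I : ModelWithCorners ℝ (EuclideanSpace ℝ (Fin m)) H}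
  {M : Type*} [TopologicalSpace M] [ChartedSpace H M]
  {J : Set ℝ}

lemma SmoothForm.curve {k : ℕ} {η : DForm I M k} (hη : SmoothForm I η) (J : Set ℝ) :
    SmoothCurve I J (fun _ => η) := fun x₀ =>
  (hη x₀).comp contDiffOn_snd fun _ hz => hz.2

lemma SmoothCurve.form {k : ℕ} {η : ℝ → DForm I M k} (hη : SmoothCurve I J η) {t : ℝ}
    (ht : t ∈ J) : SmoothForm I (η t) := fun x₀ =>
  (hη x₀).comp (contDiffOn_const.prodMk contDiffOn_id) fun _ hy => ⟨ht, hy⟩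

/-- A form is a constant curve; closure properties can therefore be proved for curves and
specialised. -/
lemma SmoothForm.of_curve {k : ℕ} {η : DForm I M k} (hη : SmoothCurve I Set.univ (fun _ => η)) :
    SmoothForm I η := hη.form (Set.mem_univ (0 : ℝ))

lemma SmoothCurve.add {k : ℕ} {η η' : ℝ → DForm I M k} (hη : SmoothCurve I J η)
    (hη' : SmoothCurve I J η') : SmoothCurve I J (fun t => η t + η' t) := fun x₀ =>
  (hη x₀).add (hη' x₀)

lemma SmoothCurve.const_smul {k : ℕ} {η : ℝ → DForm I M k} (hη : SmoothCurve I J η) (c : ℝ) :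
    SmoothCurve I J (fun t => c • η t) := fun x₀ => (hη x₀).const_smul c

lemma smoothForm_zero {k : ℕ} : SmoothForm I (0 : DForm I M k) := fun x₀ => by
  have : chartRep I (0 : DForm I M k) x₀ = fun _ => 0 := rfl
  rw [this]
  exact contDiffOn_const

lemma SmoothForm.add {k : ℕ} {η η' : DForm I M k} (hη : SmoothForm I η)
    (hη' : SmoothForm I η') : SmoothForm I (η + η') := fun x₀ => (hη x₀).add (hη' x₀)

lemma SmoothForm.const_smul {k : ℕ} {η : DForm I M k} (hη : SmoothForm I η) (c : ℝ) :
    SmoothForm I (c • η) := fun x₀ => (hη x₀).const_smul c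

lemma SmoothForm.neg {k : ℕ} {η : DForm I M k} (hη : SmoothForm I η) :
    SmoothForm I (-η) := fun x₀ => (hη x₀).neg

lemma SmoothForm.sum {k : ℕ} {ι : Type*} (s : Finset ι) {η : ι → DForm I M k}
    (hη : ∀ i ∈ s, SmoothForm I (η i)) : SmoothForm I (∑ i ∈ s, η i) :=
  Finset.sum_induction _ _ (fun _ _ => SmoothForm.add) smoothForm_zero hη

lemma SmoothCurve.wedge {k l j : ℕ} (h : k + l = j) {η : ℝ → DForm I M k} {η' : ℝ → DForm I M l}
    (hη : SmoothCurve I J η) (hη' : SmoothCurve I J η') :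
    SmoothCurve I J (fun t => wedgeForm I h (η t) (η' t)) := fun x₀ => by
  simp only [chartRep_wedge]
  exact (hη x₀).wedge h (hη' x₀)

lemma SmoothForm.wedge {k l j : ℕ} (h : k + l = j) {η : DForm I M k} {η' : DForm I M l}
    (hη : SmoothForm I η) (hη' : SmoothForm I η') : SmoothForm I (wedgeForm I h η η') :=
  .of_curve ((hη.curve _).wedge h (hη'.curve _))

variable [IsManifold I ∞ M]

lemma contDiffOn_comp_extChartAt_symm {f : M → ℝ} (hf : ContMDiff I 𝓘(ℝ) ∞ f) (x₀ : M) :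
    ContDiffOn ℝ ∞ (fun y => f ((extChartAt I x₀).symm y)) (extChartAt I x₀).target := by
  rw [← contMDiffOn_iff_contDiffOn]
  exact hf.comp_contMDiffOn (contMDiffOn_extChartAt_symm x₀)

lemma SmoothForm.fun_smul {k : ℕ} {f : M → ℝ} (hf : ContMDiff I 𝓘(ℝ) ∞ f) {η : DForm I M k}
    (hη : SmoothForm I η) : SmoothForm I (fun x => f x • η x) := fun x₀ => by
  simp only [funext (chartRep_fun_smul I f η x₀)]
  exact (contDiffOn_comp_extChartAt_symm hf x₀).smul (hη x₀)

lemma chartRep_endo {k : ℕ} (T : ∀ x : M, (TangentSpace I x [⋀^Fin k]→L[ℝ] ℝ) →ₗ[ℝ]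
      (TangentSpace I x [⋀^Fin k]→L[ℝ] ℝ)) (η : DForm I M k) {x₀ : M}
      {y : EuclideanSpace ℝ (Fin m)} (hy : y ∈ (extChartAt I x₀).target) :
    chartRep I (fun x => T x (η x)) x₀ y = chartPull I x₀ y (T ((extChartAt I x₀).symm y)
        ((chartRep I η x₀ y).compContinuousLinearMap
          (mfderiv I 𝓘(ℝ, EuclideanSpace ℝ (Fin m)) (extChartAt I x₀)
            ((extChartAt I x₀).symm y)))) := by
  rw [chartRep, form_eq_chartRep I η hy]
  rfl

/-- Smoothness of `T` concerns its values on constant covectors of a chart, so the form is expanded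
in a fixed basis of covectors, with coefficients smooth in time and space. -/
lemma SmoothCurve.endo {k : ℕ} {T : ∀ x : M, (TangentSpace I x [⋀^Fin k]→L[ℝ] ℝ) →ₗ[ℝ]
      (TangentSpace I x [⋀^Fin k]→L[ℝ] ℝ)} (hT : SmoothEndo I T) {η : ℝ → DForm I M k}
    (hη : SmoothCurve I J η) : SmoothCurve I J (fun t x => T x (η t x)) := fun x₀ => by
  let F := EuclideanSpace ℝ (Fin m) [⋀^Fin k]→L[ℝ] ℝ
  let b := Module.finBasis ℝ F
  let P (y : EuclideanSpace ℝ (Fin m)) : F →ₗ[ℝ] F :=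
    { toFun := fun β => chartPull I x₀ y (T ((extChartAt I x₀).symm y)
        (β.compContinuousLinearMap
          (mfderiv I 𝓘(ℝ, EuclideanSpace ℝ (Fin m)) (extChartAt I x₀)
            ((extChartAt I x₀).symm y))))
      map_add' := fun β β' => by
        rw [← chartPull_add, ← map_add]; rfl
      map_smul' := fun c β => by
        rw [RingHom.id_apply, ← chartPull_smul, ← map_smul]; rfl }
  have e : ∀ z ∈ J ×ˢ (extChartAt I x₀).target,
      chartRep I (fun x => T x (η z.1 x)) x₀ z.2 =
        ∑ i, b.repr (chartRep I (η z.1) x₀ z.2) i • P z.2 (b i) := by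
    intro z hz
    rw [chartRep_endo T _ hz.2]
    change P z.2 (chartRep I (η z.1) x₀ z.2) = _
    conv_lhs => rw [← b.sum_repr (chartRep I (η z.1) x₀ z.2), map_sum]
    simp only [map_smul]
  have hs : ContDiffOn ℝ ∞ (fun z : ℝ × EuclideanSpace ℝ (Fin m) =>
      ∑ i, b.repr (chartRep I (η z.1) x₀ z.2) i • P z.2 (b i)) (J ×ˢ (extChartAt I x₀).target) := by
    refine ContDiffOn.sum fun i _ => ContDiffOn.smul (𝕜 := ℝ) (𝕜' := ℝ) ?_ ?_
    rotate_left
    · exact (hT x₀ (b i)).comp contDiffOn_snd fun _ hz => hz.2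
    exact (hη x₀).linearMap_comp (b.coord i)
  exact hs.congr e

lemma SmoothForm.endo {k : ℕ} {T : ∀ x : M, (TangentSpace I x [⋀^Fin k]→L[ℝ] ℝ) →ₗ[ℝ]
      (TangentSpace I x [⋀^Fin k]→L[ℝ] ℝ)} (hT : SmoothEndo I T) {η : DForm I M k}
    (hη : SmoothForm I η) : SmoothForm I (fun x => T x (η x)) :=
  .of_curve ((hη.curve _).endo hT)

end Curves

/-! ### Exchange of time and space derivatives -/

section PartialDerivatives

variable {E F : Type*} [NormedAddCommGroup E] [NormedSpace ℝ E] [NormedAddCommGroup F]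
  [NormedSpace ℝ F] {J : Set ℝ} {T : Set E} {f : ℝ → E → F}

lemma uniqueDiffOn_prod_open (hJ : IsOpen J) (hT : UniqueDiffOn ℝ T) :
    UniqueDiffOn ℝ (J ×ˢ T) := hJ.uniqueDiffOn.prod hT

lemma ContDiffOn.hasFDerivWithinAt_uncurry
    (hf : ContDiffOn ℝ ∞ (fun z : ℝ × E => f z.1 z.2) (J ×ˢ T)) {t : ℝ} (ht : t ∈ J) {y : E}
    (hy : y ∈ T) : HasFDerivWithinAt (fun z : ℝ × E => f z.1 z.2)
      (fderivWithin ℝ (fun z : ℝ × E => f z.1 z.2) (J ×ˢ T) (t, y)) (J ×ˢ T) (t, y) :=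
  ((hf (t, y) ⟨ht, hy⟩).differentiableWithinAt (by simp)).hasFDerivWithinAt

lemma HasFDerivWithinAt.partial_time {g : ℝ × E → F} {g' : ℝ × E →L[ℝ] F} (hJ : IsOpen J)
    {t : ℝ} {y : E}
    (hg : HasFDerivWithinAt g g' (J ×ˢ T) (t, y)) (ht : t ∈ J) (hy : y ∈ T) :
    HasDerivAt (fun s => g (s, y)) (g' (1, 0)) t := by
  have h1 : HasFDerivWithinAt (fun s : ℝ => (s, y)) (ContinuousLinearMap.inl ℝ ℝ E) J t :=
    (hasFDerivAt_prodMk_left t y).hasFDerivWithinAt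
  have hm : Set.MapsTo (fun s : ℝ => (s, y)) J (J ×ˢ T) := fun s hs => ⟨hs, hy⟩
  have h2 := (HasFDerivWithinAt.comp (x := t) (g := g) hg h1 hm).hasFDerivAt (hJ.mem_nhds ht)
  simpa [Function.comp_def] using h2.hasDerivAt

lemma HasFDerivWithinAt.partial_space {g : ℝ × E → F} {g' : ℝ × E →L[ℝ] F} {t : ℝ} {y : E}
    (hg : HasFDerivWithinAt g g' (J ×ˢ T) (t, y)) (ht : t ∈ J) :
    HasFDerivWithinAt (fun y' => g (t, y')) (g'.comp (ContinuousLinearMap.inr ℝ ℝ E)) T y := by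
  have h1 : HasFDerivWithinAt (fun y' : E => (t, y')) (ContinuousLinearMap.inr ℝ ℝ E) T y :=
    (hasFDerivAt_prodMk_right t y).hasFDerivWithinAt
  exact HasFDerivWithinAt.comp (x := y) (g := g) hg h1 (fun s hs => ⟨ht, hs⟩)

lemma ContDiffOn.hasDerivAt_time (hJ : IsOpen J)
    (hf : ContDiffOn ℝ ∞ (fun z : ℝ × E => f z.1 z.2) (J ×ˢ T)) {t : ℝ} (ht : t ∈ J) {y : E}
    (hy : y ∈ T) : HasDerivAt (fun s => f s y)
      (fderivWithin ℝ (fun z : ℝ × E => f z.1 z.2) (J ×ˢ T) (t, y) (1, 0)) t :=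
  (hf.hasFDerivWithinAt_uncurry ht hy).partial_time hJ ht hy

lemma ContDiffOn.fderivWithin_space (hT : UniqueDiffOn ℝ T)
    (hf : ContDiffOn ℝ ∞ (fun z : ℝ × E => f z.1 z.2) (J ×ˢ T)) {t : ℝ} (ht : t ∈ J) {y : E}
    (hy : y ∈ T) : fderivWithin ℝ (f t) T y =
      (fderivWithin ℝ (fun z : ℝ × E => f z.1 z.2) (J ×ˢ T) (t, y)).comp
        (ContinuousLinearMap.inr ℝ ℝ E) :=
  ((hf.hasFDerivWithinAt_uncurry ht hy).partial_space ht).fderivWithin (hT y hy)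

lemma ContDiffOn.fderivWithin_uncurry (hJ : IsOpen J) (hT : UniqueDiffOn ℝ T)
    (hf : ContDiffOn ℝ ∞ (fun z : ℝ × E => f z.1 z.2) (J ×ˢ T)) :
    ContDiffOn ℝ ∞ (fderivWithin ℝ (fun z : ℝ × E => f z.1 z.2) (J ×ˢ T)) (J ×ˢ T) :=
  hf.fderivWithin (uniqueDiffOn_prod_open hJ hT) (by simp)

/-- The time derivative commutes with the spatial differential. -/
lemma ContDiffOn.hasDerivAt_fderivWithin (hJ : IsOpen J) (hT : UniqueDiffOn ℝ T)
    (hT' : T ⊆ closure (interior T))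
    (hf : ContDiffOn ℝ ∞ (fun z : ℝ × E => f z.1 z.2) (J ×ˢ T)) {t : ℝ} (ht : t ∈ J) {y : E}
    (hy : y ∈ T) : HasDerivAt (fun s => fderivWithin ℝ (f s) T y)
      (fderivWithin ℝ (fun y' => deriv (fun s => f s y') t) T y) t := by
  set D := J ×ˢ T
  set F' := fderivWithin ℝ (fun z : ℝ × E => f z.1 z.2) D with hF'
  have hF := hf.fderivWithin_uncurry hJ hT
  have hF2 : HasFDerivWithinAt F' (fderivWithin ℝ F' D (t, y)) D (t, y) :=
    ((hF (t, y) ⟨ht, hy⟩).differentiableWithinAt (by simp)).hasFDerivWithinAt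
  -- Mixed second derivatives agree also at boundary points of `T`, as these lie in the closure of
  -- the interior of `J × T`.
  have hsymm : IsSymmSndFDerivWithinAt ℝ (fun z : ℝ × E => f z.1 z.2) D (t, y) := by
    refine (hf (t, y) ⟨ht, hy⟩).isSymmSndFDerivWithinAt ?_ (uniqueDiffOn_prod_open hJ hT) ?_
      ⟨ht, hy⟩
    · rw [minSmoothness_of_isRCLikeNormedField]
      exact WithTop.coe_le_coe.2 (le_top : (2 : ℕ∞) ≤ ⊤)
    · rw [interior_prod_eq, closure_prod_eq, hJ.interior_eq]
      exact ⟨subset_closure ht, hT' hy⟩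
  have h1 : HasDerivAt (fun s => F' (s, y)) (fderivWithin ℝ F' D (t, y) (1, 0)) t :=
    hF2.partial_time hJ ht hy
  have h2 : HasDerivAt (fun s => (F' (s, y)).comp (ContinuousLinearMap.inr ℝ ℝ E))
      ((fderivWithin ℝ F' D (t, y) (1, 0)).comp (ContinuousLinearMap.inr ℝ ℝ E)) t := by
    simpa using h1.clm_comp (hasDerivAt_const t (ContinuousLinearMap.inr ℝ ℝ E))
  -- Both sides are mixed second derivatives of the joint function, taken in opposite orders.
  have h3 : (fderivWithin ℝ F' D (t, y) (1, 0)).comp (ContinuousLinearMap.inr ℝ ℝ E) =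
      fderivWithin ℝ (fun y' => deriv (fun s => f s y') t) T y := by
    have e : fderivWithin ℝ (fun y' => deriv (fun s => f s y') t) T y =
        fderivWithin ℝ (fun y' => F' (t, y') (1, 0)) T y :=
      fderivWithin_congr (fun y' hy' => (hf.hasDerivAt_time hJ ht hy').deriv)
        (hf.hasDerivAt_time hJ ht hy).deriv
    have h4 : HasFDerivWithinAt (fun y' => F' (t, y'))
        ((fderivWithin ℝ F' D (t, y)).comp (ContinuousLinearMap.inr ℝ ℝ E)) T y :=
      hF2.partial_space ht
    have h5 := h4.clm_apply (hasFDerivWithinAt_const ((1 : ℝ), (0 : E)) y T)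
    rw [e, h5.fderivWithin (hT y hy)]
    ext w
    simp only [ContinuousLinearMap.comp_apply, ContinuousLinearMap.inr_apply]
    have := hsymm (1, 0) (0, w)
    simpa using this
  rw [← h3]
  refine h2.congr_of_eventuallyEq ?_
  filter_upwards [hJ.mem_nhds ht] with s hs
  exact hf.fderivWithin_space hT hs hy

end PartialDerivatives

/-! ### Time derivative and exterior derivative of forms -/

section CurveDerivatives

variable {m : ℕ} {H : Type*} [TopologicalSpace H]
  {I : ModelWithCorners ℝ (EuclideanSpace ℝ (Fin m)) H}
  {M : Type*} [TopologicalSpace M] [ChartedSpace H M] [IsManifold I ∞ M]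
  {J : Set ℝ}

lemma HasDerivAt.linearMap_comp {F G : Type*} [NormedAddCommGroup F] [NormedSpace ℝ F]
    [FiniteDimensional ℝ F] [NormedAddCommGroup G] [NormedSpace ℝ G] {f : ℝ → F} {f' : F} {t : ℝ}
    (hf : HasDerivAt f f' t) (L : F →ₗ[ℝ] G) : HasDerivAt (fun s => L (f s)) (L f') t :=
  (LinearMap.toContinuousLinearMap L).hasFDerivAt.comp_hasDerivAt t hf

lemma HasDerivAt.bilinear_comp {F F' G : Type*} [NormedAddCommGroup F] [NormedSpace ℝ F]
    [FiniteDimensional ℝ F] [NormedAddCommGroup F'] [NormedSpace ℝ F'] [FiniteDimensional ℝ F']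
    [NormedAddCommGroup G] [NormedSpace ℝ G] {f : ℝ → F} {f₁ : F} {g : ℝ → F'} {g₁ : F'} {t : ℝ}
    (hf : HasDerivAt f f₁ t) (hg : HasDerivAt g g₁ t) (L : F →ₗ[ℝ] F' →ₗ[ℝ] G) :
    HasDerivAt (fun s => L (f s) (g s)) (L f₁ (g t) + L (f t) g₁) t := by
  have := (L.toContinuousBilinearMap).hasFDerivAt_of_bilinear hf.hasFDerivAt hg.hasFDerivAt
  have h2 := this.hasDerivAt
  rw [add_comm]
  simpa using h2

lemma SmoothCurve.hasDerivAt_chart_aux {k : ℕ} {η : ℝ → DForm I M k} (hη : SmoothCurve I J η)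
    (hJ : IsOpen J) {t : ℝ} (ht : t ∈ J) {x₀ : M} {y : EuclideanSpace ℝ (Fin m)}
    (hy : y ∈ (extChartAt I x₀).target) :
    HasDerivAt (fun s => chartRep I (η s) x₀ y) (deriv (fun s => chartRep I (η s) x₀ y) t) t :=
  (ContDiffOn.hasDerivAt_time (f := fun s => chartRep I (η s) x₀) hJ (hη x₀) ht hy).differentiableAt.hasDerivAt

/-- Smoothness is given for chart expressions; at a fixed point these are carried back to the
tangent space by a linear map that does not depend on time. -/
lemma SmoothCurve.hasDerivAt {k : ℕ} {η : ℝ → DForm I M k} (hη : SmoothCurve I J η)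
    (hJ : IsOpen J) {t : ℝ} (ht : t ∈ J) (x : M) :
    HasDerivAt (F := EuclideanSpace ℝ (Fin m) [⋀^Fin k]→L[ℝ] ℝ) (fun s => η s x)
      (timeDeriv I η t x) t := by
  have hx := mem_extChartAt_source (I := I) x
  have h1 := hη.hasDerivAt_chart_aux hJ ht ((extChartAt I x).map_source hx)
  let L : (EuclideanSpace ℝ (Fin m) [⋀^Fin k]→L[ℝ] ℝ) →ₗ[ℝ]
      (EuclideanSpace ℝ (Fin m) [⋀^Fin k]→L[ℝ] ℝ) :=
    ⟨⟨fun α => α.compContinuousLinearMap (chartDinv I x x), fun _ _ => rfl⟩, fun _ _ => rfl⟩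
  have h2 := h1.linearMap_comp L
  have e : (fun s => L (chartRep I (η s) x (extChartAt I x x))) = fun s => η s x :=
    funext fun s => (form_eq_chartRep_at I (η s) hx).symm
  rw [e] at h2
  exact h2.differentiableAt.hasDerivAt

lemma SmoothCurve.hasDerivAt_chartRep {k : ℕ} {η : ℝ → DForm I M k} (hη : SmoothCurve I J η)
    (hJ : IsOpen J) {t : ℝ} (ht : t ∈ J) (x₀ : M) (y : EuclideanSpace ℝ (Fin m)) :
    HasDerivAt (fun s => chartRep I (η s) x₀ y) (chartRep I (timeDeriv I η t) x₀ y) t := by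
  have h1 := hη.hasDerivAt hJ ht ((extChartAt I x₀).symm y)
  let L : (EuclideanSpace ℝ (Fin m) [⋀^Fin k]→L[ℝ] ℝ) →ₗ[ℝ]
      (EuclideanSpace ℝ (Fin m) [⋀^Fin k]→L[ℝ] ℝ) :=
    ⟨⟨fun α => α.compContinuousLinearMap (chartD I x₀ y), fun _ _ => rfl⟩, fun _ _ => rfl⟩
  exact h1.linearMap_comp L

lemma form_ext_at {k : ℕ} {η η' : DForm I M k} {x : M}
    (h : chartRep I η x (extChartAt I x x) = chartRep I η' x (extChartAt I x x)) : η x = η' x := by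
  rw [form_eq_chartRep_at I η (mem_extChartAt_source x),
    form_eq_chartRep_at I η' (mem_extChartAt_source x), h]

lemma timeDeriv_eq {k : ℕ} {η : ℝ → DForm I M k} {t : ℝ} {δ : DForm I M k}
    (h : ∀ x, HasDerivAt (F := EuclideanSpace ℝ (Fin m) [⋀^Fin k]→L[ℝ] ℝ) (fun s => η s x)
      (δ x) t) : timeDeriv I η t = δ := funext fun x => (h x).deriv

lemma SmoothCurve.timeDeriv {k : ℕ} {η : ℝ → DForm I M k} (hη : SmoothCurve I J η)
    (hJ : IsOpen J) : SmoothCurve I J (timeDeriv I η) := fun x₀ => by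
  have h1 := (ContDiffOn.fderivWithin_uncurry (f := fun s => chartRep I (η s) x₀) hJ
    (uniqueDiffOn_extChartAt_target x₀) (hη x₀)).clm_apply
    (contDiffOn_const (c := ((1 : ℝ), (0 : EuclideanSpace ℝ (Fin m)))))
  refine h1.congr fun z hz => ?_
  exact (hη.hasDerivAt_chartRep hJ hz.1 x₀ z.2).unique
    (ContDiffOn.hasDerivAt_time (f := fun s => chartRep I (η s) x₀) hJ (hη x₀) hz.1 hz.2)

/-- The exterior derivative is taken within `Set.range I`, while curves are smooth on `J ×ˢ target`;
near a point of the target the two derivatives agree. -/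
lemma chartRep_extD_target {k : ℕ} {η : DForm I M k} (hη : SmoothForm I η) {x₀ : M}
    {y : EuclideanSpace ℝ (Fin m)} (hy : y ∈ (extChartAt I x₀).target) :
    chartRep I (extD I rfl η) x₀ y =
      extDerivWithin (chartRep I η x₀) (extChartAt I x₀).target y := by
  rw [chartRep_extD I hη hy, extDerivWithin, extDerivWithin]
  congr 1
  exact fderivWithin_of_mem_nhdsWithin (extChartAt_target_mem_nhdsWithin_of_mem hy)
    (uniqueDiffWithinAt_range_of_target I hy) ((hη x₀ y hy).differentiableWithinAt (by simp))

lemma SmoothCurve.extD {k l : ℕ} (h : k + 1 = l) {η : ℝ → DForm I M k} (hη : SmoothCurve I J η)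
    (hJ : IsOpen J) : SmoothCurve I J (fun t => extD I h (η t)) := fun x₀ => by
  subst h
  have hT := uniqueDiffOn_extChartAt_target (I := I) x₀
  have h1 := (ContDiffOn.fderivWithin_uncurry (f := fun s => chartRep I (η s) x₀) hJ hT
    (hη x₀)).clm_comp
    (contDiffOn_const (c := ContinuousLinearMap.inr ℝ ℝ (EuclideanSpace ℝ (Fin m))))
  have h2 := (ContinuousAlternatingMap.alternatizeUncurryFinCLM ℝ (EuclideanSpace ℝ (Fin m))
    ℝ (n := k)).contDiff.comp_contDiffOn h1
  refine h2.congr fun z hz => ?_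
  rw [chartRep_extD_target (hη.form hz.1) hz.2, extDerivWithin,
    ContDiffOn.fderivWithin_space (f := fun s => chartRep I (η s) x₀) hT (hη x₀) hz.1 hz.2]
  rfl

lemma SmoothForm.extD {k l : ℕ} (h : k + 1 = l) {η : DForm I M k} (hη : SmoothForm I η) :
    SmoothForm I (extD I h η) := .of_curve ((hη.curve _).extD h isOpen_univ)

/-- In a chart this is the interchange `ContDiffOn.hasDerivAt_fderivWithin`, followed by
alternatization, a fixed continuous linear map. -/
lemma timeDeriv_extD {k l : ℕ} (h : k + 1 = l) {η : ℝ → DForm I M k} (hη : SmoothCurve I J η)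
    (hJ : IsOpen J) {t : ℝ} (ht : t ∈ J) :
    timeDeriv I (fun s => extD I h (η s)) t = extD I h (timeDeriv I η t) := by
  subst h
  ext1 x
  have hx := mem_extChartAt_target (I := I) x
  have h1 := (hη.extD rfl hJ).hasDerivAt_chartRep hJ ht x (extChartAt I x x)
  have hT := uniqueDiffOn_extChartAt_target (I := I) x
  have h2 := ContDiffOn.hasDerivAt_fderivWithin (f := fun s => chartRep I (η s) x) hJ hT
    extChartAt_target_subset_closure_interior (hη x) ht hx
  have h3 := (ContinuousAlternatingMap.alternatizeUncurryFinCLM ℝ (EuclideanSpace ℝ (Fin m))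
    ℝ (n := k)).hasFDerivAt.comp_hasDerivAt t h2
  have h4 : (fun s => chartRep I (extD I rfl (η s)) x (extChartAt I x x)) =ᶠ[𝓝 t]
      (ContinuousAlternatingMap.alternatizeUncurryFinCLM ℝ (EuclideanSpace ℝ (Fin m))
        ℝ (n := k)) ∘ fun s => fderivWithin ℝ (chartRep I (η s) x) (extChartAt I x).target
          (extChartAt I x x) := by
    filter_upwards [hJ.mem_nhds ht] with s hs
    rw [chartRep_extD_target (hη.form hs) hx]
    rfl
  have h5 := h1.unique (h3.congr_of_eventuallyEq h4)
  refine form_ext_at ?_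
  rw [chartRep_extD_target ((hη.timeDeriv hJ).form ht) hx]
  refine h5.trans ?_
  rw [extDerivWithin]
  refine congrArg (ContinuousAlternatingMap.alternatizeUncurryFinCLM ℝ (EuclideanSpace ℝ (Fin m))
    ℝ (n := k)) ?_
  exact fderivWithin_congr (fun y hy => (hη.hasDerivAt_chartRep hJ ht x y).deriv)
    (hη.hasDerivAt_chartRep hJ ht x _).deriv

lemma timeDeriv_wedge {k l j : ℕ} (h : k + l = j) {η : ℝ → DForm I M k} {η' : ℝ → DForm I M l}
    (hη : SmoothCurve I J η) (hη' : SmoothCurve I J η') (hJ : IsOpen J) {t : ℝ} (ht : t ∈ J) :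
    timeDeriv I (fun s => wedgeForm I h (η s) (η' s)) t =
      wedgeForm I h (timeDeriv I η t) (η' t) + wedgeForm I h (η t) (timeDeriv I η' t) :=
  timeDeriv_eq fun x => (hη.hasDerivAt hJ ht x).bilinear_comp (hη'.hasDerivAt hJ ht x)
    (wedgeBilin (EuclideanSpace ℝ (Fin m)) h)

/-- A fibrewise linear operator that does not depend on time commutes with the time derivative at
each point, so no regularity of `L` in `x` is required. It covers the star, the restriction to the
boundary (`f` being the inclusion), `G`, `R` and scalar factors. -/
lemma timeDeriv_linear {k l : ℕ} {m' : ℕ} {H' : Type*} [TopologicalSpace H']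
    {I' : ModelWithCorners ℝ (EuclideanSpace ℝ (Fin m')) H'}
    {M' : Type*} [TopologicalSpace M'] [ChartedSpace H' M'] [IsManifold I' ∞ M'] (f : M' → M)
    (L : ∀ x : M', (TangentSpace I (f x) [⋀^Fin k]→L[ℝ] ℝ) →ₗ[ℝ]
      (TangentSpace I' x [⋀^Fin l]→L[ℝ] ℝ)) {η : ℝ → DForm I M k}
    (hη : SmoothCurve I J η) (hJ : IsOpen J) {t : ℝ} (ht : t ∈ J) :
    timeDeriv I' (fun s x => L x (η s (f x))) t = fun x => L x (timeDeriv I η t (f x)) :=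
  timeDeriv_eq fun x => (hη.hasDerivAt hJ ht (f x)).linearMap_comp
    (F := EuclideanSpace ℝ (Fin m) [⋀^Fin k]→L[ℝ] ℝ)
    (G := EuclideanSpace ℝ (Fin m') [⋀^Fin l]→L[ℝ] ℝ) (L x)

lemma extD_wedge {k l j : ℕ} (h : k + l = j) (h1 : k + 1 + l = j + 1) (h2 : k + (l + 1) = j + 1)
    {η : DForm I M k} {η' : DForm I M l} (hη : SmoothForm I η) (hη' : SmoothForm I η') :
    extD I rfl (wedgeForm I h η η') = wedgeForm I h1 (extD I rfl η) η' +
      (-1 : ℝ) ^ k • wedgeForm I h2 η (extD I rfl η') := by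
  ext1 x
  have hx := mem_extChartAt_target (I := I) x
  refine form_ext_at ?_
  rw [chartRep_add, chartRep_smul, chartRep_wedge, chartRep_wedge, chartRep_extD I (hη.wedge h hη') hx,
    chartRep_extD I hη hx, chartRep_extD I hη' hx, ← extDerivWithin_wedge h h1 h2
      (uniqueDiffWithinAt_range_of_target I hx)
      ((hη.contDiffWithinAt I hx).differentiableWithinAt (by simp))
      ((hη'.contDiffWithinAt I hx).differentiableWithinAt (by simp))]
  congr 1
  ext1 y
  exact chartRep_wedge I h η η' x y

lemma extD_add {k l : ℕ} (h : k + 1 = l) {η η' : DForm I M k} (hη : SmoothForm I η)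
    (hη' : SmoothForm I η') : extD I h (η + η') = extD I h η + extD I h η' := by
  subst h
  ext1 x
  have hx := mem_extChartAt_target (I := I) x
  refine form_ext_at ?_
  rw [chartRep_add, chartRep_extD I (hη.add hη') hx, chartRep_extD I hη hx, chartRep_extD I hη' hx]
  exact extDerivWithin_add (uniqueDiffWithinAt_range_of_target I hx)
      ((hη.contDiffWithinAt I hx).differentiableWithinAt (by simp))
      ((hη'.contDiffWithinAt I hx).differentiableWithinAt (by simp))

lemma extD_smul {k l : ℕ} (h : k + 1 = l) (c : ℝ) {η : DForm I M k} (hη : SmoothForm I η) :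
    extD I h (c • η) = c • extD I h η := by
  subst h
  ext1 x
  have hx := mem_extChartAt_target (I := I) x
  refine form_ext_at ?_
  rw [chartRep_smul, chartRep_extD I (hη.const_smul c) hx, chartRep_extD I hη hx]
  exact extDerivWithin_smul c (chartRep I η x) (uniqueDiffWithinAt_range_of_target I hx)

lemma extD_zero {k l : ℕ} (h : k + 1 = l) : extD I h (0 : DForm I M k) = 0 := by
  have := extD_smul h 0 (smoothForm_zero (I := I) (M := M) (k := k))
  rwa [zero_smul, zero_smul] at this

lemma extD_sum {k l : ℕ} (h : k + 1 = l) {ι : Type*} (s : Finset ι) {η : ι → DForm I M k}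
    (hη : ∀ i ∈ s, SmoothForm I (η i)) :
    extD I h (∑ i ∈ s, η i) = ∑ i ∈ s, extD I h (η i) := by
  classical
  induction s using Finset.induction_on with
  | empty => simpa using extD_zero h
  | insert a s ha ih =>
    rw [Finset.sum_insert ha, Finset.sum_insert ha, extD_add h (hη a (by simp))
      (SmoothForm.sum s fun i hi => hη i (by simp [hi])), ih fun i hi => hη i (by simp [hi])]

end CurveDerivatives

/-! ### Smoothness of the Hodge star -/

section HodgeSmooth

variable {m : ℕ} {H : Type*} [TopologicalSpace H]
  {I : ModelWithCorners ℝ (EuclideanSpace ℝ (Fin m)) H}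
  {M : Type*} [TopologicalSpace M] [ChartedSpace H M] [IsManifold I ∞ M]
  {J : Set ℝ}

/-- The coefficients of the metric `g` are smooth in the preferred charts. -/
def SmoothMetric (I : ModelWithCorners ℝ (EuclideanSpace ℝ (Fin m)) H)
    (g : ∀ x : M, TangentSpace I x → TangentSpace I x → ℝ) : Prop :=
  ∀ (x₀ : M) (i j : Fin m), ContDiffOn ℝ ∞ (fun y => g ((extChartAt I x₀).symm y)
    (chartD I x₀ y (EuclideanSpace.single i 1)) (chartD I x₀ y (EuclideanSpace.single j 1)))
    (extChartAt I x₀).target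

/-- The coordinate frame as a basis of the tangent space. -/
noncomputable def chartBasis (I : ModelWithCorners ℝ (EuclideanSpace ℝ (Fin m)) H)
    [IsManifold I ∞ M] {x₀ : M}
    {y : EuclideanSpace ℝ (Fin m)} (hy : y ∈ (extChartAt I x₀).target) :
    Module.Basis (Fin m) ℝ (TangentSpace I ((extChartAt I x₀).symm y)) :=
  (stdB m).map (LinearEquiv.ofBijective (chartD I x₀ y).toLinearMap (chartD_bijective I hy))

lemma chartBasis_apply {x₀ : M}
    {y : EuclideanSpace ℝ (Fin m)} (hy : y ∈ (extChartAt I x₀).target) (i : Fin m) :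
    chartBasis I hy i = chartD I x₀ y (EuclideanSpace.single i 1) := by
  rw [chartBasis, Module.Basis.map_apply, stdB_apply]
  rfl

lemma coe_chartBasis {x₀ : M}
    {y : EuclideanSpace ℝ (Fin m)} (hy : y ∈ (extChartAt I x₀).target) :
    ⇑(chartBasis I hy) = fun i => chartD I x₀ y (EuclideanSpace.single i 1) :=
  funext fun i => chartBasis_apply hy i

/-- A null vector of the Gram matrix would give a combination of basis vectors of length zero. -/
lemma IsScalarProduct.det_gram_ne_zero {V : Type*} [AddCommGroup V] [Module ℝ V] {g : V → V → ℝ}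
    (hg : IsScalarProduct g) {n : ℕ} (e : Module.Basis (Fin n) ℝ V) :
    (Matrix.of fun i j => g (e i) (e j)).det ≠ 0 := by
  intro h
  obtain ⟨c, hc0, hc⟩ := Matrix.exists_mulVec_eq_zero_iff.2 h
  have hv : g (∑ i, c i • e i) (∑ j, c j • e j) = 0 := by
    rw [hg.sum_smul_left]
    refine Finset.sum_eq_zero fun i _ => ?_
    have := congrFun hc i
    simp only [Matrix.mulVec, dotProduct, Matrix.of_apply, Pi.zero_apply] at this
    rw [hg.sum_smul_right]
    simp only [mul_comm (c _), this, zero_mul]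
  have h0 : ∑ i, c i • e i = 0 := by
    by_contra hne
    exact (hg.pos _ hne).ne' hv
  apply hc0
  ext i
  exact Fintype.linearIndependent_iff.1 e.linearIndependent c h0 i

variable {g : ∀ x : M, TangentSpace I x → TangentSpace I x → ℝ} {vol : DForm I M m}

lemma chartRep_hodge (H : ∀ x, IsVolumeForm (g x) (vol x)) {k l : ℕ} (h : k + l = m)
    (η : DForm I M k) {x₀ : M} {y : EuclideanSpace ℝ (Fin m)} (hy : y ∈ (extChartAt I x₀).target) :
    chartRep I (fun x => hodge h (g x) (vol x) (η x)) x₀ y =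
      hodgeGram h (Matrix.of fun i j => g ((extChartAt I x₀).symm y)
        (chartD I x₀ y (EuclideanSpace.single i 1)) (chartD I x₀ y (EuclideanSpace.single j 1)))⁻¹
        (fun i => EuclideanSpace.single i 1) (chartRep I vol x₀ y) (chartRep I η x₀ y) := by
  rw [chartRep, chartPull_eq, (H _).hodge_eq_hodgeGram h (chartBasis I hy)]
  simp only [coe_chartBasis]
  exact hodgeGram_comp h _ (chartD I x₀ y) _ _ _

lemma SmoothCurve.hodge (H : ∀ x, IsVolumeForm (g x) (vol x)) (hg : SmoothMetric I g)
    (hvol : SmoothForm I vol) {k l : ℕ} (h : k + l = m) {η : ℝ → DForm I M k}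
    (hη : SmoothCurve I J η) : SmoothCurve I J (fun t x => hodge h (g x) (vol x) (η t x)) :=
  fun x₀ => by
  have hP : ∀ i j, ContDiffOn ℝ ∞ (fun z : ℝ × EuclideanSpace ℝ (Fin m) =>
      (Matrix.of fun i j => g ((extChartAt I x₀).symm z.2)
        (chartD I x₀ z.2 (EuclideanSpace.single i 1))
        (chartD I x₀ z.2 (EuclideanSpace.single j 1)))⁻¹ i j) (J ×ˢ (extChartAt I x₀).target) := by
    refine ContDiffOn.matrix_inv (fun i j => ?_) fun z hz => ?_
    · exact (hg x₀ i j).comp contDiffOn_snd fun _ hz => hz.2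
    · have := (H ((extChartAt I x₀).symm z.2)).scalar.det_gram_ne_zero (chartBasis I hz.2)
      simpa only [coe_chartBasis] using this
  exact (ContDiffOn.hodgeGram h hP (fun i => EuclideanSpace.single i 1) (hvol.curve J x₀)
    (hη x₀)).congr fun z hz => chartRep_hodge H h (η z.1) hz.2

lemma SmoothForm.hodge (H : ∀ x, IsVolumeForm (g x) (vol x)) (hg : SmoothMetric I g)
    (hvol : SmoothForm I vol) {k l : ℕ} (h : k + l = m) {η : DForm I M k}
    (hη : SmoothForm I η) : SmoothForm I (fun x => _root_.hodge h (g x) (vol x) (η x)) :=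
  .of_curve ((hη.curve _).hodge H hg hvol h)

end HodgeSmooth

/-! ### Forms of top degree under linear maps -/

section TopForms

variable {m : ℕ}

lemma ContinuousAlternatingMap.top_comp_apply
    (α : EuclideanSpace ℝ (Fin m) [⋀^Fin m]→L[ℝ] ℝ)
    (L : EuclideanSpace ℝ (Fin m) →L[ℝ] EuclideanSpace ℝ (Fin m)) :
    α (fun i => L (EuclideanSpace.single i 1)) = L.det * α (fun i => EuclideanSpace.single i 1) := by
  have h := α.toAlternatingMap.eq_smul_basis_det (stdB m)
  have h2 : ∀ v, α v = (stdB m).det v * α (fun i => EuclideanSpace.single i 1) := fun v => by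
    have := congrArg (fun β => β v) h
    simpa [coe_stdB, mul_comm] using this
  rw [h2]
  congr 1
  have := (stdB m).det_comp (L : EuclideanSpace ℝ (Fin m) →ₗ[ℝ] EuclideanSpace ℝ (Fin m)) (stdB m)
  rw [Module.Basis.det_self, mul_one, coe_stdB] at this
  exact this

lemma Real.sign_eq_mul_inv_abs (r : ℝ) : Real.sign r = r * |r|⁻¹ := by
  rcases lt_trichotomy r 0 with h | h | h
  · rw [Real.sign_of_neg h, abs_of_neg h, ← neg_inv, mul_neg, mul_inv_cancel₀ h.ne]
  · simp [h]
  · rw [Real.sign_of_pos h, abs_of_pos h, mul_inv_cancel₀ h.ne']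

/-- With `d` a Jacobian determinant, this turns the transformation law of top forms into that of
densities: the sign of `d` is compensated by the orientation form. -/
lemma Real.sign_mul_mul (d a b : ℝ) : Real.sign (d * a) * (d * b) = |d| * (Real.sign a * b) := by
  simp only [Real.sign_eq_mul_inv_abs, abs_mul, mul_inv]
  rcases eq_or_ne d 0 with rfl | h
  · simp
  · have h1 : |d| ≠ 0 := abs_ne_zero.2 h
    have h2 : d * d = |d| * |d| := (abs_mul_abs_self d).symm
    calc _ = (d * d) * |d|⁻¹ * (a * |a|⁻¹ * b) := by ring
      _ = _ := by rw [h2, mul_inv_cancel_right₀ h1]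

end TopForms

/-! ### Integration of top forms -/

section Integration

variable {m : ℕ} {H : Type*} [TopologicalSpace H]
  {I : ModelWithCorners ℝ (EuclideanSpace ℝ (Fin m)) H}
  {M : Type*} [TopologicalSpace M] [ChartedSpace H M]

/-- A smooth nowhere vanishing form of top degree. -/
structure OrientationForm (I : ModelWithCorners ℝ (EuclideanSpace ℝ (Fin m)) H)
    (vol : DForm I M m) : Prop where
  smooth : SmoothForm I vol
  ne_zero : ∀ x₀ : M, ∀ y ∈ (extChartAt I x₀).target,
    chartRep I vol x₀ y (fun i => EuclideanSpace.single i 1) ≠ 0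

/-- The density of a form of top degree in the preferred chart at `x₀`, for the orientation given
by `vol`. -/
noncomputable def chartDensity (I : ModelWithCorners ℝ (EuclideanSpace ℝ (Fin m)) H)
    (vol η : DForm I M m) (x₀ : M) (y : EuclideanSpace ℝ (Fin m)) : ℝ :=
  Real.sign (chartRep I vol x₀ y (fun i => EuclideanSpace.single i 1)) *
        chartRep I η x₀ y (fun i => EuclideanSpace.single i 1)

lemma chartDensity_add (vol η η' : DForm I M m) (x₀ : M) (y : EuclideanSpace ℝ (Fin m)) :
    chartDensity I vol (η + η') x₀ y = chartDensity I vol η x₀ y + chartDensity I vol η' x₀ y :=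
  mul_add _ _ _

lemma chartDensity_smul (vol η : DForm I M m) (c : ℝ) (x₀ : M) (y : EuclideanSpace ℝ (Fin m)) :
    chartDensity I vol (c • η) x₀ y = c * chartDensity I vol η x₀ y :=
  mul_left_comm _ _ _

/-- The sign is discontinuous only at zero, which `vol` avoids; written as `r |r|⁻¹` it is visibly
continuous. -/
lemma OrientationForm.continuousOn_chartDensity {vol η : DForm I M m} (hvol : OrientationForm I vol)
    (hη : SmoothForm I η) (x₀ : M) :
    ContinuousOn (chartDensity I vol η x₀) (extChartAt I x₀).target := by
  have h1 : ∀ {η : DForm I M m}, SmoothForm I η → ContinuousOn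
      (fun y => chartRep I η x₀ y (fun i => EuclideanSpace.single i 1))
      (extChartAt I x₀).target := fun h => (evalCLM _).continuous.comp_continuousOn (h x₀).continuousOn
  have h2 : chartDensity I vol η x₀ = fun y =>
      chartRep I vol x₀ y (fun i => EuclideanSpace.single i 1) *
        |chartRep I vol x₀ y (fun i => EuclideanSpace.single i 1)|⁻¹ *
        chartRep I η x₀ y (fun i => EuclideanSpace.single i 1) := by
    funext y
    rw [chartDensity, Real.sign_eq_mul_inv_abs]
  rw [h2]
  refine ((h1 hvol.smooth).mul ((h1 hvol.smooth).abs.inv₀ fun y hy => ?_)).mul (h1 hη)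
  exact abs_ne_zero.2 (hvol.ne_zero x₀ y hy)

/-- The set is the trace of an open set on the closed set `Set.range I`. -/
lemma measurableSet_target_inter_preimage (x₀ : M) {O : Set M} (hO : IsOpen O) :
    MeasurableSet ((extChartAt I x₀).target ∩ (extChartAt I x₀).symm ⁻¹' O) := by
  have h1 : (extChartAt I x₀).target ∩ (extChartAt I x₀).symm ⁻¹' O =
      (I.symm ⁻¹' ((chartAt H x₀).target ∩ (chartAt H x₀).symm ⁻¹' O)) ∩ Set.range I := by
    rw [extChartAt_target]
    ext y
    simp only [Set.mem_inter_iff, Set.mem_preimage, extChartAt_coe_symm, Function.comp_apply]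
    tauto
  rw [h1]
  have h2 := (chartAt H x₀).symm.isOpen_inter_preimage hO
  exact (h2.preimage I.continuous_symm).measurableSet.inter I.isClosed_range.measurableSet

lemma measurableSet_target (x₀ : M) : MeasurableSet (extChartAt I x₀).target := by
  simpa using measurableSet_target_inter_preimage (I := I) x₀ isOpen_univ

lemma isCompact_image_extChartAt {x₀ : M} {K : Set M} (hK : IsCompact K)
    (hKs : K ⊆ (extChartAt I x₀).source) : IsCompact (extChartAt I x₀ '' K) :=
  hK.image_of_continuousOn ((continuousOn_extChartAt x₀).mono hKs)

lemma integrableOn_target_of_support {x₀ : M} {f : EuclideanSpace ℝ (Fin m) → ℝ}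
    (hf : ContinuousOn f (extChartAt I x₀).target) {K : Set M} (hK : IsCompact K)
    (hKs : K ⊆ (extChartAt I x₀).source)
    (hfK : ∀ y ∈ (extChartAt I x₀).target, (extChartAt I x₀).symm y ∉ K → f y = 0) :
    IntegrableOn f (extChartAt I x₀).target := by
  have hc := isCompact_image_extChartAt hK hKs
  have hsub : extChartAt I x₀ '' K ⊆ (extChartAt I x₀).target := by
    rintro _ ⟨x, hx, rfl⟩
    exact (extChartAt I x₀).map_source (hKs hx)
  refine IntegrableOn.of_forall_sdiff_eq_zero ((hf.mono hsub).integrableOn_compact hc)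
    (measurableSet_target x₀) fun y hy => hfK y hy.1 fun hyK => hy.2 ?_
  exact ⟨_, hyK, (extChartAt I x₀).right_inv hy.1⟩

variable [IsManifold I ∞ M] [T2Space M] [SigmaCompactSpace M]

lemma tsupport_chartPartition_subset (x₀ : M) :
    tsupport (chartPartition I M x₀) ⊆ (extChartAt I x₀).source := by
  rw [extChartAt_source]
  exact Classical.choose_spec (SmoothPartitionOfUnity.exists_isSubordinate_chartAt_source I M) x₀

lemma chartPartition_eq_zero {x₀ x : M} (hx : x ∉ (extChartAt I x₀).source) :
    chartPartition I M x₀ x = 0 := by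
  by_contra h
  exact hx (tsupport_chartPartition_subset x₀ (subset_tsupport _ h))

lemma exists_chartPartition_pos (x : M) : ∃ x₀ : M, 0 < chartPartition I M x₀ x :=
  (chartPartition I M).exists_pos_of_mem (Set.mem_univ x)

variable [CompactSpace M]

lemma finite_chartPartition : {x₀ : M | (Function.support (chartPartition I M x₀)).Nonempty}.Finite :=
  (chartPartition I M).locallyFinite.finite_nonempty_of_compact

variable (I M) in
/-- The charts that are used by the partition of unity. -/
noncomputable def chartIndex : Finset M := (finite_chartPartition (I := I) (M := M)).toFinset

lemma chartPartition_eq_zero_of_notMem {x₀ : M} (h : x₀ ∉ chartIndex I M) (x : M) :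
    chartPartition I M x₀ x = 0 := by
  by_contra hx
  exact h ((Set.Finite.mem_toFinset _).2 ⟨x, hx⟩)

lemma sum_chartPartition (x : M) : ∑ x₀ ∈ chartIndex I M, chartPartition I M x₀ x = 1 := by
  rw [← (chartPartition I M).sum_eq_one (Set.mem_univ x)]
  refine (finsum_eq_sum_of_support_subset _ fun x₀ hx₀ => ?_).symm
  by_contra h
  exact hx₀ (chartPartition_eq_zero_of_notMem h x)

lemma integralForm_eq_sum (vol η : DForm I M m) :
    integralForm I vol η = ∑ x₀ ∈ chartIndex I M, ∫ y in (extChartAt I x₀).target,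
      chartPartition I M x₀ ((extChartAt I x₀).symm y) * chartDensity I vol η x₀ y := by
  refine finsum_eq_sum_of_support_subset _ fun x₀ hx₀ => ?_
  by_contra h
  exact hx₀ (by simp [chartPartition_eq_zero_of_notMem h])

lemma continuousOn_chartPartition (x₀ : M) : ContinuousOn
    (fun y => chartPartition I M x₀ ((extChartAt I x₀).symm y)) (extChartAt I x₀).target :=
  (chartPartition I M x₀).2.continuous.comp_continuousOn (continuousOn_extChartAt_symm x₀)

lemma integrableOn_chartPartition_mul (x₀ : M) {f : EuclideanSpace ℝ (Fin m) → ℝ}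
    (hf : ContinuousOn f (extChartAt I x₀).target) :
    IntegrableOn (fun y => chartPartition I M x₀ ((extChartAt I x₀).symm y) * f y)
      (extChartAt I x₀).target := by
  refine integrableOn_target_of_support ((continuousOn_chartPartition x₀).mul hf)
    (isClosed_tsupport (chartPartition I M x₀)).isCompact (tsupport_chartPartition_subset x₀)
    fun y _ hy => ?_
  rw [image_eq_zero_of_notMem_tsupport hy, zero_mul]

lemma integralForm_add {vol η η' : DForm I M m} (hvol : OrientationForm I vol)
    (hη : SmoothForm I η) (hη' : SmoothForm I η') :
    integralForm I vol (η + η') = integralForm I vol η + integralForm I vol η' := by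
  simp only [integralForm_eq_sum, ← Finset.sum_add_distrib]
  refine Finset.sum_congr rfl fun x₀ _ => ?_
  rw [← integral_add (integrableOn_chartPartition_mul x₀ (hvol.continuousOn_chartDensity hη x₀))
    (integrableOn_chartPartition_mul x₀ (hvol.continuousOn_chartDensity hη' x₀))]
  simp only [chartDensity_add, mul_add]

lemma integralForm_smul (vol η : DForm I M m) (c : ℝ) :
    integralForm I vol (c • η) = c * integralForm I vol η := by
  simp only [integralForm_eq_sum, Finset.mul_sum]
  refine Finset.sum_congr rfl fun x₀ _ => ?_
  rw [← integral_const_mul]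
  simp only [chartDensity_smul, mul_left_comm]

lemma integralForm_zero (vol : DForm I M m) : integralForm I vol 0 = 0 := by
  simpa using integralForm_smul vol 0 0

lemma integralForm_sum {vol : DForm I M m} (hvol : OrientationForm I vol) {ι : Type*}
    (s : Finset ι) {η : ι → DForm I M m} (hη : ∀ i ∈ s, SmoothForm I (η i)) :
    integralForm I vol (∑ i ∈ s, η i) = ∑ i ∈ s, integralForm I vol (η i) := by
  classical
  induction s using Finset.induction_on with
  | empty => simp [integralForm_zero]
  | insert a s ha ih =>
    rw [Finset.sum_insert ha, Finset.sum_insert ha, integralForm_add hvol (hη a (by simp))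
      (SmoothForm.sum s fun i hi => hη i (by simp [hi])), ih fun i hi => hη i (by simp [hi])]

/-- Computation of an integral with a parametrization `Θ : S → M`, with inverse `Φ`, of a part
of `M` that contains the support of the form. -/
lemma integralForm_eq_of_param {vol η : DForm I M m} {S : Set (EuclideanSpace ℝ (Fin m))}
    (hS : MeasurableSet S) {Θ : EuclideanSpace ℝ (Fin m) → M} {Φ : M → EuclideanSpace ℝ (Fin m)}
    (hΦ : ∀ s ∈ S, Φ (Θ s) = s) (hη : ∀ x, x ∉ Θ '' S → η x = 0)
    (w : EuclideanSpace ℝ (Fin m) → ℝ)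
    (F' : M → EuclideanSpace ℝ (Fin m) → EuclideanSpace ℝ (Fin m) →L[ℝ] EuclideanSpace ℝ (Fin m))
    (hU : ∀ x₀ : M, MeasurableSet ((extChartAt I x₀).target ∩ (extChartAt I x₀).symm ⁻¹' (Θ '' S)))
    (hd : ∀ (x₀ : M), ∀ y ∈ (extChartAt I x₀).target ∩ (extChartAt I x₀).symm ⁻¹' (Θ '' S),
      HasFDerivWithinAt (fun y => Φ ((extChartAt I x₀).symm y)) (F' x₀ y)
        ((extChartAt I x₀).target ∩ (extChartAt I x₀).symm ⁻¹' (Θ '' S)) y)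
    (hw : ∀ (x₀ : M), ∀ y ∈ (extChartAt I x₀).target ∩ (extChartAt I x₀).symm ⁻¹' (Θ '' S),
      chartDensity I vol η x₀ y = |(F' x₀ y).det| * w (Φ ((extChartAt I x₀).symm y)))
    (hint : ∀ x₀ : M, IntegrableOn (fun s => chartPartition I M x₀ (Θ s) * w s) S) :
    integralForm I vol η = ∫ s in S, w s := by
  -- Chart by chart, the change of variables along `Φ` carries the integral to the parameter domain
  -- `S`. There the functions of the partition add up to one.
  have key : ∀ x₀ : M, ∫ y in (extChartAt I x₀).target,
      chartPartition I M x₀ ((extChartAt I x₀).symm y) * chartDensity I vol η x₀ y =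
      ∫ s in S, chartPartition I M x₀ (Θ s) * w s := by
    intro x₀
    set U := (extChartAt I x₀).target ∩ (extChartAt I x₀).symm ⁻¹' (Θ '' S) with hUdef
    set F := fun y => Φ ((extChartAt I x₀).symm y) with hF
    have hΘF : ∀ y ∈ U, Θ (F y) = (extChartAt I x₀).symm y ∧ F y ∈ S := by
      rintro y ⟨_, s, hs, hsy⟩
      simp only [hF, ← hsy, hΦ s hs, hs, and_self]
    have h1 : ∫ y in (extChartAt I x₀).target,
        chartPartition I M x₀ ((extChartAt I x₀).symm y) * chartDensity I vol η x₀ y =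
        ∫ y in U, chartPartition I M x₀ ((extChartAt I x₀).symm y) * chartDensity I vol η x₀ y := by
      refine setIntegral_eq_of_subset_of_forall_sdiff_eq_zero (measurableSet_target x₀)
        Set.inter_subset_left fun y hy => ?_
      have : chartRep I η x₀ y = 0 := by
        rw [chartRep, hη _ fun h => hy.2 ⟨hy.1, h⟩]; rfl
      simp [chartDensity, this]
    have h2 : ∫ y in U, chartPartition I M x₀ ((extChartAt I x₀).symm y) * chartDensity I vol η x₀ y =
        ∫ y in U, |(F' x₀ y).det| • (chartPartition I M x₀ (Θ (F y)) * w (F y)) := by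
      refine setIntegral_congr_fun (hU x₀) fun y hy => ?_
      have h3 := (hΘF y hy).1
      simp only [h3, hw x₀ y hy, smul_eq_mul]
      exact mul_left_comm _ _ _
    have hinj : Set.InjOn F U := by
      intro y hy y' hy' h
      refine (extChartAt I x₀).symm.injOn hy.1 hy'.1 ?_
      rw [← (hΘF y hy).1, ← (hΘF y' hy').1, h]
    rw [h1, h2, ← integral_image_eq_integral_abs_det_fderiv_smul volume (hU x₀) (hd x₀) hinj
      (fun s => chartPartition I M x₀ (Θ s) * w s)]
    symm
    -- Parameters whose image leaves the chart at `x₀` contribute nothing, since the partition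
    -- function of that chart vanishes there.
    refine setIntegral_eq_of_subset_of_forall_sdiff_eq_zero hS ?_ fun s hs => ?_
    · rintro _ ⟨y, hy, rfl⟩
      exact (hΘF y hy).2
    · rw [chartPartition_eq_zero, zero_mul]
      intro hsrc
      refine hs.2 ⟨extChartAt I x₀ (Θ s), ⟨(extChartAt I x₀).map_source hsrc, ?_⟩, ?_⟩
      · rw [Set.mem_preimage, (extChartAt I x₀).left_inv hsrc]
        exact ⟨s, hs.1, rfl⟩
      · simp only [(extChartAt I x₀).left_inv hsrc, hΦ s hs.1]
  rw [integralForm_eq_sum]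
  simp only [key]
  rw [← integral_finsetSum _ fun x₀ _ => hint x₀]
  simp only [← Finset.sum_mul, sum_chartPartition, one_mul]

/-- A form supported in one chart can be integrated in this chart. -/
lemma integralForm_eq_chart {vol η : DForm I M m} (hvol : OrientationForm I vol)
    (hη : SmoothForm I η) {x₁ : M} {K : Set M} (hK : IsCompact K)
    (hKs : K ⊆ (extChartAt I x₁).source) (hηK : ∀ x, x ∉ K → η x = 0) :
    integralForm I vol η = ∫ y in (extChartAt I x₁).target, chartDensity I vol η x₁ y := by
  have himg : (extChartAt I x₁).symm '' (extChartAt I x₁).target = (extChartAt I x₁).source :=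
    (extChartAt I x₁).symm_image_target_eq_source
  refine integralForm_eq_of_param (Θ := (extChartAt I x₁).symm) (Φ := extChartAt I x₁)
    (measurableSet_target x₁) (fun s hs => (extChartAt I x₁).right_inv hs)
    (fun x hx => hηK x fun h => hx (himg ▸ hKs h)) _
    (fun x₀ y => fderivWithin ℝ (chartTrans I x₀ x₁) (Set.range I) y) ?_ ?_ ?_ ?_
  · intro x₀
    rw [himg]
    exact measurableSet_target_inter_preimage x₀ (isOpen_extChartAt_source x₁)
  · rw [himg]
    rintro x₀ y ⟨hy, hy'⟩
    exact ((contDiffWithinAt_chartTrans I hy hy').differentiableWithinAt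
      (by simp)).hasFDerivWithinAt.mono (Set.inter_subset_left.trans
        (extChartAt_target_subset_range x₀))
  · rw [himg]
    rintro x₀ y ⟨hy, hy'⟩
    have h1 : ∀ η : DForm I M m, chartRep I η x₀ y (fun i => EuclideanSpace.single i 1) =
        (fderivWithin ℝ (chartTrans I x₀ x₁) (Set.range I) y).det *
          chartRep I η x₁ (chartTrans I x₀ x₁ y) (fun i => EuclideanSpace.single i 1) := by
      intro η
      rw [chartRep_trans I η hy hy', ← ContinuousAlternatingMap.top_comp_apply]
      rfl
    rw [chartDensity, h1, h1, Real.sign_mul_mul]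
    rfl
  · intro x₀
    refine integrableOn_target_of_support (ContinuousOn.mul ?_
      (hvol.continuousOn_chartDensity hη x₁)) hK hKs fun y hy hyK => ?_
    · exact (chartPartition I M x₀).2.continuous.comp_continuousOn (continuousOn_extChartAt_symm x₁)
    · have : chartRep I η x₁ y = 0 := by
        rw [chartRep, hηK _ hyK]; rfl
      simp [chartDensity, this]

/-- A nonnegative form of top degree with integral zero vanishes. -/
lemma eq_zero_of_integralForm_eq_zero {vol η : DForm I M m} (hvol : OrientationForm I vol)
    (hη : SmoothForm I η) {f : M → ℝ} (hf : ∀ x, 0 ≤ f x) (hηf : ∀ x, η x = f x • vol x)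
    (h0 : integralForm I vol η = 0) (x : M) : f x = 0 := by
  have hden : ∀ x₀ y, chartDensity I vol η x₀ y = f ((extChartAt I x₀).symm y) *
      |chartRep I vol x₀ y (fun i => EuclideanSpace.single i 1)| := by
    intro x₀ y
    have : chartRep I η x₀ y = f ((extChartAt I x₀).symm y) • chartRep I vol x₀ y := by
      rw [← chartRep_fun_smul, ← funext hηf]
    rw [chartDensity, this, ContinuousAlternatingMap.smul_apply, smul_eq_mul,
      Real.sign_eq_mul_inv_abs]
    generalize chartRep I vol x₀ y (fun i => EuclideanSpace.single i 1) = r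
    rcases eq_or_ne r 0 with rfl | hr
    · simp
    calc r * |r|⁻¹ * (f ((extChartAt I x₀).symm y) * r)
        = f ((extChartAt I x₀).symm y) * (r * r * |r|⁻¹) := by ring
      _ = _ := by rw [← abs_mul_abs_self r, mul_inv_cancel_right₀ (abs_ne_zero.2 hr)]
  obtain ⟨x₀, hx₀⟩ := exists_chartPartition_pos (I := I) x
  have hnn : ∀ (x₀ : M) (y : EuclideanSpace ℝ (Fin m)),
      0 ≤ chartPartition I M x₀ ((extChartAt I x₀).symm y) * chartDensity I vol η x₀ y :=
    fun x₀ y => mul_nonneg ((chartPartition I M).nonneg x₀ _)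
      (by rw [hden]; exact mul_nonneg (hf _) (abs_nonneg _))
  rw [integralForm_eq_sum, Finset.sum_eq_zero_iff_of_nonneg fun x₀ _ =>
    integral_nonneg (hnn x₀)] at h0
  have hmem : x₀ ∈ chartIndex I M := by
    by_contra h
    exact hx₀.ne' (chartPartition_eq_zero_of_notMem h x)
  have hsrc : x ∈ (extChartAt I x₀).source := by
    by_contra h
    exact hx₀.ne' (chartPartition_eq_zero h)
  have hcont := hvol.continuousOn_chartDensity hη x₀
  have h1 := (integral_eq_zero_iff_of_nonneg (hnn x₀)
    (integrableOn_chartPartition_mul x₀ hcont)).1 (h0 x₀ hmem)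
  -- A continuous function vanishing almost everywhere on the target vanishes everywhere on it,
  -- boundary points included, because the target lies in the closure of its interior.
  have h2 := Measure.eqOn_of_ae_eq h1 ((continuousOn_chartPartition x₀).mul hcont)
    continuousOn_const extChartAt_target_subset_closure_interior
  have hy := (extChartAt I x₀).map_source hsrc
  have h3 := h2 hy
  simp only [hden, Pi.zero_apply, (extChartAt I x₀).left_inv hsrc, mul_eq_zero, hx₀.ne',
    abs_eq_zero, hvol.ne_zero x₀ _ hy, or_false, false_or] at h3
  exact h3

/-- Differentiation under the integral sign. -/
lemma hasDerivAt_integralForm {vol : DForm I M m} (hvol : OrientationForm I vol) {J : Set ℝ}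
    (hJ : IsOpen J) {η : ℝ → DForm I M m} (hη : SmoothCurve I J η) {t : ℝ} (ht : t ∈ J) :
    HasDerivAt (fun s => integralForm I vol (η s)) (integralForm I vol (timeDeriv I η t)) t := by
  simp only [integralForm_eq_sum]
  refine HasDerivAt.fun_sum fun x₀ _ => ?_
  obtain ⟨δ, hδ, hball⟩ := Metric.nhds_basis_closedBall.mem_iff.1 (hJ.mem_nhds ht)
  set K := extChartAt I x₀ '' (tsupport (chartPartition I M x₀)) with hKdef
  have hK : IsCompact K := isCompact_image_extChartAt
    (isClosed_tsupport (chartPartition I M x₀)).isCompact (tsupport_chartPartition_subset x₀)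
  have hKT : K ⊆ (extChartAt I x₀).target := by
    rintro _ ⟨x, hx, rfl⟩
    exact (extChartAt I x₀).map_source (tsupport_chartPartition_subset x₀ hx)
  set G : ℝ × EuclideanSpace ℝ (Fin m) → ℝ := fun z =>
    chartPartition I M x₀ ((extChartAt I x₀).symm z.2) *
      chartDensity I vol (timeDeriv I η z.1) x₀ z.2 with hG
  have hGc : ContinuousOn G (J ×ˢ (extChartAt I x₀).target) := by
    have h1 : ContinuousOn (fun z : ℝ × EuclideanSpace ℝ (Fin m) =>
        chartRep I (timeDeriv I η z.1) x₀ z.2 (fun i => EuclideanSpace.single i 1))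
        (J ×ˢ (extChartAt I x₀).target) :=
      (evalCLM _).continuous.comp_continuousOn (hη.timeDeriv hJ x₀).continuousOn
    have h2 : ContinuousOn (fun z : ℝ × EuclideanSpace ℝ (Fin m) =>
        chartPartition I M x₀ ((extChartAt I x₀).symm z.2))
        (J ×ˢ (extChartAt I x₀).target) :=
      (continuousOn_chartPartition x₀).comp continuousOn_snd fun z hz => hz.2
    have h3 : ContinuousOn (fun z : ℝ × EuclideanSpace ℝ (Fin m) =>
        chartRep I vol x₀ z.2 (fun i => EuclideanSpace.single i 1))
        (J ×ˢ (extChartAt I x₀).target) :=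
      ((evalCLM _).continuous.comp_continuousOn (hvol.smooth x₀).continuousOn).comp
        continuousOn_snd fun z hz => hz.2
    simp only [hG, chartDensity, Real.sign_eq_mul_inv_abs]
    exact h2.mul ((h3.mul (h3.abs.inv₀ fun z hz =>
      abs_ne_zero.2 (hvol.ne_zero x₀ _ hz.2))).mul h1)
  -- The time derivative of the integrand is continuous, hence bounded on the compact set of times
  -- near `t` and points of `K`, and it vanishes off `K`; so `C` times the indicator of `K`
  -- dominates.
  obtain ⟨C, hC⟩ := ((isCompact_closedBall t δ).prod hK).exists_bound_of_continuousOn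
    (hGc.mono (Set.prod_mono hball hKT))
  have hzero : ∀ (ζ : DForm I M m), ∀ y ∈ (extChartAt I x₀).target, y ∉ K →
      chartPartition I M x₀ ((extChartAt I x₀).symm y) * chartDensity I vol ζ x₀ y = 0 := by
    intro ζ y hy hyK
    have : chartPartition I M x₀ ((extChartAt I x₀).symm y) = 0 :=
      image_eq_zero_of_notMem_tsupport fun h => hyK ⟨_, h, (extChartAt I x₀).right_inv hy⟩
    rw [this, zero_mul]
  have hint : ∀ s ∈ J, IntegrableOn (fun y => chartPartition I M x₀ ((extChartAt I x₀).symm y) *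
      chartDensity I vol (η s) x₀ y) (extChartAt I x₀).target := fun s hs =>
    integrableOn_chartPartition_mul x₀ (hvol.continuousOn_chartDensity (hη.form hs) x₀)
  refine (hasDerivAt_integral_of_dominated_loc_of_deriv_le (bound := K.indicator fun _ => C)
    (μ := volume.restrict (extChartAt I x₀).target)
    (F := fun s y => chartPartition I M x₀ ((extChartAt I x₀).symm y) *
      chartDensity I vol (η s) x₀ y)
    (F' := fun s y => G (s, y)) (Metric.closedBall_mem_nhds t hδ) ?_ (hint t ht) ?_ ?_ ?_ ?_).2
  · filter_upwards [hJ.mem_nhds ht] with s hs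
    exact (hint s hs).aestronglyMeasurable
  · exact (integrableOn_chartPartition_mul x₀ (hvol.continuousOn_chartDensity
      ((hη.timeDeriv hJ).form ht) x₀)).aestronglyMeasurable
  · refine ae_restrict_of_forall_mem (measurableSet_target x₀) fun y hy s hs => ?_
    by_cases hyK : y ∈ K
    · rw [Set.indicator_of_mem hyK]
      exact hC (s, y) ⟨hs, hyK⟩
    · rw [Set.indicator_of_notMem hyK]
      simp only [hG, hzero _ y hy hyK, norm_zero, le_refl]
  · exact ((integrable_indicator_iff hK.measurableSet).2
      (integrableOn_const hK.measure_lt_top.ne)).integrableOn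
  · refine ae_restrict_of_forall_mem (measurableSet_target x₀) fun y hy s hs => ?_
    have h1 := hη.hasDerivAt_chartRep hJ (hball hs) x₀ y
    have h2 := (evalCLM fun i => EuclideanSpace.single i (1 : ℝ)).hasFDerivAt.comp_hasDerivAt s h1
    exact (h2.const_mul _).const_mul _

end Integration

/-! ### Charts at boundary points -/

section ChartDifferential

variable {m : ℕ} {H : Type*} [TopologicalSpace H]
  (I : ModelWithCorners ℝ (EuclideanSpace ℝ (Fin m)) H)
  {M : Type*} [TopologicalSpace M] [ChartedSpace H M] [IsManifold I ∞ M]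

lemma chartDinv_bijective {x₀ x : M} (hx : x ∈ (extChartAt I x₀).source) :
    Function.Bijective (chartDinv I x₀ x) := by
  obtain ⟨y, hy, rfl⟩ : ∃ y ∈ (extChartAt I x₀).target, (extChartAt I x₀).symm y = x :=
    ⟨_, (extChartAt I x₀).map_source hx, (extChartAt I x₀).left_inv hx⟩
  exact ⟨Function.LeftInverse.injective (g := chartD I x₀ y) (chartD_chartDinv I hy),
    Function.RightInverse.surjective (g := chartD I x₀ y) (chartDinv_chartD I hy)⟩

end ChartDifferential

section BoundaryCoordinates

variable {n : ℕ} [NeZero n]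
  {Z : Type*} [TopologicalSpace Z] [ChartedSpace (EuclideanHalfSpace n) Z]

lemma extChartAt_halfSpace_nonneg (x₀ x : Z) : 0 ≤ extChartAt (𝓡∂ n) x₀ x 0 := by
  have : extChartAt (𝓡∂ n) x₀ x ∈ Set.range (𝓡∂ n) := ⟨chartAt _ x₀ x, rfl⟩
  rwa [range_modelWithCornersEuclideanHalfSpace] at this

variable [IsManifold (𝓡∂ n) ∞ Z]

/-- Being an interior point can be tested in any chart of the atlas, and the interior of the half
space is where the coordinate of index `0` is positive. -/
lemma mem_boundary_iff_extChartAt {x₀ x : Z} (hx : x ∈ (extChartAt (𝓡∂ n) x₀).source) :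
    x ∈ (𝓡∂ n).boundary Z ↔ extChartAt (𝓡∂ n) x₀ x 0 = 0 := by
  rw [extChartAt_source] at hx
  have h2 : (𝓡∂ n).IsInteriorPoint x ↔ 0 < extChartAt (𝓡∂ n) x₀ x 0 := by
    have h1 : extChartAt (𝓡∂ n) x₀ x ∈ interior (Set.range (𝓡∂ n)) ↔
        0 < extChartAt (𝓡∂ n) x₀ x 0 := by
      rw [interior_range_modelWithCornersEuclideanHalfSpace]
      rfl
    rw [← h1, ModelWithCorners.isInteriorPoint_iff_of_mem_atlas (n := ∞) (by simp)
      (chart_mem_atlas _ x₀) hx]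
    exact ⟨fun h => OpenPartialHomeomorph.interior_extend_target_subset_interior_range _ h,
      fun h => (chartAt _ x₀).mem_interior_extend_target ((chartAt _ x₀).map_source hx) h⟩
  change (𝓡∂ n).IsBoundaryPoint x ↔ _
  rw [ModelWithCorners.isBoundaryPoint_iff_not_isInteriorPoint, h2, not_lt]
  exact ⟨fun h => le_antisymm h (extChartAt_halfSpace_nonneg x₀ x), fun h => h.le⟩

/-- At a boundary point, the differentials of two charts agree on the sign of the normal
coordinate. -/
lemma exists_pos_chartDinv {x₀ x₁ x : Z} (hx : x ∈ (𝓡∂ n).boundary Z)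
    (hx₀ : x ∈ (extChartAt (𝓡∂ n) x₀).source) (hx₁ : x ∈ (extChartAt (𝓡∂ n) x₁).source) :
    ∃ c : ℝ, 0 < c ∧ ∀ w : TangentSpace (𝓡∂ n) x,
      chartDinv (𝓡∂ n) x₁ x w 0 = c * chartDinv (𝓡∂ n) x₀ x w 0 := by
  have hz0 := (mem_boundary_iff_extChartAt hx₀).1 hx
  have hz1 := (mem_boundary_iff_extChartAt hx₁).1 hx
  obtain ⟨y, hy, rfl⟩ : ∃ y ∈ (extChartAt (𝓡∂ n) x₀).target, (extChartAt (𝓡∂ n) x₀).symm y = x :=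
    ⟨_, (extChartAt (𝓡∂ n) x₀).map_source hx₀, (extChartAt (𝓡∂ n) x₀).left_inv hx₀⟩
  rw [(extChartAt (𝓡∂ n) x₀).right_inv hy] at hz0
  set A := fderivWithin ℝ (chartTrans (𝓡∂ n) x₀ x₁) (Set.range (𝓡∂ n)) y with hA
  have hAw : ∀ w, chartDinv (𝓡∂ n) x₁ ((extChartAt (𝓡∂ n) x₀).symm y) w =
      A (chartDinv (𝓡∂ n) x₀ _ w) := fun w => by
    rw [hA, ← chartDinv_comp_chartD (𝓡∂ n) hy hx₁, ContinuousLinearMap.comp_apply,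
      chartD_chartDinv (𝓡∂ n) hy]
  have hder : HasFDerivWithinAt (fun y' => chartTrans (𝓡∂ n) x₀ x₁ y' 0)
      ((EuclideanSpace.proj (𝕜 := ℝ) (0 : Fin n)).comp A) (Set.range (𝓡∂ n)) y :=
    (EuclideanSpace.proj (𝕜 := ℝ) (0 : Fin n)).hasFDerivAt.comp_hasFDerivWithinAt y
      ((contDiffWithinAt_chartTrans (𝓡∂ n) hy hx₁).differentiableWithinAt
        (by simp)).hasFDerivWithinAt
  -- The normal coordinate of the transition map is nonnegative and vanishes at `y`, hence is
  -- minimal there. The first-order condition makes `A` nonnegative on inward vectors; a tangential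
  -- vector and its opposite are both inward, so `A` annihilates it in the normal direction.
  have hmin : IsLocalMinOn (fun y' => chartTrans (𝓡∂ n) x₀ x₁ y' 0) (Set.range (𝓡∂ n)) y := by
    refine Filter.Eventually.of_forall fun y' => ?_
    change extChartAt (𝓡∂ n) x₁ _ 0 ≤ _
    rw [hz1]
    exact extChartAt_halfSpace_nonneg x₁ _
  have hnn : ∀ v : EuclideanSpace ℝ (Fin n), 0 ≤ v 0 → 0 ≤ A v 0 := by
    intro v hv
    refine hmin.hasFDerivWithinAt_nonneg hder (mem_posTangentConeAt_of_segment_subset ?_)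
    rw [range_modelWithCornersEuclideanHalfSpace]
    rintro _ ⟨a, b, ha, hb, hab, rfl⟩
    simp only [Set.mem_ofPred_eq, PiLp.add_apply, PiLp.smul_apply, hz0, smul_eq_mul]
    nlinarith
  have hker : ∀ v : EuclideanSpace ℝ (Fin n), v 0 = 0 → A v 0 = 0 := by
    intro v hv
    have h1 := hnn v hv.ge
    have h2 := hnn (-v) (by simp [hv])
    rw [map_neg, PiLp.neg_apply] at h2
    linarith
  have hlin : ∀ v : EuclideanSpace ℝ (Fin n), A v 0 = A (EuclideanSpace.single 0 1) 0 * v 0 := by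
    intro v
    have h1 := hker (v - v 0 • EuclideanSpace.single 0 1) (by simp)
    rw [map_sub, map_smul, PiLp.sub_apply, PiLp.smul_apply, smul_eq_mul] at h1
    linarith
  refine ⟨A (EuclideanSpace.single 0 1) 0, lt_of_le_of_ne (hnn _ (by simp)) fun h0 => ?_,
    fun w => by rw [hAw, hlin]⟩
  -- The factor cannot vanish, since the differential of the second chart is onto.
  obtain ⟨w, hw⟩ := (chartDinv_bijective (𝓡∂ n) hx₁).2 (EuclideanSpace.single 0 1)
  have h3 := hlin (chartDinv (𝓡∂ n) x₀ _ w)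
  rw [← hAw, hw, ← h0] at h3
  simp at h3

end BoundaryCoordinates

/-! ### The boundary inclusion in coordinates -/

namespace RiemannianDomain

variable {n : ℕ} [NeZero n]
  {Z : Type*} [TopologicalSpace Z] [ChartedSpace (EuclideanHalfSpace n) Z]
  [IsManifold (𝓡∂ n) ∞ Z]
  {B : Type*} [TopologicalSpace B] [ChartedSpace (EuclideanSpace ℝ (Fin (n - 1))) B]
  (X : RiemannianDomain n Z B)

/-- The inclusion of the boundary in the preferred charts at `b₀` and `x₀`. -/
noncomputable def bdryCoord (b₀ : B) (x₀ : Z) (y : EuclideanSpace ℝ (Fin (n - 1))) :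
    EuclideanSpace ℝ (Fin n) :=
  extChartAt (𝓡∂ n) x₀ (X.incl ((extChartAt (𝓡 (n - 1)) b₀).symm y))

/-- The domain of `bdryCoord`. -/
def bdryDomain (b₀ : B) (x₀ : Z) : Set (EuclideanSpace ℝ (Fin (n - 1))) :=
  (extChartAt (𝓡 (n - 1)) b₀).target ∩
    (extChartAt (𝓡 (n - 1)) b₀).symm ⁻¹' (X.incl ⁻¹' (extChartAt (𝓡∂ n) x₀).source)

/-- The differential of `bdryCoord`. -/
noncomputable def bdryD (b₀ : B) (x₀ : Z) (y : EuclideanSpace ℝ (Fin (n - 1))) :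
    EuclideanSpace ℝ (Fin (n - 1)) →L[ℝ] EuclideanSpace ℝ (Fin n) :=
  fderiv ℝ (X.bdryCoord b₀ x₀) y

lemma isOpen_bdryDomain (b₀ : B) (x₀ : Z) : IsOpen (X.bdryDomain b₀ x₀) :=
  (continuousOn_extChartAt_symm b₀).isOpen_inter_preimage (isOpen_extChartAt_target b₀)
    ((isOpen_extChartAt_source x₀).preimage X.incl_embedding.continuous)

lemma incl_mem_boundary (b : B) : X.incl b ∈ (𝓡∂ n).boundary Z :=
  X.range_incl ▸ Set.mem_range_self b

lemma bdryCoord_zero {b₀ : B} {x₀ : Z} {y : EuclideanSpace ℝ (Fin (n - 1))}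
    (hy : y ∈ X.bdryDomain b₀ x₀) : X.bdryCoord b₀ x₀ y 0 = 0 :=
  (mem_boundary_iff_extChartAt hy.2).1 (X.incl_mem_boundary _)

lemma bdryCoord_mem {b₀ : B} {x₀ : Z} {y : EuclideanSpace ℝ (Fin (n - 1))}
    (hy : y ∈ X.bdryDomain b₀ x₀) : X.bdryCoord b₀ x₀ y ∈ (extChartAt (𝓡∂ n) x₀).target :=
  (extChartAt (𝓡∂ n) x₀).map_source hy.2

variable [IsManifold (𝓡 (n - 1)) ∞ B]

lemma contDiffOn_bdryCoord (b₀ : B) (x₀ : Z) :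
    ContDiffOn ℝ ∞ (X.bdryCoord b₀ x₀) (X.bdryDomain b₀ x₀) := by
  rw [← contMDiffOn_iff_contDiffOn]
  have h1 : ContMDiffOn (𝓡 (n - 1)) (𝓡∂ n) ∞ X.incl Set.univ := X.incl_smooth.contMDiffOn
  refine (contMDiffOn_extChartAt (I := 𝓡∂ n) (n := ∞) (x := x₀)).comp
    (X.incl_smooth.comp_contMDiffOn
      ((contMDiffOn_extChartAt_symm b₀).mono Set.inter_subset_left)) fun y hy => ?_
  rw [← extChartAt_source (𝓡∂ n)]
  exact hy.2

lemma hasFDerivAt_bdryCoord {b₀ : B} {x₀ : Z} {y : EuclideanSpace ℝ (Fin (n - 1))}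
    (hy : y ∈ X.bdryDomain b₀ x₀) :
    HasFDerivAt (X.bdryCoord b₀ x₀) (X.bdryD b₀ x₀ y) y :=
  (((X.contDiffOn_bdryCoord b₀ x₀).contDiffAt ((X.isOpen_bdryDomain b₀ x₀).mem_nhds
    hy)).differentiableAt (by simp)).hasFDerivAt

lemma contDiffOn_bdryD (b₀ : B) (x₀ : Z) :
    ContDiffOn ℝ ∞ (X.bdryD b₀ x₀) (X.bdryDomain b₀ x₀) :=
  (X.contDiffOn_bdryCoord b₀ x₀).fderiv_of_isOpen (X.isOpen_bdryDomain b₀ x₀) (by simp)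

lemma bdryD_zero {b₀ : B} {x₀ : Z} {y : EuclideanSpace ℝ (Fin (n - 1))}
    (hy : y ∈ X.bdryDomain b₀ x₀) (v : EuclideanSpace ℝ (Fin (n - 1))) :
    X.bdryD b₀ x₀ y v 0 = 0 := by
  have h1 := (EuclideanSpace.proj (𝕜 := ℝ) (0 : Fin n)).hasFDerivAt.comp y
    (X.hasFDerivAt_bdryCoord hy)
  have h2 : (EuclideanSpace.proj (𝕜 := ℝ) (0 : Fin n)) ∘ X.bdryCoord b₀ x₀ =ᶠ[𝓝 y]
      fun _ => (0 : ℝ) := by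
    filter_upwards [(X.isOpen_bdryDomain b₀ x₀).mem_nhds hy] with y' hy'
    exact X.bdryCoord_zero hy'
  exact DFunLike.congr_fun (h1.unique ((hasFDerivAt_const (0 : ℝ) y).congr_of_eventuallyEq h2)) v

lemma chartDinv_dincl {b₀ : B} {x₀ : Z} {y : EuclideanSpace ℝ (Fin (n - 1))}
    (hy : y ∈ X.bdryDomain b₀ x₀) (v : EuclideanSpace ℝ (Fin (n - 1))) :
    chartDinv (𝓡∂ n) x₀ (X.incl ((extChartAt (𝓡 (n - 1)) b₀).symm y))
      (X.dincl _ (chartD (𝓡 (n - 1)) b₀ y v)) = X.bdryD b₀ x₀ y v := by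
  have i1 := IsManifold.of_le (I := 𝓡∂ n) (M := Z) (m := 1) (n := ∞) (by norm_num)
  have i2 := IsManifold.of_le (I := 𝓡 (n - 1)) (M := B) (m := 1) (n := ∞) (by norm_num)
  have h1 := mdifferentiableAt_extChartAt (I := 𝓡∂ n) (x := x₀)
    (y := X.incl ((extChartAt (𝓡 (n - 1)) b₀).symm y)) (by simpa using hy.2)
  have h2 := mdifferentiableWithinAt_extChartAt_symm (I := 𝓡 (n - 1)) hy.1
  have h3 : MDifferentiableAt (𝓡 (n - 1)) (𝓡∂ n) X.incl ((extChartAt (𝓡 (n - 1)) b₀).symm y) :=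
    (X.incl_smooth _).mdifferentiableAt (by simp)
  have hu := uniqueMDiffWithinAt_iff_uniqueDiffWithinAt.2
    (uniqueDiffWithinAt_range_of_target (𝓡 (n - 1)) hy.1)
  have h4 := h3.comp_mdifferentiableWithinAt y h2
  have e1 := mfderiv_comp_mfderivWithin y h3 h2 hu
  have e2 := mfderiv_comp_mfderivWithin y h1 h4 hu
  rw [e1] at e2
  have e3 : X.bdryD b₀ x₀ y = mfderivWithin 𝓘(ℝ, EuclideanSpace ℝ (Fin (n - 1)))
      𝓘(ℝ, EuclideanSpace ℝ (Fin n)) (X.bdryCoord b₀ x₀) (Set.range (𝓡 (n - 1))) y := by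
    rw [mfderivWithin_eq_fderivWithin, ModelWithCorners.range_eq_univ, fderivWithin_univ]
    rfl
  rw [e3]
  exact (DFunLike.congr_fun e2 v).symm

lemma chartRep_restrict {k : ℕ} (η : DForm (𝓡∂ n) Z k) {b₀ : B} {x₀ : Z}
    {y : EuclideanSpace ℝ (Fin (n - 1))} (hy : y ∈ X.bdryDomain b₀ x₀) :
    chartRep (𝓡 (n - 1)) (X.restrict η) b₀ y =
      (chartRep (𝓡∂ n) η x₀ (X.bdryCoord b₀ x₀ y)).compContinuousLinearMap (X.bdryD b₀ x₀ y) := by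
  ext v
  change η _ (fun i => X.dincl _ (chartD (𝓡 (n - 1)) b₀ y (v i))) = _
  rw [form_eq_chartRep_at (𝓡∂ n) η hy.2]
  simp only [ContinuousAlternatingMap.compContinuousLinearMap_apply, Function.comp_def,
    X.chartDinv_dincl hy]
  rfl

lemma mem_bdryDomain_self {b₀ : B} {y : EuclideanSpace ℝ (Fin (n - 1))}
    (hy : y ∈ (extChartAt (𝓡 (n - 1)) b₀).target) :
    y ∈ X.bdryDomain b₀ (X.incl ((extChartAt (𝓡 (n - 1)) b₀).symm y)) :=
  ⟨hy, mem_extChartAt_source _⟩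

/-- Smoothness is local on the boundary, so at each point one may use the chart of `Z` at its image,
where restriction is the pull-back by the smooth map `bdryCoord`. -/
lemma smoothCurve_restrict {k : ℕ} {J : Set ℝ} {η : ℝ → DForm (𝓡∂ n) Z k}
    (hη : SmoothCurve (𝓡∂ n) J η) : SmoothCurve (𝓡 (n - 1)) J (fun t => X.restrict (η t)) := by
  intro b₀ z hz
  set x₀ := X.incl ((extChartAt (𝓡 (n - 1)) b₀).symm z.2)
  have hz2 := X.mem_bdryDomain_self hz.2
  have hO := X.isOpen_bdryDomain b₀ x₀
  have h1 : ContDiffOn ℝ ∞ (fun z : ℝ × EuclideanSpace ℝ (Fin (n - 1)) =>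
      (chartRep (𝓡∂ n) (η z.1) x₀ (X.bdryCoord b₀ x₀ z.2)).compContinuousLinearMap
        (X.bdryD b₀ x₀ z.2)) (J ×ˢ X.bdryDomain b₀ x₀) := by
    refine ContDiffOn.form_comp ?_ ((X.contDiffOn_bdryD b₀ x₀).comp contDiffOn_snd
      fun _ h => h.2)
    exact (hη x₀).comp (contDiffOn_fst.prodMk ((X.contDiffOn_bdryCoord b₀ x₀).comp contDiffOn_snd
      fun _ h => h.2)) fun z hz => ⟨hz.1, X.bdryCoord_mem hz.2⟩
  have h2 := (h1.congr fun z hz => X.chartRep_restrict (η z.1) hz.2) z ⟨hz.1, hz2⟩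
  refine h2.mono_of_mem_nhdsWithin ?_
  filter_upwards [self_mem_nhdsWithin, nhdsWithin_le_nhds
    ((hO.preimage continuous_snd).mem_nhds hz2)] with z' h3 h4
  exact ⟨h3.1, h4⟩

lemma smoothForm_restrict {k : ℕ} {η : DForm (𝓡∂ n) Z k} (hη : SmoothForm (𝓡∂ n) η) :
    SmoothForm (𝓡 (n - 1)) (X.restrict η) :=
  .of_curve (X.smoothCurve_restrict (hη.curve _))

end RiemannianDomain

lemma IsVolumeForm.orientationForm {m : ℕ} {H : Type*} [TopologicalSpace H]
    {I : ModelWithCorners ℝ (EuclideanSpace ℝ (Fin m)) H}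
    {M : Type*} [TopologicalSpace M] [ChartedSpace H M] [IsManifold I ∞ M]
    {g : ∀ x : M, TangentSpace I x → TangentSpace I x → ℝ} {vol : DForm I M m}
    (H : ∀ x, IsVolumeForm (g x) (vol x)) (hvol : SmoothForm I vol) : OrientationForm I vol where
  smooth := hvol
  ne_zero x₀ y hy := by
    have := (H ((extChartAt I x₀).symm y)).apply_basis_ne_zero (chartBasis I hy)
    rwa [coe_chartBasis] at this

/-- The vector dual to a coordinate of a basis, in terms of the inverse of the Gram matrix. -/
lemma IsScalarProduct.apply_sum_inv_gram {V : Type*} [AddCommGroup V] [Module ℝ V]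
    {g : V → V → ℝ} (hg : IsScalarProduct g) {m : ℕ} (e : Module.Basis (Fin m) ℝ V) (i : Fin m)
    (w : V) : g (∑ a, (Matrix.of fun i j => g (e i) (e j))⁻¹ i a • e a) w = e.repr w i := by
  have hdet := hg.det_gram_ne_zero e
  conv_lhs => rw [← e.sum_repr w]
  rw [hg.sum_smul_right]
  have : ∀ j, g (∑ a, (Matrix.of fun i j => g (e i) (e j))⁻¹ i a • e a) (e j) =
      if i = j then 1 else 0 := by
    intro j
    rw [hg.sum_smul_left]
    have h1 := congrFun (congrFun (Matrix.nonsing_inv_mul (Matrix.of fun i j => g (e i) (e j))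
      (isUnit_iff_ne_zero.2 hdet)) i) j
    rw [Matrix.mul_apply, Matrix.one_apply] at h1
    exact h1
  simp [this]

/-! ### Metric, outward normal and boundary volume form -/

namespace RiemannianDomain

variable {n : ℕ} [NeZero n]
  {Z : Type*} [TopologicalSpace Z] [ChartedSpace (EuclideanHalfSpace n) Z]
  [IsManifold (𝓡∂ n) ∞ Z]
  {B : Type*} [TopologicalSpace B] [ChartedSpace (EuclideanSpace ℝ (Fin (n - 1))) B]
  (X : RiemannianDomain n Z B)

/-- The Riemannian metric as a family of scalar products. -/
noncomputable abbrev metric (x : Z) (v w : TangentSpace (𝓡∂ n) x) : ℝ := X.g.inner x v w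

lemma isScalarProduct_metric (x : Z) : IsScalarProduct (X.metric x) where
  add_left u v w := by simp [metric]
  smul_left c v w := by simp [metric]
  symm v w := X.g.symm x v w
  pos v hv := X.g.pos x v hv

lemma isVolumeForm (x : Z) : IsVolumeForm (X.metric x) (X.vol x) where
  scalar := X.isScalarProduct_metric x
  finite := inferInstance
  finrank := finrank_euclideanSpace_fin (𝕜 := ℝ) (n := n)
  unit := X.vol_unit x

lemma orientationForm : OrientationForm (𝓡∂ n) X.vol :=
  IsVolumeForm.orientationForm X.isVolumeForm X.vol_smooth

lemma smoothMetric : SmoothMetric (𝓡∂ n) X.metric := by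
  intro x₀ i j
  have hT := uniqueDiffOn_extChartAt_target (I := 𝓡∂ n) x₀
  -- The coordinate fields are the images of constant fields under the tangent map of the inverse
  -- chart, hence smooth as sections.
  have hv : ∀ i : Fin n, ContMDiffOn 𝓘(ℝ, EuclideanSpace ℝ (Fin n)) ((𝓡∂ n).prod 𝓘(ℝ, EuclideanSpace ℝ (Fin n))) ∞
      (fun y => (⟨(extChartAt (𝓡∂ n) x₀).symm y, chartD (𝓡∂ n) x₀ y (EuclideanSpace.single i 1)⟩ :
        TangentBundle (𝓡∂ n) Z)) (extChartAt (𝓡∂ n) x₀).target := by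
    intro i
    have h1 := (contMDiffOn_extChartAt_symm (I := 𝓡∂ n) (n := ∞) x₀).contMDiffOn_tangentMapWithin
      (m := ∞) (by simp) (uniqueMDiffOn_iff_uniqueDiffOn.2 hT)
    have h2 : ContMDiffOn 𝓘(ℝ, EuclideanSpace ℝ (Fin n)) 𝓘(ℝ, EuclideanSpace ℝ (Fin n)).tangent ∞
      (fun y => (⟨y, EuclideanSpace.single i 1⟩ :
        TangentBundle 𝓘(ℝ, EuclideanSpace ℝ (Fin n)) (EuclideanSpace ℝ (Fin n))))
        (extChartAt (𝓡∂ n) x₀).target :=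
      contMDiffOn_vectorSpace_iff_contDiffOn.2 contDiffOn_const
    refine (h1.comp h2 fun y hy => hy).congr fun y hy => ?_
    have h3 : mfderivWithin 𝓘(ℝ, EuclideanSpace ℝ (Fin n)) (𝓡∂ n) (extChartAt (𝓡∂ n) x₀).symm
        (extChartAt (𝓡∂ n) x₀).target y = chartD (𝓡∂ n) x₀ y := by
      have i1 := IsManifold.of_le (I := 𝓡∂ n) (M := Z) (m := 1) (n := ∞) (by norm_num)
      exact (((contMDiffOn_extChartAt_symm (I := 𝓡∂ n) (n := ∞) x₀) y hy).mdifferentiableWithinAt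
        (by simp)).mfderivWithin_mono_of_mem_nhdsWithin
        (uniqueMDiffWithinAt_iff_uniqueDiffWithinAt.2
          (uniqueDiffWithinAt_range_of_target (𝓡∂ n) hy))
        (extChartAt_target_mem_nhdsWithin_of_mem hy) |>.symm
    simp only [Function.comp_apply, tangentMapWithin, h3]
    rfl
  intro y hy
  have hg := X.g.contMDiff.contMDiffAt.comp_contMDiffWithinAt y
    ((contMDiffOn_extChartAt_symm (I := 𝓡∂ n) (n := ∞) x₀) y hy)
  have h4 := ContMDiffWithinAt.clm_bundle_apply₂ (F₁ := EuclideanSpace ℝ (Fin n))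
    (F₂ := EuclideanSpace ℝ (Fin n)) (F₃ := ℝ) (E₃ := Bundle.Trivial Z ℝ)
    (b := (extChartAt (𝓡∂ n) x₀).symm) hg (hv i y hy) (hv j y hy)
  rw [Bundle.contMDiffWithinAt_totalSpace] at h4
  exact contMDiffWithinAt_iff_contDiffWithinAt.1 h4.2

/-- The Gram matrix of the coordinate frame. -/
noncomputable def gram (x₀ : Z) (y : EuclideanSpace ℝ (Fin n)) : Matrix (Fin n) (Fin n) ℝ :=
  Matrix.of fun i j => X.metric ((extChartAt (𝓡∂ n) x₀).symm y)
    (chartD (𝓡∂ n) x₀ y (EuclideanSpace.single i 1))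
    (chartD (𝓡∂ n) x₀ y (EuclideanSpace.single j 1))

lemma metric_eq_sum_gram {x₀ x : Z} (hx : x ∈ (extChartAt (𝓡∂ n) x₀).source)
    (v w : TangentSpace (𝓡∂ n) x) : X.metric x v w =
      ∑ i, chartDinv (𝓡∂ n) x₀ x v i * ∑ j, chartDinv (𝓡∂ n) x₀ x w j *
        X.gram x₀ (extChartAt (𝓡∂ n) x₀ x) i j := by
  obtain ⟨y, hy, rfl⟩ : ∃ y ∈ (extChartAt (𝓡∂ n) x₀).target, (extChartAt (𝓡∂ n) x₀).symm y = x :=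
    ⟨_, (extChartAt (𝓡∂ n) x₀).map_source hx, (extChartAt (𝓡∂ n) x₀).left_inv hx⟩
  rw [(extChartAt (𝓡∂ n) x₀).right_inv hy]
  have h1 : ∀ v : TangentSpace (𝓡∂ n) ((extChartAt (𝓡∂ n) x₀).symm y),
      v = ∑ i, chartDinv (𝓡∂ n) x₀ _ v i • chartD (𝓡∂ n) x₀ y (EuclideanSpace.single i 1) := by
    intro v
    conv_lhs => rw [← chartD_chartDinv (𝓡∂ n) hy v,
      sum_coord_smul_single (chartDinv (𝓡∂ n) x₀ _ v), map_sum]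
    simp only [map_smul]
  have hg := X.isScalarProduct_metric ((extChartAt (𝓡∂ n) x₀).symm y)
  conv_lhs => rw [h1 v, h1 w]
  rw [hg.sum_smul_left]
  simp only [hg.sum_smul_right]
  rfl

/-- The outward unit normal in the preferred chart at `x₀`, extended to the whole chart. -/
noncomputable def normalCoord (x₀ : Z) (y : EuclideanSpace ℝ (Fin n)) : EuclideanSpace ℝ (Fin n) :=
  -(√((X.gram x₀ y)⁻¹ 0 0))⁻¹ • ∑ a, (X.gram x₀ y)⁻¹ 0 a • EuclideanSpace.single a (1 : ℝ)

/-- The vector with components `g^{0a}` is dual to the differential of the normal coordinate. Its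
squared length is its own coordinate `g^{00}`, which is therefore positive and provides the
normalisation. -/
lemma gram_inv_pos_and {x₀ : Z} {y : EuclideanSpace ℝ (Fin n)}
    (hy : y ∈ (extChartAt (𝓡∂ n) x₀).target) : 0 < (X.gram x₀ y)⁻¹ 0 0 ∧
    ∀ w, X.metric _ (chartD (𝓡∂ n) x₀ y (X.normalCoord x₀ y)) w =
      -(√((X.gram x₀ y)⁻¹ 0 0))⁻¹ * chartDinv (𝓡∂ n) x₀ _ w 0 := by
  have hg := X.isScalarProduct_metric ((extChartAt (𝓡∂ n) x₀).symm y)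
  have h0 := hg.apply_sum_inv_gram (chartBasis (𝓡∂ n) hy) 0
  simp only [chartBasis_apply] at h0
  have hr : ∀ w, (chartBasis (𝓡∂ n) hy).repr w 0 = chartDinv (𝓡∂ n) x₀ _ w 0 := by
    intro w
    have : (chartBasis (𝓡∂ n) hy).repr w = (stdB n).repr (chartDinv (𝓡∂ n) x₀ _ w) := by
      obtain ⟨v, rfl⟩ := (chartD_bijective (𝓡∂ n) hy).2 w
      rw [chartDinv_chartD (𝓡∂ n) hy, chartBasis, Module.Basis.map_repr, LinearEquiv.trans_apply]
      congr 1
      exact (LinearEquiv.symm_apply_eq _).2 rfl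
    rw [this]
    rfl
  set N := ∑ a, (X.gram x₀ y)⁻¹ 0 a • EuclideanSpace.single a (1 : ℝ) with hN
  have h1 : ∀ w, X.metric _ (chartD (𝓡∂ n) x₀ y N) w = chartDinv (𝓡∂ n) x₀ _ w 0 := by
    intro w
    rw [← hr, ← h0, hN, map_sum]
    simp only [map_smul]
    rfl
  have hN0 : N 0 = (X.gram x₀ y)⁻¹ 0 0 := by simp [hN, Pi.single_apply]
  refine ⟨?_, fun w => ?_⟩
  · have h2 := h1 (chartD (𝓡∂ n) x₀ y N)
    rw [chartDinv_chartD (𝓡∂ n) hy, hN0] at h2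
    rw [← h2]
    refine hg.pos _ fun h3 => ?_
    have h4 := h1 (chartD (𝓡∂ n) x₀ y (EuclideanSpace.single 0 1))
    have h5 := hg.smul_left 0 0 (chartD (𝓡∂ n) x₀ y (EuclideanSpace.single 0 1))
    rw [zero_smul, zero_mul, ← h3, h4, chartDinv_chartD (𝓡∂ n) hy] at h5
    simp at h5
  · rw [normalCoord, map_smul, hg.smul_left, h1]

lemma normalCoord_zero_neg {x₀ : Z} {y : EuclideanSpace ℝ (Fin n)}
    (hy : y ∈ (extChartAt (𝓡∂ n) x₀).target) : X.normalCoord x₀ y 0 < 0 := by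
  have h := (X.gram_inv_pos_and hy).1
  have : X.normalCoord x₀ y 0 = -(√((X.gram x₀ y)⁻¹ 0 0))⁻¹ * (X.gram x₀ y)⁻¹ 0 0 := by
    simp [normalCoord, Pi.single_apply]
  rw [this, neg_mul, neg_lt_zero]
  positivity

lemma exists_normalCoord {x₀ x : Z} (hx : x ∈ (extChartAt (𝓡∂ n) x₀).source) :
    ∃ u : TangentSpace (𝓡∂ n) x,
      chartDinv (𝓡∂ n) x₀ x u = X.normalCoord x₀ (extChartAt (𝓡∂ n) x₀ x) ∧
      X.metric x u u = 1 ∧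
      ∀ w, chartDinv (𝓡∂ n) x₀ x w 0 = 0 → X.metric x u w = 0 := by
  obtain ⟨y, hy, rfl⟩ : ∃ y ∈ (extChartAt (𝓡∂ n) x₀).target, (extChartAt (𝓡∂ n) x₀).symm y = x :=
    ⟨_, (extChartAt (𝓡∂ n) x₀).map_source hx, (extChartAt (𝓡∂ n) x₀).left_inv hx⟩
  rw [(extChartAt (𝓡∂ n) x₀).right_inv hy]
  obtain ⟨h1, h2⟩ := X.gram_inv_pos_and hy
  refine ⟨chartD (𝓡∂ n) x₀ y (X.normalCoord x₀ y), chartDinv_chartD (𝓡∂ n) hy _, ?_, fun w hw => ?_⟩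
  · have : X.normalCoord x₀ y 0 = -(√((X.gram x₀ y)⁻¹ 0 0))⁻¹ * (X.gram x₀ y)⁻¹ 0 0 := by
      simp [normalCoord, Pi.single_apply]
    rw [h2, chartDinv_chartD (𝓡∂ n) hy, this]
    have h3 := Real.sqrt_pos.2 h1
    have h4 := Real.mul_self_sqrt h1.le
    field_simp
    rw [← h4]
    ring_nf
    simp [Real.sqrt_sq h3.le]
  · rw [h2, hw, mul_zero]

lemma contDiffOn_gram_inv (x₀ : Z) (i j : Fin n) :
    ContDiffOn ℝ ∞ (fun y => (X.gram x₀ y)⁻¹ i j) (extChartAt (𝓡∂ n) x₀).target := by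
  refine ContDiffOn.matrix_inv (fun i j => X.smoothMetric x₀ i j) (fun y hy => ?_) i j
  have := (X.isScalarProduct_metric ((extChartAt (𝓡∂ n) x₀).symm y)).det_gram_ne_zero
    (chartBasis (𝓡∂ n) hy)
  simp only [chartBasis_apply] at this
  exact this

lemma contDiffOn_normalCoord (x₀ : Z) :
    ContDiffOn ℝ ∞ (X.normalCoord x₀) (extChartAt (𝓡∂ n) x₀).target := by
  refine ContDiffOn.smul (((X.contDiffOn_gram_inv x₀ 0 0).sqrt fun y hy => ?_).inv
    fun y hy => ?_).neg (ContDiffOn.sum fun a _ => (X.contDiffOn_gram_inv x₀ 0 a).smul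
      contDiffOn_const)
  · exact (X.gram_inv_pos_and hy).1.ne'
  · exact (Real.sqrt_pos.2 (X.gram_inv_pos_and hy).1).ne'

variable [IsManifold (𝓡 (n - 1)) ∞ B]

lemma chartDinv_dincl_zero {x₀ : Z} {b : B} (hb : X.incl b ∈ (extChartAt (𝓡∂ n) x₀).source)
    (w : TangentSpace (𝓡 (n - 1)) b) : chartDinv (𝓡∂ n) x₀ (X.incl b) (X.dincl b w) 0 = 0 := by
  obtain ⟨b₀, y, hy, rfl⟩ : ∃ b₀, ∃ y ∈ (extChartAt (𝓡 (n - 1)) b₀).target,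
      (extChartAt (𝓡 (n - 1)) b₀).symm y = b :=
    ⟨b, _, mem_extChartAt_target b, extChartAt_to_inv b⟩
  obtain ⟨v, rfl⟩ := (chartD_bijective (𝓡 (n - 1)) hy).2 w
  rw [X.chartDinv_dincl ⟨hy, hb⟩, X.bdryD_zero ⟨hy, hb⟩]

/-- The vectors tangent to the boundary are those with vanishing normal coordinate. -/
lemma exists_dincl_eq {x₀ : Z} {b : B} (hb : X.incl b ∈ (extChartAt (𝓡∂ n) x₀).source)
    {w : TangentSpace (𝓡∂ n) (X.incl b)} (hw : chartDinv (𝓡∂ n) x₀ (X.incl b) w 0 = 0) :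
    ∃ v, X.dincl b v = w := by
  let L : TangentSpace (𝓡∂ n) (X.incl b) →ₗ[ℝ] ℝ :=
    ((EuclideanSpace.proj (𝕜 := ℝ) (0 : Fin n)).comp (chartDinv (𝓡∂ n) x₀ (X.incl b))).toLinearMap
  have hL : L ≠ 0 := by
    intro h
    obtain ⟨u, hu⟩ := (chartDinv_bijective (𝓡∂ n) hb).2 (EuclideanSpace.single 0 1)
    have h1 : L u = 1 := by
      change chartDinv (𝓡∂ n) x₀ (X.incl b) u 0 = 1
      rw [hu]
      simp
    rw [h] at h1
    exact zero_ne_one h1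
  have h1 : LinearMap.range (X.dincl b).toLinearMap ≤ LinearMap.ker L := by
    rintro _ ⟨v, rfl⟩
    exact X.chartDinv_dincl_zero hb v
  have h2 := Module.Dual.finrank_ker_add_one_of_ne_zero (f := L) hL
  have h3 := LinearMap.finrank_range_of_inj (f := (X.dincl b).toLinearMap) (X.incl_immersion b)
  have h4 : Module.finrank ℝ (TangentSpace (𝓡∂ n) (X.incl b)) = n :=
    finrank_euclideanSpace_fin (𝕜 := ℝ) (n := n)
  have h5 : Module.finrank ℝ (TangentSpace (𝓡 (n - 1)) b) = n - 1 :=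
    finrank_euclideanSpace_fin (𝕜 := ℝ) (n := n - 1)
  have h6 := Submodule.eq_of_le_of_finrank_eq h1 (by omega)
  have h7 : w ∈ LinearMap.range (X.dincl b).toLinearMap := by
    rw [h6]
    exact hw
  exact h7

/-- Outwardness is defined with the preferred chart at the foot point; by `exists_pos_chartDinv` it
can be read in any chart. The normal field is thereby given, throughout a chart, by the smooth field
`normalCoord`. -/
lemma isOutwardUnitNormal_iff {x₀ : Z} {b : B} (hb : X.incl b ∈ (extChartAt (𝓡∂ n) x₀).source)
    (ν : TangentSpace (𝓡∂ n) (X.incl b)) : X.IsOutwardUnitNormal b ν ↔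
      chartDinv (𝓡∂ n) x₀ (X.incl b) ν =
        X.normalCoord x₀ (extChartAt (𝓡∂ n) x₀ (X.incl b)) := by
  obtain ⟨u, hu, hu1, hu2⟩ := X.exists_normalCoord hb
  obtain ⟨c, hc, hc'⟩ := exists_pos_chartDinv (X.incl_mem_boundary b) hb
    (mem_extChartAt_source (I := 𝓡∂ n) (X.incl b))
  have hneg := X.normalCoord_zero_neg ((extChartAt (𝓡∂ n) x₀).map_source hb)
  rw [← hu] at hneg ⊢
  have hg := X.isScalarProduct_metric (X.incl b)
  constructor
  · rintro ⟨h1, h2, h3⟩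
    have h3' : chartDinv (𝓡∂ n) x₀ (X.incl b) ν 0 < 0 := by
      have : c * chartDinv (𝓡∂ n) x₀ (X.incl b) ν 0 < 0 := by
        rw [← hc']
        exact h3
      exact (pos_iff_neg_of_mul_neg this).1 hc
    -- With this `a`, the vector `ν - a u` has no normal coordinate and is tangent to the boundary.
    -- It is then orthogonal to `ν` and to `u`, so it has length zero, and `a > 0` with `a² = 1`
    -- leaves `a = 1`.
    set a := chartDinv (𝓡∂ n) x₀ (X.incl b) ν 0 / chartDinv (𝓡∂ n) x₀ (X.incl b) u 0 with ha
    have ha0 : 0 < a := div_pos_of_neg_of_neg h3' hneg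
    have h4 : chartDinv (𝓡∂ n) x₀ (X.incl b) (ν - a • u) 0 = 0 := by
      rw [map_sub, map_smul, PiLp.sub_apply, PiLp.smul_apply, ha, smul_eq_mul,
        div_mul_cancel₀ _ hneg.ne, sub_self]
    obtain ⟨v, hv⟩ := X.exists_dincl_eq hb h4
    have h5 : X.metric _ ν (ν - a • u) = 0 := by rw [← hv]; exact h2 v
    have h6 := hu2 _ h4
    have h7 : X.metric _ (ν - a • u) (ν - a • u) = 0 := by
      rw [sub_eq_add_neg, ← neg_smul, hg.add_left, hg.smul_left, neg_smul, ← sub_eq_add_neg,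
        h5, h6, mul_zero, add_zero]
    have h8 : ν = a • u := by
      by_contra hne
      exact (hg.pos _ (sub_ne_zero.2 hne)).ne' h7
    have h9 : a * a = 1 := by
      have : X.metric _ ν ν = 1 := h1
      rw [h8, hg.smul_left, hg.symm, hg.smul_left, hu1, mul_one] at this
      exact this
    have h10 : a = 1 := by nlinarith
    rw [h8, h10, one_smul]
  · intro h
    rw [(chartDinv_bijective (𝓡∂ n) hb).1 h]
    refine ⟨hu1, fun w => hu2 _ (X.chartDinv_dincl_zero hb w), ?_⟩
    have : chartDinv (𝓡∂ n) (X.incl b) (X.incl b) u 0 < 0 := by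
      rw [hc']
      exact mul_neg_of_pos_of_neg hc hneg
    exact this

lemma isOutwardUnitNormal_normal (b : B) : X.IsOutwardUnitNormal b (X.normal b) := by
  have hb := mem_extChartAt_source (I := 𝓡∂ n) (X.incl b)
  obtain ⟨u, hu, -⟩ := X.exists_normalCoord hb
  exact Classical.epsilon_spec (p := X.IsOutwardUnitNormal b)
    ⟨u, (X.isOutwardUnitNormal_iff hb u).2 hu⟩

lemma chartDinv_normal {x₀ : Z} {b : B} (hb : X.incl b ∈ (extChartAt (𝓡∂ n) x₀).source) :
    chartDinv (𝓡∂ n) x₀ (X.incl b) (X.normal b) =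
      X.normalCoord x₀ (extChartAt (𝓡∂ n) x₀ (X.incl b)) :=
  (X.isOutwardUnitNormal_iff hb _).1 (X.isOutwardUnitNormal_normal b)

lemma isScalarProduct_bdryMetric (b : B) : IsScalarProduct (X.bdryMetric b) where
  add_left u v w := by simp [bdryMetric]
  smul_left c v w := by simp [bdryMetric]
  symm v w := X.g.symm _ _ _
  pos v hv := X.g.pos _ _ fun h => hv (X.incl_immersion b (h.trans (map_zero (X.dincl b)).symm))

/-- An orthonormal frame of the boundary, preceded by the outward normal, is an orthonormal frame of
`Z`. -/
lemma isVolumeForm_bdry (b : B) : IsVolumeForm (X.bdryMetric b) (X.bdryVol b) where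
  scalar := X.isScalarProduct_bdryMetric b
  finite := inferInstance
  finrank := finrank_euclideanSpace_fin (𝕜 := ℝ) (n := n - 1)
  unit e he := by
    obtain ⟨h1, h2, -⟩ := X.isOutwardUnitNormal_normal b
    have hn : 1 + (n - 1) = n := Nat.add_sub_cancel' (NeZero.one_le (n := n))
    have h3 : X.bdryVol b e = X.vol (X.incl b) (fun i => Fin.append (fun _ : Fin 1 => X.normal b)
        (fun j => X.dincl b (e j)) (Fin.cast hn.symm i)) :=
      contract_apply hn _ _ _
    rw [h3]
    refine X.vol_unit _ _ fun i j => ?_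
    obtain ⟨i, rfl⟩ : ∃ i', i = Fin.cast hn i' := ⟨Fin.cast hn.symm i, rfl⟩
    obtain ⟨j, rfl⟩ : ∃ j', j = Fin.cast hn j' := ⟨Fin.cast hn.symm j, rfl⟩
    simp only [Fin.cast_cast, Fin.cast_eq_self, Fin.cast_inj]
    induction i using Fin.addCases with
    | left i =>
      induction j using Fin.addCases with
      | left j =>
        rw [Fin.append_left, Fin.append_left, h1, if_pos (by rw [Subsingleton.elim i j])]
      | right j =>
        rw [Fin.append_left, Fin.append_right, h2, if_neg]
        intro h
        have := congrArg Fin.val h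
        simp at this
        omega
    | right i =>
      induction j using Fin.addCases with
      | left j =>
        rw [Fin.append_left, Fin.append_right, X.g.symm, h2, if_neg]
        intro h
        have := congrArg Fin.val h
        simp at this
      | right j =>
        rw [Fin.append_right, Fin.append_right]
        have := he i j
        simp only [Fin.natAdd_inj]
        exact this

lemma chartRep_bdryVol {b₀ : B} {x₀ : Z} {y : EuclideanSpace ℝ (Fin (n - 1))}
    (hy : y ∈ X.bdryDomain b₀ x₀) (v : Fin (n - 1) → EuclideanSpace ℝ (Fin (n - 1))) :
    chartRep (𝓡 (n - 1)) X.bdryVol b₀ y v =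
      chartRep (𝓡∂ n) X.vol x₀ (X.bdryCoord b₀ x₀ y) (fun i =>
        Fin.append (fun _ : Fin 1 => X.normalCoord x₀ (X.bdryCoord b₀ x₀ y))
          (fun j => X.bdryD b₀ x₀ y (v j))
          (Fin.cast (Nat.add_sub_cancel' (NeZero.one_le (n := n))).symm i)) := by
  have hn : 1 + (n - 1) = n := Nat.add_sub_cancel' (NeZero.one_le (n := n))
  have h3 : chartRep (𝓡 (n - 1)) X.bdryVol b₀ y v = X.vol (X.incl _) (fun i =>
      Fin.append (fun _ : Fin 1 => X.normal ((extChartAt (𝓡 (n - 1)) b₀).symm y))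
        (fun j => X.dincl _ (chartD (𝓡 (n - 1)) b₀ y (v j))) (Fin.cast hn.symm i)) :=
    contract_apply hn _ _ _
  rw [h3, form_eq_chartRep_at (𝓡∂ n) X.vol hy.2]
  simp only [ContinuousAlternatingMap.compContinuousLinearMap_apply, Function.comp_def]
  refine congrArg (chartRep (𝓡∂ n) X.vol x₀ (X.bdryCoord b₀ x₀ y)) (funext fun i => ?_)
  obtain ⟨i, rfl⟩ : ∃ i', i = Fin.cast hn i' := ⟨Fin.cast hn.symm i, rfl⟩
  simp only [Fin.cast_cast, Fin.cast_eq_self]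
  induction i using Fin.addCases with
  | left i =>
    rw [Fin.append_left, Fin.append_left, X.chartDinv_normal hy.2]
    rfl
  | right i => rw [Fin.append_right, Fin.append_right, X.chartDinv_dincl hy]

lemma contDiffOn_of_bdryDomain {F : Type*} [NormedAddCommGroup F] [NormedSpace ℝ F] {b₀ : B}
    {f : EuclideanSpace ℝ (Fin (n - 1)) → F}
    (hf : ∀ x₀, ContDiffOn ℝ ∞ f (X.bdryDomain b₀ x₀)) :
    ContDiffOn ℝ ∞ f (extChartAt (𝓡 (n - 1)) b₀).target := fun _ hy =>
  (((hf _).contDiffAt ((X.isOpen_bdryDomain b₀ _).mem_nhds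
    (X.mem_bdryDomain_self hy)))).contDiffWithinAt

lemma smoothForm_bdryVol : SmoothForm (𝓡 (n - 1)) X.bdryVol := by
  intro b₀
  refine X.contDiffOn_of_bdryDomain fun x₀ => contDiffOn_form_iff.2 fun t => ?_
  have hc := X.contDiffOn_bdryCoord b₀ x₀
  have hm : Set.MapsTo (X.bdryCoord b₀ x₀) (X.bdryDomain b₀ x₀) (extChartAt (𝓡∂ n) x₀).target :=
    fun y hy => X.bdryCoord_mem hy
  refine ContDiffOn.congr (ContDiffOn.form_apply ((X.vol_smooth x₀).comp hc hm) fun i => ?_)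
    fun y hy => X.chartRep_bdryVol hy _
  have hn : 1 + (n - 1) = n := Nat.add_sub_cancel' (NeZero.one_le (n := n))
  obtain ⟨i, rfl⟩ : ∃ i', i = Fin.cast hn i' := ⟨Fin.cast hn.symm i, rfl⟩
  simp only [Fin.cast_cast, Fin.cast_eq_self]
  induction i using Fin.addCases with
  | left i =>
    simp only [Fin.append_left]
    exact (X.contDiffOn_normalCoord x₀).comp hc hm
  | right i =>
    simp only [Fin.append_right]
    exact (X.contDiffOn_bdryD b₀ x₀).clm_apply contDiffOn_const

lemma orientationForm_bdry : OrientationForm (𝓡 (n - 1)) X.bdryVol :=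
  IsVolumeForm.orientationForm X.isVolumeForm_bdry X.smoothForm_bdryVol

lemma smoothMetric_bdry : SmoothMetric (𝓡 (n - 1)) X.bdryMetric := by
  intro b₀ i j
  refine X.contDiffOn_of_bdryDomain fun x₀ => ?_
  have hc := X.contDiffOn_bdryCoord b₀ x₀
  have hm : Set.MapsTo (X.bdryCoord b₀ x₀) (X.bdryDomain b₀ x₀) (extChartAt (𝓡∂ n) x₀).target :=
    fun y hy => X.bdryCoord_mem hy
  have hD : ∀ i, ContDiffOn ℝ ∞ (fun y => X.bdryD b₀ x₀ y (EuclideanSpace.single i 1))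
      (X.bdryDomain b₀ x₀) := fun i => (X.contDiffOn_bdryD b₀ x₀).clm_apply contDiffOn_const
  have h1 : ContDiffOn ℝ ∞ (fun y => ∑ k, X.bdryD b₀ x₀ y (EuclideanSpace.single i 1) k *
      ∑ l, X.bdryD b₀ x₀ y (EuclideanSpace.single j 1) l *
        X.gram x₀ (X.bdryCoord b₀ x₀ y) k l) (X.bdryDomain b₀ x₀) :=
    ContDiffOn.sum fun k _ => ((hD i).euclidean_apply k).mul <| ContDiffOn.sum fun l _ =>
      ((hD j).euclidean_apply l).mul ((X.smoothMetric x₀ k l).comp hc hm)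
  refine h1.congr fun y hy => ?_
  have h2 := X.metric_eq_sum_gram hy.2
    (X.dincl _ (chartD (𝓡 (n - 1)) b₀ y (EuclideanSpace.single i 1)))
    (X.dincl _ (chartD (𝓡 (n - 1)) b₀ y (EuclideanSpace.single j 1)))
  rw [X.chartDinv_dincl hy, X.chartDinv_dincl hy] at h2
  exact h2

end RiemannianDomain

/-! ### The divergence theorem on a half space -/

/-- The divergence theorem for compactly supported vector fields on a half space. -/
lemma integral_halfSpace_divergence {m : ℕ} {f : Fin (m + 1) → EuclideanSpace ℝ (Fin (m + 1)) → ℝ}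
    {K : Set (EuclideanSpace ℝ (Fin (m + 1)))} (hK : IsCompact K)
    (hf : ∀ i, ContDiffOn ℝ 1 (f i) {y | 0 ≤ y 0})
    (h0 : ∀ i y, 0 ≤ y 0 → y ∉ K → f i y = 0) :
    ∫ y in {y : EuclideanSpace ℝ (Fin (m + 1)) | 0 ≤ y 0},
        ∑ i, fderivWithin ℝ (f i) {y | 0 ≤ y 0} y (EuclideanSpace.single i 1) =
      -∫ w : EuclideanSpace ℝ (Fin m), f 0 (WithLp.toLp 2 (Fin.cons 0 w)) := by
  set H := {y : EuclideanSpace ℝ (Fin (m + 1)) | 0 ≤ y 0} with hH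
  have hHu : UniqueDiffOn ℝ H := by
    rw [hH, ← range_modelWithCornersEuclideanHalfSpace]
    exact (𝓡∂ (m + 1)).uniqueDiffOn
  have hHc : IsClosed H := by
    rw [hH, ← range_modelWithCornersEuclideanHalfSpace]
    exact (𝓡∂ (m + 1)).isClosed_range
  have hHi : ∀ y : EuclideanSpace ℝ (Fin (m + 1)), 0 < y 0 → H ∈ 𝓝 y := fun y hy => by
    have h1 : IsOpen {y : EuclideanSpace ℝ (Fin (m + 1)) | 0 < y 0} :=
      isOpen_lt continuous_const (EuclideanSpace.proj (𝕜 := ℝ) (0 : Fin (m + 1))).continuous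
    filter_upwards [h1.mem_nhds hy] with z (hz : 0 < z 0)
    exact hz.le
  set D : EuclideanSpace ℝ (Fin (m + 1)) → ℝ := fun y =>
    ∑ i, fderivWithin ℝ (f i) H y (EuclideanSpace.single i 1) with hD
  have hDc : ContinuousOn D H := continuousOn_finsetSum _ fun i _ =>
    ((hf i).continuousOn_fderivWithin hHu le_rfl).clm_apply continuousOn_const
  have hD0 : ∀ y ∈ H, y ∉ K → D y = 0 := by
    intro y hy hyK
    refine Finset.sum_eq_zero fun i _ => ?_
    have h1 : f i =ᶠ[𝓝[H] y] fun _ => 0 := by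
      filter_upwards [self_mem_nhdsWithin, nhdsWithin_le_nhds (hK.isClosed.isOpen_compl.mem_nhds
        hyK)] with z hz hzK
      exact h0 i z hz hzK
    rw [h1.fderivWithin_eq (h0 i y hy hyK), fderivWithin_const_apply]
    rfl
  have hDi : IntegrableOn D H :=
    IntegrableOn.of_forall_sdiff_eq_zero (s := K ∩ H)
      ((hDc.mono Set.inter_subset_right).integrableOn_compact (hK.inter_right hHc))
      hHc.measurableSet fun y hy => hD0 y hy.1 fun h => hy.2 ⟨h, hy.1⟩
  -- The box `[0, R] × [-R, R]^m` contains the part of `K` in the half space, and its faces other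
  -- than `y₀ = 0` do not meet `K`.
  obtain ⟨R, hR0, hR⟩ : ∃ R : ℝ, 0 < R ∧ ∀ y ∈ K, ∀ i, |y i| < R := by
    obtain ⟨R, hR⟩ := hK.isBounded.exists_norm_le
    refine ⟨|R| + 1, by positivity, fun y hy i => ?_⟩
    calc |y i| ≤ ‖y‖ := PiLp.norm_apply_le y i
      _ ≤ R := hR y hy
      _ < |R| + 1 := by linarith [le_abs_self R]
  set a : Fin (m + 1) → ℝ := Fin.cons 0 fun _ => -R with ha
  set b : Fin (m + 1) → ℝ := fun _ => R with hb
  have hab : a ≤ b := by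
    intro i
    refine Fin.cases ?_ (fun i => ?_) i
    · simp [ha, hb, hR0.le]
    · simp [ha, hb]; linarith
  have ha0 : ∀ x ∈ Set.Icc a b, WithLp.toLp 2 x ∈ H := fun x hx => hx.1 0
  have hKI : ∀ x : Fin (m + 1) → ℝ, WithLp.toLp 2 x ∈ H → WithLp.toLp 2 x ∈ K →
      x ∈ Set.Icc a b := by
    intro x hx hxK
    refine ⟨fun i => ?_, fun i => (abs_lt.1 (hR _ hxK i)).2.le⟩
    refine Fin.cases ?_ (fun i => ?_) i
    · exact hx
    · exact (abs_lt.1 (hR _ hxK i.succ)).1.le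
  have hmp := PiLp.volume_preserving_toLp (Fin (m + 1))
  have hme := (MeasurableEquiv.toLp 2 (Fin (m + 1) → ℝ)).measurableEmbedding
  have e1 : ∫ y in H, D y = ∫ x in Set.Icc a b, D (WithLp.toLp 2 x) := by
    rw [← hmp.setIntegral_preimage_emb hme]
    refine setIntegral_eq_of_subset_of_forall_sdiff_eq_zero (hmp.measurable hHc.measurableSet)
      (fun x hx => ha0 x hx) fun x hx => hD0 _ hx.1 fun h => hx.2 (hKI x hx.1 h)
  have hcont : ∀ i, ContinuousOn (fun x => f i (WithLp.toLp 2 x)) (Set.Icc a b) := fun i =>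
    (hf i).continuousOn.comp (PiLp.continuous_toLp 2 _).continuousOn ha0
  have hdiv := integral_divergence_of_hasFDerivAt_off_countable' a b hab
    (fun i x => f i (WithLp.toLp 2 x))
    (fun i x => (fderivWithin ℝ (f i) H (WithLp.toLp 2 x)).comp
      (PiLp.continuousLinearEquiv 2 ℝ fun _ : Fin (m + 1) => ℝ).symm.toContinuousLinearMap) ∅
    Set.countable_empty hcont
    (fun x hx i => by
      have hx0 : 0 < x 0 := (hx.1 0 (Set.mem_univ _)).1
      have h1 := (((hf i).differentiableOn one_ne_zero _
        (show WithLp.toLp 2 x ∈ H from hx0.le)).hasFDerivWithinAt).hasFDerivAt (hHi _ hx0)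
      exact h1.comp x
        (PiLp.continuousLinearEquiv 2 ℝ fun _ : Fin (m + 1) => ℝ).symm.hasFDerivAt)
    ((hmp.integrableOn_comp_preimage hme).2 hDi |>.mono_set ha0)
  rw [e1]
  refine hdiv.trans ?_
  have hface : ∀ i : Fin (m + 1), ∀ x : Fin (m + 1) → ℝ, WithLp.toLp 2 x ∈ H → |x i| = R →
      ∀ j, f j (WithLp.toLp 2 x) = 0 := fun i x hx hxi j =>
    h0 j _ hx fun h => (hR _ h i).ne hxi
  have hfront : ∀ i : Fin (m + 1), ∫ x in Set.Icc (a ∘ Fin.succAbove i) (b ∘ Fin.succAbove i),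
      f i (WithLp.toLp 2 (Fin.insertNth i (b i) x)) = 0 := by
    intro i
    refine setIntegral_eq_zero_of_forall_eq_zero fun x hx => hface i _ ?_ ?_ i
    · refine ha0 _ ?_
      rw [Fin.insertNth_mem_Icc]
      exact ⟨⟨hab i, le_rfl⟩, hx⟩
    · simp [hb, abs_of_pos hR0]
  have hback : ∀ i : Fin m, ∫ x in Set.Icc (a ∘ Fin.succAbove i.succ) (b ∘ Fin.succAbove i.succ),
      f i.succ (WithLp.toLp 2 (Fin.insertNth i.succ (a i.succ) x)) = 0 := by
    intro i
    refine setIntegral_eq_zero_of_forall_eq_zero fun x hx => hface i.succ _ ?_ ?_ i.succ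
    · refine ha0 _ ?_
      rw [Fin.insertNth_mem_Icc]
      exact ⟨⟨le_rfl, hab _⟩, hx⟩
    · simp [ha, abs_of_pos hR0]
  -- Only the face `y₀ = 0` survives; it is a lower face, hence the minus sign.
  simp only [hfront, zero_sub]
  rw [Fin.sum_univ_succ]
  simp only [hback, neg_zero, Finset.sum_const_zero, add_zero, neg_inj]
  have hmp' := PiLp.volume_preserving_toLp (Fin m)
  have hme' := (MeasurableEquiv.toLp 2 (Fin m → ℝ)).measurableEmbedding
  rw [← hmp'.integral_comp hme']
  rw [setIntegral_eq_integral_of_forall_compl_eq_zero]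
  · refine integral_congr_ae (Filter.Eventually.of_forall fun x => ?_)
    simp only [Fin.insertNth_zero']
    rfl
  · intro x hx
    refine h0 0 _ (by simp [ha]) fun h => hx ?_
    have h2 := hKI _ (by simp [ha, hH]) h
    rw [Fin.insertNth_mem_Icc] at h2
    exact h2.2

/-! ### The boundary hyperplane of the half space -/

section BoundaryEmbedding

variable {n : ℕ} [NeZero n]

variable (n) in
lemma one_add_pred : 1 + (n - 1) = n := Nat.add_sub_cancel' (NeZero.one_le (n := n))

/-- The indices of the tangential coordinates of a half space. -/
def bdryIdx (j : Fin (n - 1)) : Fin n := Fin.cast (one_add_pred n) (Fin.natAdd 1 j)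

lemma bdryIdx_ne_zero (j : Fin (n - 1)) : bdryIdx j ≠ 0 := by
  intro h
  have := congrArg Fin.val h
  simp [bdryIdx] at this

lemma bdryIdx_injective : Function.Injective (bdryIdx (n := n)) := by
  intro i j h
  simpa [bdryIdx] using h

lemma eq_zero_or_bdryIdx (i : Fin n) : i = 0 ∨ ∃ j, i = bdryIdx j := by
  obtain ⟨i, rfl⟩ : ∃ i', i = Fin.cast (one_add_pred n) i' :=
    ⟨Fin.cast (one_add_pred n).symm i, rfl⟩
  induction i using Fin.addCases with
  | left i => left; ext; simp
  | right i => exact Or.inr ⟨i, rfl⟩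

/-- The embedding of the boundary of a half space. -/
noncomputable def tailEmb : EuclideanSpace ℝ (Fin (n - 1)) →L[ℝ] EuclideanSpace ℝ (Fin n) :=
  ∑ j, (EuclideanSpace.proj (𝕜 := ℝ) j).smulRight (EuclideanSpace.single (bdryIdx j) 1)

/-- The projection onto the boundary of a half space. -/
noncomputable def tailProj : EuclideanSpace ℝ (Fin n) →L[ℝ] EuclideanSpace ℝ (Fin (n - 1)) :=
  ∑ j, (EuclideanSpace.proj (𝕜 := ℝ) (bdryIdx j)).smulRight (EuclideanSpace.single j 1)

lemma tailEmb_apply (w : EuclideanSpace ℝ (Fin (n - 1))) :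
    tailEmb w = ∑ j, w j • EuclideanSpace.single (bdryIdx j) (1 : ℝ) := by
  simp [tailEmb]

lemma tailEmb_zero (w : EuclideanSpace ℝ (Fin (n - 1))) : tailEmb w 0 = 0 := by
  simp [tailEmb_apply, (bdryIdx_ne_zero _).symm]

lemma tailEmb_bdryIdx (w : EuclideanSpace ℝ (Fin (n - 1))) (j : Fin (n - 1)) :
    tailEmb w (bdryIdx j) = w j := by
  simp [tailEmb_apply, Pi.single_apply, bdryIdx_injective.eq_iff]

lemma tailProj_apply (y : EuclideanSpace ℝ (Fin n)) (j : Fin (n - 1)) :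
    tailProj y j = y (bdryIdx j) := by
  simp [tailProj, Pi.single_apply]

lemma tailProj_tailEmb (w : EuclideanSpace ℝ (Fin (n - 1))) : tailProj (tailEmb w) = w := by
  ext j
  rw [tailProj_apply, tailEmb_bdryIdx]

lemma tailEmb_tailProj {y : EuclideanSpace ℝ (Fin n)} (hy : y 0 = 0) :
    tailEmb (tailProj y) = y := by
  ext i
  obtain rfl | ⟨j, rfl⟩ := eq_zero_or_bdryIdx i
  · rw [tailEmb_zero, hy]
  · rw [tailEmb_bdryIdx, tailProj_apply]

lemma tailEmb_single (j : Fin (n - 1)) :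
    tailEmb (EuclideanSpace.single j 1) = EuclideanSpace.single (bdryIdx j) (1 : ℝ) := by
  simp [tailEmb_apply, ite_smul]

/-- The divergence theorem for compactly supported vector fields on a half space. -/
lemma integral_halfSpace_divergence_tailEmb {f : Fin n → EuclideanSpace ℝ (Fin n) → ℝ}
    {K : Set (EuclideanSpace ℝ (Fin n))} (hK : IsCompact K)
    (hf : ∀ i, ContDiffOn ℝ 1 (f i) {y | 0 ≤ y 0})
    (h0 : ∀ i y, 0 ≤ y 0 → y ∉ K → f i y = 0) :
    ∫ y in {y : EuclideanSpace ℝ (Fin n) | 0 ≤ y 0},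
        ∑ i, fderivWithin ℝ (f i) {y | 0 ≤ y 0} y (EuclideanSpace.single i 1) =
      -∫ w : EuclideanSpace ℝ (Fin (n - 1)), f 0 (tailEmb w) := by
  obtain ⟨m, rfl⟩ : ∃ m, n = m + 1 := ⟨n - 1, (Nat.sub_add_cancel (NeZero.one_le (n := n))).symm⟩
  have h1 := integral_halfSpace_divergence hK hf h0
  have h2 : ∀ w : EuclideanSpace ℝ (Fin (m + 1 - 1)),
      tailEmb w = WithLp.toLp 2 (Fin.cons 0 (w : Fin m → ℝ) : Fin (m + 1) → ℝ) := by
    intro w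
    ext i
    obtain rfl | ⟨j, rfl⟩ := eq_zero_or_bdryIdx i
    · rw [tailEmb_zero]; rfl
    · rw [tailEmb_bdryIdx]
      have : bdryIdx j = Fin.succ (n := m) j := by ext; simp [bdryIdx]
      rw [this]
      rfl
  simp only [h2]
  exact h1

/-- A form of top degree on a family of vectors of which all but the first one are standard. -/
lemma ContinuousAlternatingMap.top_append_apply
    (α : EuclideanSpace ℝ (Fin n) [⋀^Fin n]→L[ℝ] ℝ) (ν : EuclideanSpace ℝ (Fin n)) :
    α (fun i => Fin.append (fun _ : Fin 1 => ν)
      (fun j : Fin (n - 1) => EuclideanSpace.single (bdryIdx j) (1 : ℝ))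
      (Fin.cast (one_add_pred n).symm i)) =
      ν 0 * α (fun i => EuclideanSpace.single i 1) := by
  have h1 : (fun i => Fin.append (fun _ : Fin 1 => ν)
      (fun j : Fin (n - 1) => EuclideanSpace.single (bdryIdx j) (1 : ℝ))
      (Fin.cast (one_add_pred n).symm i)) =
      Function.update (fun i => EuclideanSpace.single i (1 : ℝ)) 0 ν := by
    funext i
    obtain rfl | ⟨j, rfl⟩ := eq_zero_or_bdryIdx i
    · have : Fin.cast (one_add_pred n).symm 0 = Fin.castAdd (n - 1) (0 : Fin 1) := by ext; simp
      rw [this, Fin.append_left, Function.update_self]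
    · rw [Function.update_of_ne (bdryIdx_ne_zero j)]
      simp [bdryIdx]
  rw [h1]
  obtain ⟨L, h2⟩ : ∃ L : EuclideanSpace ℝ (Fin n) →ₗ[ℝ] ℝ, ∀ v,
      α (Function.update (fun i => EuclideanSpace.single i (1 : ℝ)) 0 v) = L v :=
    ⟨α.toMultilinearMap.toLinearMap (fun i => EuclideanSpace.single i (1 : ℝ)) 0, fun v => rfl⟩
  rw [h2]
  conv_lhs => rw [sum_coord_smul_single ν]
  rw [_root_.map_sum, Finset.sum_eq_single 0]
  · rw [_root_.map_smul, ← h2, Function.update_eq_self, smul_eq_mul]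
  · intro i _ hi
    have h3 : α (Function.update (fun i => EuclideanSpace.single i (1 : ℝ)) 0
        (EuclideanSpace.single i 1)) = 0 :=
      α.toAlternatingMap.map_update_self (fun i => EuclideanSpace.single i (1 : ℝ)) hi.symm
    rw [_root_.map_smul, ← h2, h3, smul_zero]
  · simp

end BoundaryEmbedding

/-! ### Local properties of the exterior derivative -/

section ExteriorDerivativeLocal

variable {m : ℕ} {H : Type*} [TopologicalSpace H]
  {I : ModelWithCorners ℝ (EuclideanSpace ℝ (Fin m)) H}
  {M : Type*} [TopologicalSpace M] [ChartedSpace H M] [IsManifold I ∞ M]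

lemma chartRep_extD_apply {k l : ℕ} (h : k + 1 = l) {η : DForm I M k} (hη : SmoothForm I η)
    {x₀ : M} {y : EuclideanSpace ℝ (Fin m)} (hy : y ∈ (extChartAt I x₀).target)
    (v : Fin l → EuclideanSpace ℝ (Fin m)) :
    chartRep I (extD I h η) x₀ y v = ∑ i : Fin l, (-1 : ℝ) ^ (i : ℕ) *
      fderivWithin ℝ (fun y' => chartRep I η x₀ y' fun j =>
        v (Fin.cast h ((Fin.cast h.symm i).succAbove j))) (Set.range I) y (v i) := by
  subst h
  rw [chartRep_extD I hη hy, extDerivWithin_apply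
    ((hη.contDiffWithinAt I hy).differentiableWithinAt (by simp))
    (uniqueDiffWithinAt_range_of_target I hy)]
  refine Finset.sum_congr rfl fun i _ => ?_
  rw [neg_one_pow_zsmul_real]
  rfl

lemma extD_eq_zero_of_notMem {k l : ℕ} (h : k + 1 = l) {η : DForm I M k} {K : Set M}
    (hK : IsClosed K) (hη : ∀ x ∉ K, η x = 0) {x : M} (hx : x ∉ K) : extD I h η x = 0 := by
  subst h
  have h1 : chartRep I η x =ᶠ[𝓝[Set.range I] (extChartAt I x x)] fun _ => 0 := by
    have h2 : (extChartAt I x).symm ⁻¹' Kᶜ ∈ 𝓝[Set.range I] (extChartAt I x x) := by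
      refine nhdsWithin_le_of_mem (extChartAt_target_mem_nhdsWithin x)
        (((continuousOn_extChartAt_symm (I := I) x) _
          (mem_extChartAt_target x)).preimage_mem_nhdsWithin (hK.isOpen_compl.mem_nhds ?_))
      rwa [extChartAt_to_inv]
    filter_upwards [h2] with y hy
    rw [chartRep, hη _ hy]
    rfl
  have h3 : extDerivWithin (chartRep I η x) (Set.range I) (extChartAt I x x) = 0 := by
    rw [h1.extDerivWithin_eq_of_mem (extChartAt_target_subset_range x (mem_extChartAt_target x)),
      extDerivWithin, fderivWithin_const_apply]
    exact map_zero (ContinuousAlternatingMap.alternatizeUncurryFinCLM ℝ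
      (EuclideanSpace ℝ (Fin m)) ℝ (n := k))
  change (extDerivWithin (chartRep I η x) (Set.range I)
    (extChartAt I x x)).compContinuousLinearMap _ = 0
  rw [h3]
  rfl

/-- The orientation sign is locally constant, so it can be treated as a constant factor under
derivatives. -/
lemma eventually_sign_chartRep {vol : DForm I M m} (hvol : OrientationForm I vol) {x₀ : M}
    {y : EuclideanSpace ℝ (Fin m)} (hy : y ∈ (extChartAt I x₀).target) :
    ∀ᶠ y' in 𝓝[Set.range I] y,
      Real.sign (chartRep I vol x₀ y' (fun i => EuclideanSpace.single i 1)) =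
        Real.sign (chartRep I vol x₀ y (fun i => EuclideanSpace.single i 1)) := by
  have hc : ContinuousWithinAt (fun y' => chartRep I vol x₀ y' fun i => EuclideanSpace.single i 1)
      (Set.range I) y :=
    (evalCLM _).continuous.continuousAt.comp_continuousWithinAt
      (hvol.smooth.contDiffWithinAt I hy).continuousWithinAt
  rcases lt_or_gt_of_ne (hvol.ne_zero x₀ y hy) with h | h
  · filter_upwards [hc.eventually_lt continuousWithinAt_const h] with y' hy'
    rw [Real.sign_of_neg h, Real.sign_of_neg hy']
  · filter_upwards [continuousWithinAt_const.eventually_lt hc h] with y' hy'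
    rw [Real.sign_of_pos h, Real.sign_of_pos hy']

end ExteriorDerivativeLocal

/-! ### Stokes' theorem in one chart -/

section StokesChart

variable {n : ℕ} [NeZero n]
  {Z : Type*} [TopologicalSpace Z] [ChartedSpace (EuclideanHalfSpace n) Z]
  [IsManifold (𝓡∂ n) ∞ Z]

/-- Stokes' theorem in a chart. -/
lemma integral_chartDensity_extD (h : n - 1 + 1 = n) {vol : DForm (𝓡∂ n) Z n}
    (hvol : OrientationForm (𝓡∂ n) vol) {η : DForm (𝓡∂ n) Z (n - 1)} (hη : SmoothForm (𝓡∂ n) η)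
    {x₁ : Z} {K : Set Z} (hK : IsCompact K) (hKs : K ⊆ (extChartAt (𝓡∂ n) x₁).source)
    (hηK : ∀ x ∉ K, η x = 0) :
    ∫ y in (extChartAt (𝓡∂ n) x₁).target, chartDensity (𝓡∂ n) vol (extD (𝓡∂ n) h η) x₁ y =
      ∫ w in tailEmb ⁻¹' (extChartAt (𝓡∂ n) x₁).target,
        -(Real.sign (chartRep (𝓡∂ n) vol x₁ (tailEmb w) (fun i => EuclideanSpace.single i 1)) *
          chartRep (𝓡∂ n) η x₁ (tailEmb w) (fun j => EuclideanSpace.single (bdryIdx j) 1)) := by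
  set T := (extChartAt (𝓡∂ n) x₁).target with hT
  have hTH : T ⊆ {y | 0 ≤ y 0} := by
    rw [← range_modelWithCornersEuclideanHalfSpace]
    exact extChartAt_target_subset_range x₁
  set K' := extChartAt (𝓡∂ n) x₁ '' K with hK'
  have hK'c : IsCompact K' := isCompact_image_extChartAt hK hKs
  have hηK' : ∀ y ∈ T, y ∉ K' → chartRep (𝓡∂ n) η x₁ y = 0 := by
    intro y hy hyK
    rw [chartRep, hηK _ fun h => hyK ⟨_, h, (extChartAt (𝓡∂ n) x₁).right_inv hy⟩]
    rfl
  let rem (i : Fin n) (j : Fin (n - 1)) : EuclideanSpace ℝ (Fin n) :=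
    EuclideanSpace.single (Fin.cast h ((Fin.cast h.symm i).succAbove j)) 1
  -- The vector field whose divergence is the density of `dη`, extended by zero from the chart to
  -- the whole half space.
  let f (i : Fin n) : EuclideanSpace ℝ (Fin n) → ℝ := T.indicator fun y =>
    ((-1 : ℝ) ^ (i : ℕ) *
      Real.sign (chartRep (𝓡∂ n) vol x₁ y (fun i => EuclideanSpace.single i 1))) *
        chartRep (𝓡∂ n) η x₁ y (rem i)
  have hf0 : ∀ i y, y ∉ K' → f i y = 0 := by
    intro i y hyK
    by_cases hy : y ∈ T
    · simp [f, Set.indicator_of_mem hy, hηK' y hy hyK]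
    · simp [f, Set.indicator_of_notMem hy]
  have hf_out : ∀ i y, y ∉ K' → f i =ᶠ[𝓝[{y | 0 ≤ y 0}] y] fun _ => 0 := by
    intro i y hyK
    filter_upwards [nhdsWithin_le_nhds (hK'c.isClosed.isOpen_compl.mem_nhds hyK)] with z hz
    exact hf0 i z hz
  have hf_in : ∀ i, ∀ y ∈ T, f i =ᶠ[𝓝[{y | 0 ≤ y 0}] y] fun y' =>
      ((-1 : ℝ) ^ (i : ℕ) *
        Real.sign (chartRep (𝓡∂ n) vol x₁ y (fun i => EuclideanSpace.single i 1))) *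
        chartRep (𝓡∂ n) η x₁ y' (rem i) := by
    intro i y hy
    rw [← range_modelWithCornersEuclideanHalfSpace]
    filter_upwards [extChartAt_target_mem_nhdsWithin_of_mem hy,
      eventually_sign_chartRep hvol hy] with z hz hz'
    simp only [f]
    rw [Set.indicator_of_mem (show z ∈ T from hz), hz']
  have hKT : K' ⊆ T := by
    rintro _ ⟨x, hx, rfl⟩
    exact (extChartAt (𝓡∂ n) x₁).map_source (hKs hx)
  have hHu : ∀ y ∈ T, UniqueDiffWithinAt ℝ {y : EuclideanSpace ℝ (Fin n) | 0 ≤ y 0} y := by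
    intro y hy
    rw [← range_modelWithCornersEuclideanHalfSpace]
    exact uniqueDiffWithinAt_range_of_target (𝓡∂ n) hy
  have hcomp : ∀ i, ∀ y ∈ T, ContDiffWithinAt ℝ ∞ (fun y' => chartRep (𝓡∂ n) η x₁ y' (rem i))
      {y | 0 ≤ y 0} y := by
    intro i y hy
    rw [← range_modelWithCornersEuclideanHalfSpace]
    exact (evalCLM (rem i)).contDiff.contDiffAt.comp_contDiffWithinAt y (hη.contDiffWithinAt _ hy)
  -- At points of `K'` the field is locally a constant sign times a smooth component; off `K'` it
  -- vanishes nearby. So the extension by zero is of class `C¹`.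
  have hfs : ∀ i, ContDiffOn ℝ 1 (f i) {y | 0 ≤ y 0} := by
    intro i y hy
    by_cases hyK : y ∈ K'
    · have hyT := hKT hyK
      exact ((contDiffWithinAt_const.mul ((hcomp i y hyT).of_le (by simp))).congr_of_eventuallyEq
        (hf_in i y hyT) ((hf_in i y hyT).eq_of_nhdsWithin hy))
    · exact contDiffWithinAt_const.congr_of_eventuallyEq (hf_out i y hyK) (hf0 i y hyK)
  have hdiv := integral_halfSpace_divergence_tailEmb hK'c hfs fun i y _ hyK => hf0 i y hyK
  have hHm : MeasurableSet {y : EuclideanSpace ℝ (Fin n) | 0 ≤ y 0} := by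
    rw [← range_modelWithCornersEuclideanHalfSpace]
    exact (𝓡∂ n).isClosed_range.measurableSet
  have e1 : ∫ y in {y : EuclideanSpace ℝ (Fin n) | 0 ≤ y 0},
        ∑ i, fderivWithin ℝ (f i) {y | 0 ≤ y 0} y (EuclideanSpace.single i 1) =
      ∫ y in T, chartDensity (𝓡∂ n) vol (extD (𝓡∂ n) h η) x₁ y := by
    rw [setIntegral_eq_of_subset_of_forall_sdiff_eq_zero hHm hTH]
    · refine setIntegral_congr_fun (measurableSet_target x₁) fun y hy => ?_
      rw [chartDensity, chartRep_extD_apply h hη hy, Finset.mul_sum]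
      refine Finset.sum_congr rfl fun i _ => ?_
      rw [(hf_in i y hy).fderivWithin_eq ((hf_in i y hy).eq_of_nhdsWithin (hTH hy)),
        fderivWithin_const_mul (hHu y hy) ((hcomp i y hy).differentiableWithinAt (by simp)),
        range_modelWithCornersEuclideanHalfSpace]
      simp only [smul_apply, smul_eq_mul, rem]
      ring
    · intro y hy
      refine Finset.sum_eq_zero fun i _ => ?_
      have hyK : y ∉ K' := fun h => hy.2 (hKT h)
      rw [(hf_out i y hyK).fderivWithin_eq (hf0 i y hyK), fderivWithin_const_apply]
      rfl
  rw [← e1, hdiv, integral_neg]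
  congr 1
  have hrem : rem 0 = fun j => EuclideanSpace.single (bdryIdx j) 1 := by
    funext j
    simp only [rem]
    congr 1
    ext
    simp [bdryIdx, add_comm]
  have hm : MeasurableSet (tailEmb ⁻¹' T) :=
    tailEmb.continuous.measurable (measurableSet_target (I := 𝓡∂ n) x₁)
  rw [← integral_indicator hm]
  refine integral_congr_ae (Filter.Eventually.of_forall fun w => ?_)
  by_cases hw : tailEmb w ∈ T
  · rw [Set.indicator_of_mem (show w ∈ tailEmb ⁻¹' T from hw)]
    simp only [f, Set.indicator_of_mem hw, hrem]
    simp
  · rw [Set.indicator_of_notMem (show w ∉ tailEmb ⁻¹' T from hw)]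
    simp only [f, Set.indicator_of_notMem hw]

end StokesChart

/-! ### Stokes' theorem on the manifold -/

namespace RiemannianDomain

variable {n : ℕ} [NeZero n]
  {Z : Type*} [TopologicalSpace Z] [ChartedSpace (EuclideanHalfSpace n) Z]
  [IsManifold (𝓡∂ n) ∞ Z]
  {B : Type*} [TopologicalSpace B] [ChartedSpace (EuclideanSpace ℝ (Fin (n - 1))) B]
  (X : RiemannianDomain n Z B)

/-- The inverse of the inclusion of the boundary. -/
noncomputable def inclInv [Nonempty B] (x : Z) : B := Function.invFun X.incl x

lemma inclInv_incl [Nonempty B] (b : B) : X.inclInv (X.incl b) = b :=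
  Function.leftInverse_invFun X.incl_embedding.injective b

lemma exists_incl_eq {x₁ : Z} {w : EuclideanSpace ℝ (Fin (n - 1))}
    (hw : tailEmb w ∈ (extChartAt (𝓡∂ n) x₁).target) :
    ∃ b, X.incl b = (extChartAt (𝓡∂ n) x₁).symm (tailEmb w) := by
  have h1 : (extChartAt (𝓡∂ n) x₁).symm (tailEmb w) ∈ (𝓡∂ n).boundary Z := by
    rw [mem_boundary_iff_extChartAt ((extChartAt (𝓡∂ n) x₁).map_target hw),
      (extChartAt (𝓡∂ n) x₁).right_inv hw, tailEmb_zero]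
  rwa [← X.range_incl] at h1

variable [IsManifold (𝓡 (n - 1)) ∞ B]

lemma tailEmb_tailProj_bdryD {b₀ : B} {x₁ : Z} {y : EuclideanSpace ℝ (Fin (n - 1))}
    (hy : y ∈ X.bdryDomain b₀ x₁) (v : EuclideanSpace ℝ (Fin (n - 1))) :
    tailEmb ((tailProj.comp (X.bdryD b₀ x₁ y)) v) = X.bdryD b₀ x₁ y v :=
  tailEmb_tailProj (X.bdryD_zero hy v)

/-- The density of the restriction of a form to the boundary. -/
lemma chartDensity_bdryVol (η : DForm (𝓡∂ n) Z (n - 1)) {b₀ : B} {x₁ : Z}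
    {y : EuclideanSpace ℝ (Fin (n - 1))} (hy : y ∈ X.bdryDomain b₀ x₁) :
    chartDensity (𝓡 (n - 1)) X.bdryVol (X.restrict η) b₀ y =
      |(tailProj.comp (X.bdryD b₀ x₁ y)).det| *
      -(Real.sign (chartRep (𝓡∂ n) X.vol x₁ (X.bdryCoord b₀ x₁ y)
          (fun i => EuclideanSpace.single i 1)) *
        chartRep (𝓡∂ n) η x₁ (X.bdryCoord b₀ x₁ y)
          (fun j => EuclideanSpace.single (bdryIdx j) 1)) := by
  set L := tailProj.comp (X.bdryD b₀ x₁ y) with hL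
  set c := X.bdryCoord b₀ x₁ y with hc
  have h1 : chartRep (𝓡 (n - 1)) (X.restrict η) b₀ y (fun i => EuclideanSpace.single i 1) =
      L.det * chartRep (𝓡∂ n) η x₁ c (fun j => EuclideanSpace.single (bdryIdx j) 1) := by
    rw [X.chartRep_restrict η hy]
    have := ContinuousAlternatingMap.top_comp_apply
      ((chartRep (𝓡∂ n) η x₁ c).compContinuousLinearMap tailEmb) L
    simp only [ContinuousAlternatingMap.compContinuousLinearMap_apply, Function.comp_def,
      tailEmb_single, hL, X.tailEmb_tailProj_bdryD hy] at this
    exact this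
  have h2 : chartRep (𝓡 (n - 1)) X.bdryVol b₀ y (fun i => EuclideanSpace.single i 1) =
      L.det * (X.normalCoord x₁ c 0 *
        chartRep (𝓡∂ n) X.vol x₁ c (fun i => EuclideanSpace.single i 1)) := by
    rw [X.chartRep_bdryVol hy]
    have := ContinuousAlternatingMap.top_comp_apply
      ((contract (one_add_pred n) (fun _ : Fin 1 => X.normalCoord x₁ c)
        (chartRep (𝓡∂ n) X.vol x₁ c)).compContinuousLinearMap tailEmb) L
    simp only [ContinuousAlternatingMap.compContinuousLinearMap_apply, Function.comp_def,
      tailEmb_single, hL, X.tailEmb_tailProj_bdryD hy, contract_apply] at this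
    rw [ContinuousAlternatingMap.top_append_apply] at this
    exact this
  -- The normal inserted in `vol` has negative coordinate of index `0`; this reverses the coordinate
  -- orientation of the boundary and matches the minus sign in the half-space formula.
  have hneg := X.normalCoord_zero_neg (X.bdryCoord_mem hy)
  rw [chartDensity, h1, h2, Real.sign_mul_mul]
  congr 1
  rw [← neg_mul]
  congr 1
  rw [← hc] at hneg
  simp only [Real.sign_eq_mul_inv_abs, abs_mul, mul_inv, abs_of_neg hneg, inv_neg]
  have h3 := mul_inv_cancel₀ hneg.ne
  linear_combination (-chartRep (𝓡∂ n) X.vol x₁ c (fun i => EuclideanSpace.single i 1) *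
    |chartRep (𝓡∂ n) X.vol x₁ c (fun i => EuclideanSpace.single i 1)|⁻¹) * h3

variable [T2Space Z] [CompactSpace Z] [T2Space B] [CompactSpace B]

/-- The chart computation leaves an integral over the part of the hyperplane `y₀ = 0` in the target.
This hyperplane parametrises the boundary inside the chart, so `integralForm_eq_of_param` identifies
it with the boundary integral, the densities being matched by `chartDensity_bdryVol`. -/
lemma stokes_of_chart (h : n - 1 + 1 = n) {η : DForm (𝓡∂ n) Z (n - 1)}
    (hη : SmoothForm (𝓡∂ n) η) {x₁ : Z} {K : Set Z} (hK : IsCompact K)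
    (hKs : K ⊆ (extChartAt (𝓡∂ n) x₁).source) (hηK : ∀ x ∉ K, η x = 0) :
    integralForm (𝓡∂ n) X.vol (extD (𝓡∂ n) h η) =
      integralForm (𝓡 (n - 1)) X.bdryVol (X.restrict η) := by
  rw [integralForm_eq_chart X.orientationForm (hη.extD h) hK hKs
    (fun x hx => extD_eq_zero_of_notMem h hK.isClosed hηK hx),
    integral_chartDensity_extD h X.orientationForm hη hK hKs hηK]
  symm
  -- The map `inclInv` needs a point of `B`. If there is none, no chart target meets `y₀ = 0` and
  -- both sides vanish.
  rcases isEmpty_or_nonempty B with hB | hB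
  · have h1 : tailEmb ⁻¹' (extChartAt (𝓡∂ n) x₁).target = ∅ := by
      refine Set.eq_empty_of_forall_notMem fun w hw => ?_
      obtain ⟨b, -⟩ := X.exists_incl_eq hw
      exact hB.false b
    rw [h1, setIntegral_empty, integralForm_eq_sum, Finset.sum_eq_zero]
    intro b
    exact hB.elim b
  set S := tailEmb ⁻¹' (extChartAt (𝓡∂ n) x₁).target with hS
  set Θ : EuclideanSpace ℝ (Fin (n - 1)) → B :=
    fun w => X.inclInv ((extChartAt (𝓡∂ n) x₁).symm (tailEmb w)) with hΘ
  have hinclΘ : ∀ w ∈ S, X.incl (Θ w) = (extChartAt (𝓡∂ n) x₁).symm (tailEmb w) := by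
    intro w hw
    obtain ⟨b, hb⟩ := X.exists_incl_eq hw
    simp only [hΘ, ← hb, X.inclInv_incl]
  have himg : Θ '' S = X.incl ⁻¹' (extChartAt (𝓡∂ n) x₁).source := by
    ext b
    constructor
    · rintro ⟨w, hw, rfl⟩
      rw [Set.mem_preimage, hinclΘ w hw]
      exact (extChartAt (𝓡∂ n) x₁).map_target hw
    · intro hb
      have h1 := (mem_boundary_iff_extChartAt hb).1 (X.incl_mem_boundary b)
      have h2 := tailEmb_tailProj h1
      refine ⟨tailProj (extChartAt (𝓡∂ n) x₁ (X.incl b)), ?_, ?_⟩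
      · rw [hS, Set.mem_preimage, h2]
        exact (extChartAt (𝓡∂ n) x₁).map_source hb
      · simp only [hΘ, h2, (extChartAt (𝓡∂ n) x₁).left_inv hb, X.inclInv_incl]
  have hSm : MeasurableSet S := tailEmb.continuous.measurable (measurableSet_target (I := 𝓡∂ n) x₁)
  have hdom : ∀ b₀, (extChartAt (𝓡 (n - 1)) b₀).target ∩
      (extChartAt (𝓡 (n - 1)) b₀).symm ⁻¹' (Θ '' S) = X.bdryDomain b₀ x₁ := by
    intro b₀
    rw [himg]
    rfl
  have hcS : ContinuousOn (fun w => (extChartAt (𝓡∂ n) x₁).symm (tailEmb w)) S :=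
    (continuousOn_extChartAt_symm x₁).comp tailEmb.continuous.continuousOn fun w hw => hw
  -- Continuity of the parametrisation uses that the inclusion is an embedding, so that it is
  -- detected in `Z`.
  have hΘc : ContinuousOn Θ S := by
    rw [X.incl_embedding.continuousOn_iff]
    exact hcS.congr hinclΘ
  refine integralForm_eq_of_param (Θ := Θ)
    (Φ := fun b => tailProj (extChartAt (𝓡∂ n) x₁ (X.incl b))) hSm
    (fun w hw => ?_) (fun b hb => ?_) _ (fun b₀ y => tailProj.comp (X.bdryD b₀ x₁ y)) ?_ ?_ ?_ ?_
  · simp only [hinclΘ w hw, (extChartAt (𝓡∂ n) x₁).right_inv hw, tailProj_tailEmb]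
  · rw [himg] at hb
    rw [restrict, hηK _ fun h => hb (hKs h)]
    rfl
  · intro b₀
    rw [hdom]
    exact (X.isOpen_bdryDomain b₀ x₁).measurableSet
  · intro b₀
    rw [hdom]
    intro y hy
    exact (tailProj.hasFDerivAt.comp y (X.hasFDerivAt_bdryCoord hy)).hasFDerivWithinAt
  · intro b₀
    rw [hdom]
    intro y hy
    have h1 : tailEmb (tailProj (extChartAt (𝓡∂ n) x₁ (X.incl ((extChartAt (𝓡 (n - 1)) b₀).symm y))))
        = X.bdryCoord b₀ x₁ y := tailEmb_tailProj (X.bdryCoord_zero hy)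
    rw [X.chartDensity_bdryVol η hy]
    simp only [h1]
  · intro b₀
    set K' := {w | tailEmb w ∈ extChartAt (𝓡∂ n) x₁ '' K} with hK'
    have hKT : extChartAt (𝓡∂ n) x₁ '' K ⊆ (extChartAt (𝓡∂ n) x₁).target := by
      rintro _ ⟨x, hx, rfl⟩
      exact (extChartAt (𝓡∂ n) x₁).map_source (hKs hx)
    have hKc : IsCompact (extChartAt (𝓡∂ n) x₁ '' K) := isCompact_image_extChartAt hK hKs
    have hK'c : IsCompact K' := by
      have h1 : IsClosed K' := hKc.isClosed.preimage tailEmb.continuous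
      refine (hKc.image tailProj.continuous).of_isClosed_subset h1 fun w hw => ?_
      exact ⟨_, hw, tailProj_tailEmb w⟩
    have hK'S : K' ⊆ S := fun w hw => hKT hw
    have hcont : ContinuousOn (fun w => chartPartition (𝓡 (n - 1)) B b₀ (Θ w) *
        -(Real.sign (chartRep (𝓡∂ n) X.vol x₁ (tailEmb w) (fun i => EuclideanSpace.single i 1)) *
          chartRep (𝓡∂ n) η x₁ (tailEmb w) (fun j => EuclideanSpace.single (bdryIdx j) 1))) S := by
      have hv : ContinuousOn (fun w => chartRep (𝓡∂ n) X.vol x₁ (tailEmb w)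
          (fun i => EuclideanSpace.single i 1)) S :=
        (evalCLM _).continuous.comp_continuousOn ((X.vol_smooth x₁).continuousOn.comp
          tailEmb.continuous.continuousOn fun w hw => hw)
      have he : ContinuousOn (fun w => chartRep (𝓡∂ n) η x₁ (tailEmb w)
          (fun j => EuclideanSpace.single (bdryIdx j) 1)) S :=
        (evalCLM _).continuous.comp_continuousOn ((hη x₁).continuousOn.comp
          tailEmb.continuous.continuousOn fun w hw => hw)
      simp only [Real.sign_eq_mul_inv_abs]
      refine ((chartPartition (𝓡 (n - 1)) B b₀).2.continuous.comp_continuousOn hΘc).mul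
        (((hv.mul (hv.abs.inv₀ fun w hw => ?_)).mul he).neg)
      exact abs_ne_zero.2 (X.orientationForm.ne_zero x₁ _ hw)
    refine IntegrableOn.of_forall_sdiff_eq_zero ((hcont.mono hK'S).integrableOn_compact hK'c) hSm
      fun w hw => ?_
    have h1 : chartRep (𝓡∂ n) η x₁ (tailEmb w) = 0 := by
      rw [chartRep, hηK _ fun h => hw.2 ⟨_, h, (extChartAt (𝓡∂ n) x₁).right_inv hw.1⟩]
      rfl
    rw [h1]
    simp

lemma restrict_sum {k : ℕ} {ι : Type*} (s : Finset ι) (η : ι → DForm (𝓡∂ n) Z k) :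
    X.restrict (∑ i ∈ s, η i) = ∑ i ∈ s, X.restrict (η i) := by
  let L : DForm (𝓡∂ n) Z k →+ DForm (𝓡 (n - 1)) B k :=
    { toFun := X.restrict, map_zero' := rfl, map_add' := fun _ _ => rfl }
  exact map_sum L η s

/-- Stokes' theorem. -/
theorem stokes (h : n - 1 + 1 = n) {η : DForm (𝓡∂ n) Z (n - 1)} (hη : SmoothForm (𝓡∂ n) η) :
    integralForm (𝓡∂ n) X.vol (extD (𝓡∂ n) h η) =
      integralForm (𝓡 (n - 1)) X.bdryVol (X.restrict η) := by
  let ηs (x₀ : Z) : DForm (𝓡∂ n) Z (n - 1) := fun x => chartPartition (𝓡∂ n) Z x₀ x • η x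
  have hs : ∀ x₀, SmoothForm (𝓡∂ n) (ηs x₀) := fun x₀ =>
    hη.fun_smul (chartPartition (𝓡∂ n) Z x₀).2
  have hsum : η = ∑ x₀ ∈ chartIndex (𝓡∂ n) Z, ηs x₀ := by
    ext1 x
    rw [Finset.sum_apply, ← Finset.sum_smul, sum_chartPartition, one_smul]
  rw [hsum, extD_sum h _ fun x₀ _ => hs x₀, X.restrict_sum,
    integralForm_sum X.orientationForm _ fun x₀ _ => (hs x₀).extD h,
    integralForm_sum X.orientationForm_bdry _ fun x₀ _ => X.smoothForm_restrict (hs x₀)]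
  refine Finset.sum_congr rfl fun x₀ _ => ?_
  refine X.stokes_of_chart h (hs x₀) (isClosed_tsupport (chartPartition (𝓡∂ n) Z x₀)).isCompact
    (tsupport_chartPartition_subset x₀) fun x hx => ?_
  have : chartPartition (𝓡∂ n) Z x₀ x = 0 := image_eq_zero_of_notMem_tsupport hx
  simp only [ηs, this, zero_smul]

end RiemannianDomain

/-! ### Fundamental lemmas of the calculus of variations -/

section TestForms

variable {m : ℕ} {H : Type*} [TopologicalSpace H]
  {I : ModelWithCorners ℝ (EuclideanSpace ℝ (Fin m)) H}
  {M : Type*} [TopologicalSpace M] [ChartedSpace H M] [IsManifold I ∞ M]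

/-- In a chart the coefficient is a quotient of components with nonvanishing denominator. -/
lemma OrientationForm.continuous_coeff {vol η : DForm I M m} (hvol : OrientationForm I vol)
    (hη : SmoothForm I η) {c : M → ℝ} (hc : ∀ x, η x = c x • vol x) : Continuous c := by
  refine continuous_iff_continuousAt.2 fun x₀ => ?_
  set e : Fin m → EuclideanSpace ℝ (Fin m) := fun i => EuclideanSpace.single i 1
  have h1 : ContinuousOn (fun y => chartRep I η x₀ y e / chartRep I vol x₀ y e)
      (extChartAt I x₀).target :=
    ((evalCLM e).continuous.comp_continuousOn (hη x₀).continuousOn).div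
      ((evalCLM e).continuous.comp_continuousOn (hvol.smooth x₀).continuousOn)
      fun y hy => hvol.ne_zero x₀ y hy
  have h2 : ContinuousOn (fun x => chartRep I η x₀ (extChartAt I x₀ x) e /
      chartRep I vol x₀ (extChartAt I x₀ x) e) (extChartAt I x₀).source :=
    h1.comp (continuousOn_extChartAt x₀) fun x hx => (extChartAt I x₀).map_source hx
  refine (h2.congr fun x hx => ?_).continuousAt (extChartAt_source_mem_nhds x₀)
  have h3 : chartRep I η x₀ (extChartAt I x₀ x) =
      c x • chartRep I vol x₀ (extChartAt I x₀ x) := by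
    have := chartRep_fun_smul I c vol x₀ (extChartAt I x₀ x)
    rw [← funext hc, (extChartAt I x₀).left_inv hx] at this
    exact this
  rw [h3, ContinuousAlternatingMap.smul_apply, smul_eq_mul, mul_div_cancel_right₀]
  exact hvol.ne_zero x₀ _ ((extChartAt I x₀).map_source hx)

/-- A form with constant coefficients in a chart, cut off outside this chart. -/
lemma smoothForm_cutoff {k : ℕ} {x₁ : M} {f : M → ℝ} (hf : ContMDiff I 𝓘(ℝ) ∞ f)
    (hfs : tsupport f ⊆ (extChartAt I x₁).source)
    (β : EuclideanSpace ℝ (Fin m) [⋀^Fin k]→L[ℝ] ℝ) :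
    SmoothForm I (fun x => f x • (β.compContinuousLinearMap (chartDinv I x₁ x) :
      TangentSpace I x [⋀^Fin k]→L[ℝ] ℝ)) := by
  intro x₀ y hy
  have hσ := (continuousOn_extChartAt_symm (I := I) x₀) y hy
  -- Inside the chart at `x₁` the coefficients are those of `β` pulled back by the transition map,
  -- times `f`. Outside it, `f` vanishes in a neighbourhood, since its closed support lies in the
  -- chart domain.
  by_cases hy' : (extChartAt I x₀).symm y ∈ (extChartAt I x₁).source
  · have hR := extChartAt_target_subset_range (I := I) x₀ hy
    have h1 : ContDiffWithinAt ℝ ∞ (fderivWithin ℝ (chartTrans I x₀ x₁) (Set.range I))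
        (Set.range I) y :=
      (contDiffWithinAt_chartTrans I hy hy').fderivWithin_right I.uniqueDiffOn (by simp) hR
    have h2 : ContDiffWithinAt ℝ ∞ (fun y => f ((extChartAt I x₀).symm y) •
        β.compContinuousLinearMap (fderivWithin ℝ (chartTrans I x₀ x₁) (Set.range I) y))
        (extChartAt I x₀).target y := by
      refine ((contDiffOn_comp_extChartAt_symm hf x₀) y hy).smul ?_
      have h3 := contDiffOn_univ.1 (ContDiffOn.form_comp (r := ∞) (s := Set.univ)
        (f := fun _ : EuclideanSpace ℝ (Fin m) →L[ℝ] EuclideanSpace ℝ (Fin m) => β)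
        contDiffOn_const contDiffOn_id)
      exact h3.comp_contDiffWithinAt (h1.mono (extChartAt_target_subset_range x₀))
    have h4 : ∀ y' ∈ (extChartAt I x₀).target ∩
        (extChartAt I x₀).symm ⁻¹' (extChartAt I x₁).source,
        chartRep I (fun x => f x • (β.compContinuousLinearMap (chartDinv I x₁ x) :
          TangentSpace I x [⋀^Fin k]→L[ℝ] ℝ)) x₀ y' = f ((extChartAt I x₀).symm y') •
        β.compContinuousLinearMap (fderivWithin ℝ (chartTrans I x₀ x₁) (Set.range I) y') := by
      intro y' hy'
      rw [← chartDinv_comp_chartD I hy'.1 hy'.2]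
      rfl
    refine h2.congr_of_eventuallyEq ?_ (h4 y ⟨hy, hy'⟩)
    filter_upwards [self_mem_nhdsWithin, hσ.preimage_mem_nhdsWithin
      ((isOpen_extChartAt_source (I := I) x₁).mem_nhds hy')] with y' h5 h6
    exact h4 y' ⟨h5, h6⟩
  · have h1 : ∀ y', (extChartAt I x₀).symm y' ∉ tsupport f →
        chartRep I (fun x => f x • (β.compContinuousLinearMap (chartDinv I x₁ x) :
          TangentSpace I x [⋀^Fin k]→L[ℝ] ℝ)) x₀ y' = 0 := by
      intro y' hy'
      rw [chartRep_fun_smul, image_eq_zero_of_notMem_tsupport hy', zero_smul]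
    refine (contDiffWithinAt_const (c := 0)).congr_of_eventuallyEq ?_ (h1 y fun h => hy' (hfs h))
    filter_upwards [hσ.preimage_mem_nhdsWithin ((isClosed_tsupport f).isOpen_compl.mem_nhds
      fun h => hy' (hfs h))] with y' h5
    exact h1 y' h5

variable {g : ∀ x : M, TangentSpace I x → TangentSpace I x → ℝ} {vol : DForm I M m}

/-- The fundamental lemma of the calculus of variations, on a compact manifold. -/
lemma eq_zero_of_forall_integralForm_wedge [T2Space M] [CompactSpace M]
    (H : ∀ x, IsVolumeForm (g x) (vol x)) (hg : SmoothMetric I g)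
    (hvol : OrientationForm I vol) {k l : ℕ} (h : k + l = m) {ζ : DForm I M k}
    (hζ : SmoothForm I ζ) (h0 : ∀ w : DForm I M l, SmoothForm I w →
      integralForm I vol (wedgeForm I h ζ w) = 0) : ζ = 0 := by
  -- The test form is `∗ζ`, for which `ζ ∧ ∗ζ = |ζ|² vol`.
  have hs := SmoothForm.hodge H hg hvol.smooth h hζ
  funext x
  refine (H x).eq_zero_of_formInner_self h ?_
  exact eq_zero_of_integralForm_eq_zero hvol (hζ.wedge h hs)
    (f := fun x => formInner h (someFrame m (g x)) (ζ x) (ζ x))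
    (fun x => formInner_self_nonneg h _ _) (fun x => (H x).wedge_hodge h _ _) (h0 _ hs) x

end TestForms

namespace RiemannianDomain

variable {n : ℕ} [NeZero n]
  {Z : Type*} [TopologicalSpace Z] [ChartedSpace (EuclideanHalfSpace n) Z]
  [IsManifold (𝓡∂ n) ∞ Z] [T2Space Z] [CompactSpace Z]
  {B : Type*} [TopologicalSpace B] [ChartedSpace (EuclideanSpace ℝ (Fin (n - 1))) B]
  (X : RiemannianDomain n Z B)

/-- The fundamental lemma of the calculus of variations, for variations which vanish on the
boundary. -/
lemma eq_zero_of_forall_pair {k l : ℕ} (h : k + l = n) {ζ : DForm (𝓡∂ n) Z k}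
    (hζ : SmoothForm (𝓡∂ n) ζ) (h0 : ∀ w : DForm (𝓡∂ n) Z l, SmoothForm (𝓡∂ n) w →
      X.restrict w = 0 → X.pair h ζ w = 0) : ζ = 0 := by
  have hs := SmoothForm.hodge X.isVolumeForm X.smoothMetric X.vol_smooth h hζ
  have hO : IsOpen ((𝓡∂ n).boundary Z)ᶜ :=
    ((𝓡∂ n).isClosed_boundary (M := Z) (n := ∞) (by simp)).isOpen_compl
  -- The function `f` is nonnegative and nonzero exactly off the boundary. The test form `f ∗ζ` is
  -- thus admissible and still detects `ζ` at all interior points.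
  obtain ⟨f, hf1, hf2, hf3⟩ := hO.exists_contMDiff_support_eq (n := ⊤) (𝓡∂ n)
  have hfz : ∀ b, f (X.incl b) = 0 := fun b => by
    by_contra hb
    have : X.incl b ∈ Function.support f := hb
    rw [hf1] at this
    exact this (X.incl_mem_boundary b)
  set w : DForm (𝓡∂ n) Z l := fun x => f x • hodge h (X.metric x) (X.vol x) (ζ x) with hw
  have hws : SmoothForm (𝓡∂ n) w := hs.fun_smul hf2
  have hwr : X.restrict w = 0 := by
    funext b
    simp only [restrict, hw, hfz, zero_smul]
    rfl
  have h1 : ∀ x, wedgeForm (𝓡∂ n) h ζ w x =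
      (f x * formInner h (someFrame n (X.metric x)) (ζ x) (ζ x)) • X.vol x := fun x => by
    rw [wedgeForm, wedge_smul_right, (X.isVolumeForm x).wedge_hodge, mul_smul]
  have h2 := eq_zero_of_integralForm_eq_zero X.orientationForm (hζ.wedge h hws)
    (fun x => mul_nonneg (hf3 x) (formInner_self_nonneg h _ _)) h1 (h0 w hws hwr)
  have h3 : ∀ x ∉ (𝓡∂ n).boundary Z, ζ x = 0 := fun x hx => by
    refine (X.isVolumeForm x).eq_zero_of_formInner_self h ((mul_eq_zero.1 (h2 x)).resolve_left ?_)
    rw [← Set.mem_compl_iff, ← hf1] at hx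
    exact hx
  funext x
  refine form_ext_at (I := 𝓡∂ n) (η := ζ) (η' := 0) ?_
  -- Vanishing extends to the boundary by continuity, interior points of the target being dense in
  -- it.
  have h4 : Set.EqOn (chartRep (𝓡∂ n) ζ x) (chartRep (𝓡∂ n) 0 x)
      (interior (extChartAt (𝓡∂ n) x).target) := by
    intro y hy
    have hy1 := interior_subset hy
    have hy2 : (extChartAt (𝓡∂ n) x).symm y ∉ (𝓡∂ n).boundary Z := by
      rw [mem_boundary_iff_extChartAt ((extChartAt (𝓡∂ n) x).map_target hy1),
        (extChartAt (𝓡∂ n) x).right_inv hy1]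
      have := interior_mono (extChartAt_target_subset_range x) hy
      rw [interior_range_modelWithCornersEuclideanHalfSpace] at this
      exact ne_of_gt this
    rw [chartRep, h3 _ hy2]
    rfl
  exact h4.of_subset_closure (hζ x).continuousOn
    (smoothForm_zero (I := 𝓡∂ n) (M := Z) x).continuousOn interior_subset
    extChartAt_target_subset_closure_interior (mem_extChartAt_target x)

variable [IsManifold (𝓡 (n - 1)) ∞ B] [T2Space B] [CompactSpace B]

/-- The fundamental lemma of the calculus of variations, for the boundary values of forms. -/
lemma eq_zero_of_forall_pairB_restrict {k l : ℕ} (h : k + l = n - 1) {ζ : DForm (𝓡 (n - 1)) B k}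
    (hζ : SmoothForm (𝓡 (n - 1)) ζ) (h0 : ∀ w : DForm (𝓡∂ n) Z l, SmoothForm (𝓡∂ n) w →
      X.pairB h ζ (X.restrict w) = 0) : ζ = 0 := by
  funext b
  by_contra hb
  set x₁ := X.incl b with hx₁
  have H := X.isVolumeForm_bdry
  let A : EuclideanSpace ℝ (Fin (n - 1)) →ₗ[ℝ] EuclideanSpace ℝ (Fin n) :=
    ((chartDinv (𝓡∂ n) x₁ x₁).comp (X.dincl b)).toLinearMap
  have hA : Function.Injective A :=
    (chartDinv_bijective (𝓡∂ n) (mem_extChartAt_source x₁)).1.comp (X.incl_immersion b)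
  -- A left inverse of the differential of the inclusion extends the covector `∗ζ` at `b` to the
  -- coordinate space of `Z`. With constant coefficients and a cutoff it becomes a smooth form `w₀`
  -- on `Z` restricting to `∗ζ` at `b`.
  obtain ⟨L, hL⟩ := A.exists_leftInverse_of_injective
    (LinearMap.ker_eq_bot.2 hA)
  let β : EuclideanSpace ℝ (Fin n) [⋀^Fin l]→L[ℝ] ℝ :=
    (hodge h (X.bdryMetric b) (X.bdryVol b) (ζ b)).compContinuousLinearMap
      (LinearMap.toContinuousLinearMap L)
  let f : SmoothBumpFunction (𝓡∂ n) x₁ :=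
    (inferInstance : Nonempty (SmoothBumpFunction (𝓡∂ n) x₁)).some
  set w₀ : DForm (𝓡∂ n) Z l := fun x => f x • (β.compContinuousLinearMap (chartDinv (𝓡∂ n) x₁ x) :
      TangentSpace (𝓡∂ n) x [⋀^Fin l]→L[ℝ] ℝ) with hw₀
  have hw₀s : SmoothForm (𝓡∂ n) w₀ :=
    smoothForm_cutoff f.contMDiff f.tsupport_subset_extChartAt_source β
  have hwb : X.restrict w₀ b = hodge h (X.bdryMetric b) (X.bdryVol b) (ζ b) := by
    ext v
    have hf1 : f (X.incl b) = 1 := f.eq_one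
    simp only [restrict, hw₀, hf1, one_smul]
    change (hodge h (X.bdryMetric b) (X.bdryVol b) (ζ b)) (fun i => L (A (v i))) = _
    congr 1
    funext i
    exact LinearMap.congr_fun hL (v i)
  -- the coefficient of `ζ ∧ w₀`
  set c : B → ℝ := fun b => (-1 : ℝ) ^ (l * k) * formInner h (someFrame (n - 1) (X.bdryMetric b))
    (ζ b) (hodge ((add_comm l k).trans h) (X.bdryMetric b) (X.bdryVol b) (X.restrict w₀ b)) with hc
  have hcw : ∀ b, wedgeForm (𝓡 (n - 1)) h ζ (X.restrict w₀) b = c b • X.bdryVol b := by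
    intro b
    simp only [hc]
    rw [mul_smul, ← (H b).wedge_hodge h, (H b).hodge_hodge, wedge_smul_right, smul_smul, ← mul_pow]
    simp [wedgeForm]
  have hcc : Continuous c := X.orientationForm_bdry.continuous_coeff
    (hζ.wedge h (X.smoothForm_restrict hw₀s)) hcw
  have hcb : 0 < c b := by
    have h1 : c b = formInner h (someFrame (n - 1) (X.bdryMetric b)) (ζ b) (ζ b) := by
      have h2 : ∀ (a : ℝ) (α β : TangentSpace (𝓡 (n - 1)) b [⋀^Fin k]→L[ℝ] ℝ),
          formInner h (someFrame (n - 1) (X.bdryMetric b)) α (a • β) =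
            a * formInner h (someFrame (n - 1) (X.bdryMetric b)) α β := by
        intro a α β
        simp only [formInner, ContinuousAlternatingMap.smul_apply, smul_eq_mul, mul_left_comm _ a,
          ← Finset.mul_sum]
      simp only [hc]
      rw [hwb, (H b).hodge_hodge, h2, mul_comm l k, ← mul_assoc, ← mul_pow]
      simp
    rw [h1]
    exact lt_of_le_of_ne (formInner_self_nonneg h _ _)
      fun h2 => hb ((H b).eq_zero_of_formInner_self h h2.symm)
  -- The coefficient `c` of `ζ ∧ w₀` is `|ζ|² > 0` at `b` but has no sign elsewhere. As the boundary
  -- carries the subspace topology, `{c > 0}` is the trace of an open set `V` of `Z`; a factor `φ`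
  -- supported in `V` makes the integrand nonnegative.
  obtain ⟨V, hV, hVU⟩ := X.incl_embedding.isInducing.isOpen_iff.1 (isOpen_lt continuous_const hcc)
  obtain ⟨φ, hφ1, hφ2, hφ3⟩ := hV.exists_contMDiff_support_eq (n := ⊤) (𝓡∂ n)
  have h1 := eq_zero_of_integralForm_eq_zero X.orientationForm_bdry
    (hζ.wedge h (X.smoothForm_restrict (hw₀s.fun_smul hφ2)))
    (f := fun b => φ (X.incl b) * c b) (fun b' => ?_) (fun b' => ?_)
    (h0 _ (hw₀s.fun_smul hφ2)) b
  · have h2 : b ∈ X.incl ⁻¹' V := by rw [hVU]; exact hcb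
    rw [Set.mem_preimage, ← hφ1] at h2
    exact (mul_ne_zero h2 hcb.ne') h1
  · by_cases h2 : X.incl b' ∈ V
    · have h3 : b' ∈ X.incl ⁻¹' V := h2
      rw [hVU] at h3
      exact mul_nonneg (hφ3 _) (le_of_lt h3)
    · rw [← hφ1, Function.notMem_support] at h2
      rw [h2, zero_mul]
  · rw [mul_smul, ← hcw b', wedgeForm, wedgeForm, ← wedge_smul_right]
    rfl

end RiemannianDomain

/-! ### Affine families and linearity of the wedge -/

section FormAlgebra

variable {m : ℕ} {H : Type*} [TopologicalSpace H]
  {I : ModelWithCorners ℝ (EuclideanSpace ℝ (Fin m)) H}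
  {M : Type*} [TopologicalSpace M] [ChartedSpace H M]

lemma SmoothForm.sub {k : ℕ} {η η' : DForm I M k} (hη : SmoothForm I η) (hη' : SmoothForm I η') :
    SmoothForm I (η - η') := fun x₀ => (hη x₀).sub (hη' x₀)

lemma wedgeForm_add_left {k l j : ℕ} (h : k + l = j) (α α' : DForm I M k) (β : DForm I M l) :
    wedgeForm I h (α + α') β = wedgeForm I h α β + wedgeForm I h α' β :=
  funext fun _ => wedge_add_left h _ _ _

lemma wedgeForm_smul_left {k l j : ℕ} (h : k + l = j) (c : ℝ) (α : DForm I M k)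
    (β : DForm I M l) : wedgeForm I h (c • α) β = c • wedgeForm I h α β :=
  funext fun _ => wedge_smul_left h _ _ _

lemma wedgeForm_smul_right {k l j : ℕ} (h : k + l = j) (c : ℝ) (α : DForm I M k)
    (β : DForm I M l) : wedgeForm I h α (c • β) = c • wedgeForm I h α β :=
  funext fun _ => wedge_smul_right h _ _ _

lemma wedgeForm_comm {k l j : ℕ} (h : k + l = j) (h' : l + k = j) (α : DForm I M k)
    (β : DForm I M l) : wedgeForm I h α β = (-1 : ℝ) ^ (k * l) • wedgeForm I h' β α :=
  funext fun _ => wedge_comm h h' _ _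

lemma form_neg_smul {k : ℕ} (c : ℝ) (η : DForm I M k) : (-c) • η = -(c • η) := by
  funext x
  ext v
  exact neg_mul c (η x v)

lemma SmoothCurve.line {k : ℕ} {η w : DForm I M k} (hη : SmoothForm I η) (hw : SmoothForm I w) :
    SmoothCurve I Set.univ (fun s => η + s • w) :=
  (hη.curve _).add fun x₀ => contDiffOn_fst.smul (hw.curve Set.univ x₀)

variable [IsManifold I ∞ M]

lemma timeDeriv_line {k : ℕ} (η w : DForm I M k) (t : ℝ) :
    timeDeriv I (fun s => η + s • w) t = w :=
  timeDeriv_eq fun x => by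
    let η' : EuclideanSpace ℝ (Fin m) [⋀^Fin k]→L[ℝ] ℝ := η x
    let w' : EuclideanSpace ℝ (Fin m) [⋀^Fin k]→L[ℝ] ℝ := w x
    have := ((hasDerivAt_id t).smul_const w').const_add η'
    rwa [one_smul] at this

lemma timeDeriv_congr {k : ℕ} {η η' : ℝ → DForm I M k} {J : Set ℝ} (hJ : IsOpen J)
    (h : ∀ t ∈ J, η t = η' t) {t : ℝ} (ht : t ∈ J) : timeDeriv I η t = timeDeriv I η' t := by
  funext x
  refine Filter.EventuallyEq.deriv_eq (F := EuclideanSpace ℝ (Fin m) [⋀^Fin k]→L[ℝ] ℝ) ?_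
  filter_upwards [hJ.mem_nhds ht] with s hs
  rw [h s hs]

lemma extD_wedgeForm {k l j j' : ℕ} (h : k + l = j) (hj : j + 1 = j') (h1 : k + 1 + l = j')
    (h2 : k + (l + 1) = j') {η : DForm I M k} {η' : DForm I M l} (hη : SmoothForm I η)
    (hη' : SmoothForm I η') :
    extD I hj (wedgeForm I h η η') = wedgeForm I h1 (extD I rfl η) η' +
      (-1 : ℝ) ^ k • wedgeForm I h2 η (extD I rfl η') := by
  subst hj
  exact extD_wedge h h1 h2 hη hη'

end FormAlgebra

/-! ### Stars, pairings and integration by parts -/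

namespace RiemannianDomain

variable {n : ℕ} [NeZero n]
  {Z : Type*} [TopologicalSpace Z] [ChartedSpace (EuclideanHalfSpace n) Z]
  [IsManifold (𝓡∂ n) ∞ Z]
  {B : Type*} [TopologicalSpace B] [ChartedSpace (EuclideanSpace ℝ (Fin (n - 1))) B]
  (X : RiemannianDomain n Z B)

lemma smoothForm_star {k l : ℕ} (h : k + l = n) {η : DForm (𝓡∂ n) Z k}
    (hη : SmoothForm (𝓡∂ n) η) : SmoothForm (𝓡∂ n) (X.star h η) :=
  SmoothForm.hodge X.isVolumeForm X.smoothMetric X.vol_smooth h hη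

lemma smoothCurve_star {k l : ℕ} (h : k + l = n) {J : Set ℝ} {η : ℝ → DForm (𝓡∂ n) Z k}
    (hη : SmoothCurve (𝓡∂ n) J η) : SmoothCurve (𝓡∂ n) J (fun t => X.star h (η t)) :=
  SmoothCurve.hodge X.isVolumeForm X.smoothMetric X.vol_smooth h hη

lemma star_add {k l : ℕ} (h : k + l = n) (η η' : DForm (𝓡∂ n) Z k) :
    X.star h (η + η') = X.star h η + X.star h η' := funext fun _ => hodge_add h _ _

lemma star_smul {k l : ℕ} (h : k + l = n) (c : ℝ) (η : DForm (𝓡∂ n) Z k) :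
    X.star h (c • η) = c • X.star h η := funext fun _ => hodge_smul h _ _

lemma star_neg {k l : ℕ} (h : k + l = n) (η : DForm (𝓡∂ n) Z k) :
    X.star h (-η) = -X.star h η :=
  funext fun x => map_neg (hodgeLin h (X.metric x) (X.vol x)) (η x)

lemma star_zero {k l : ℕ} (h : k + l = n) : X.star h (0 : DForm (𝓡∂ n) Z k) = 0 :=
  funext fun x => map_zero (hodgeLin h (X.metric x) (X.vol x))

lemma star_star {k l : ℕ} (h : k + l = n) (h' : l + k = n) (η : DForm (𝓡∂ n) Z k) :
    X.star h' (X.star h η) = (-1 : ℝ) ^ (k * l) • η :=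
  funext fun x => (X.isVolumeForm x).hodge_hodge h h' (η x)

lemma star_injective {k l : ℕ} (h : k + l = n) :
    Function.Injective (X.star (k := k) (l := l) h) := fun _ _ hη =>
  funext fun x => (X.isVolumeForm x).hodge_injective h (congrFun hη x)

lemma wedgeForm_star_comm {k l : ℕ} (h : k + l = n) (α β : DForm (𝓡∂ n) Z k) :
    wedgeForm (𝓡∂ n) h α (X.star h β) = wedgeForm (𝓡∂ n) h β (X.star h α) :=
  funext fun x => (X.isVolumeForm x).wedge_hodge_comm h _ _

lemma wedgeForm_star_star {k l : ℕ} (h : k + l = n) (h' : l + k = n) (α : DForm (𝓡∂ n) Z k)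
    (β : DForm (𝓡∂ n) Z l) :
    wedgeForm (𝓡∂ n) h' (X.star h α) (X.star h' β) = wedgeForm (𝓡∂ n) h α β :=
  funext fun x => (X.isVolumeForm x).wedge_hodge_hodge h h' _ _

lemma timeDeriv_star {k l : ℕ} (h : k + l = n) {J : Set ℝ} {η : ℝ → DForm (𝓡∂ n) Z k}
    (hη : SmoothCurve (𝓡∂ n) J η) (hJ : IsOpen J) {t : ℝ} (ht : t ∈ J) :
    timeDeriv (𝓡∂ n) (fun s => X.star h (η s)) t = X.star h (timeDeriv (𝓡∂ n) η t) :=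
  timeDeriv_linear (I' := 𝓡∂ n) id (fun x => hodgeLin h (X.metric x) (X.vol x)) hη hJ ht

lemma timeDeriv_restrict [IsManifold (𝓡 (n - 1)) ∞ B] {k : ℕ} {J : Set ℝ}
    {η : ℝ → DForm (𝓡∂ n) Z k}
    (hη : SmoothCurve (𝓡∂ n) J η) (hJ : IsOpen J) {t : ℝ} (ht : t ∈ J) :
    timeDeriv (𝓡 (n - 1)) (fun s => X.restrict (η s)) t = X.restrict (timeDeriv (𝓡∂ n) η t) :=
  timeDeriv_linear (I' := 𝓡 (n - 1)) X.incl
    (fun x => ⟨⟨fun α => α.compContinuousLinearMap (X.dincl x), fun _ _ => rfl⟩,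
      fun _ _ => rfl⟩) hη hJ ht

section BoundaryStar

variable [IsManifold (𝓡 (n - 1)) ∞ B]

lemma smoothForm_starB {k l : ℕ} (h : k + l = n - 1) {η : DForm (𝓡 (n - 1)) B k}
    (hη : SmoothForm (𝓡 (n - 1)) η) : SmoothForm (𝓡 (n - 1)) (X.starB h η) :=
  SmoothForm.hodge X.isVolumeForm_bdry X.smoothMetric_bdry X.smoothForm_bdryVol h hη

lemma starB_add {k l : ℕ} (h : k + l = n - 1) (η η' : DForm (𝓡 (n - 1)) B k) :
    X.starB h (η + η') = X.starB h η + X.starB h η' := funext fun _ => hodge_add h _ _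

lemma starB_smul {k l : ℕ} (h : k + l = n - 1) (c : ℝ) (η : DForm (𝓡 (n - 1)) B k) :
    X.starB h (c • η) = c • X.starB h η := funext fun _ => hodge_smul h _ _

lemma starB_neg {k l : ℕ} (h : k + l = n - 1) (η : DForm (𝓡 (n - 1)) B k) :
    X.starB h (-η) = -X.starB h η :=
  funext fun x => map_neg (hodgeLin h (X.bdryMetric x) (X.bdryVol x)) (η x)

lemma starB_zero {k l : ℕ} (h : k + l = n - 1) :
    X.starB h (0 : DForm (𝓡 (n - 1)) B k) = 0 :=
  funext fun x => map_zero (hodgeLin h (X.bdryMetric x) (X.bdryVol x))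

lemma starB_starB {k l : ℕ} (h : k + l = n - 1) (h' : l + k = n - 1)
    (η : DForm (𝓡 (n - 1)) B k) : X.starB h' (X.starB h η) = (-1 : ℝ) ^ (k * l) • η :=
  funext fun x => (X.isVolumeForm_bdry x).hodge_hodge h h' (η x)

lemma starB_injective {k l : ℕ} (h : k + l = n - 1) :
    Function.Injective (X.starB (k := k) (l := l) h) := fun _ _ hη =>
  funext fun x => (X.isVolumeForm_bdry x).hodge_injective h (congrFun hη x)

lemma wedgeForm_starB_starB {k l : ℕ} (h : k + l = n - 1) (h' : l + k = n - 1)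
    (α : DForm (𝓡 (n - 1)) B k) (β : DForm (𝓡 (n - 1)) B l) :
    wedgeForm (𝓡 (n - 1)) h' (X.starB h α) (X.starB h' β) = wedgeForm (𝓡 (n - 1)) h α β :=
  funext fun x => (X.isVolumeForm_bdry x).wedge_hodge_hodge h h' _ _

end BoundaryStar

section Pairings

variable [T2Space Z] [CompactSpace Z]

lemma pair_add_left {k l : ℕ} (h : k + l = n) {α α' : DForm (𝓡∂ n) Z k} {β : DForm (𝓡∂ n) Z l}
    (hα : SmoothForm (𝓡∂ n) α) (hα' : SmoothForm (𝓡∂ n) α') (hβ : SmoothForm (𝓡∂ n) β) :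
    X.pair h (α + α') β = X.pair h α β + X.pair h α' β := by
  rw [pair, wedgeForm_add_left, integralForm_add X.orientationForm (hα.wedge h hβ)
    (hα'.wedge h hβ)]
  rfl

lemma pair_smul_left {k l : ℕ} (h : k + l = n) (c : ℝ) (α : DForm (𝓡∂ n) Z k)
    (β : DForm (𝓡∂ n) Z l) : X.pair h (c • α) β = c * X.pair h α β := by
  rw [pair, wedgeForm_smul_left, integralForm_smul]
  rfl

lemma pair_smul_right {k l : ℕ} (h : k + l = n) (c : ℝ) (α : DForm (𝓡∂ n) Z k)
    (β : DForm (𝓡∂ n) Z l) : X.pair h α (c • β) = c * X.pair h α β := by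
  rw [pair, wedgeForm_smul_right, integralForm_smul]
  rfl

lemma pair_neg_left {k l : ℕ} (h : k + l = n) (α : DForm (𝓡∂ n) Z k)
    (β : DForm (𝓡∂ n) Z l) : X.pair h (-α) β = -X.pair h α β := by
  rw [← neg_one_smul ℝ, pair_smul_left, neg_one_mul]

lemma pair_neg_right {k l : ℕ} (h : k + l = n) (α : DForm (𝓡∂ n) Z k)
    (β : DForm (𝓡∂ n) Z l) : X.pair h α (-β) = -X.pair h α β := by
  rw [← neg_one_smul ℝ, pair_smul_right, neg_one_mul]

lemma pair_zero_left {k l : ℕ} (h : k + l = n) (β : DForm (𝓡∂ n) Z l) :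
    X.pair h (0 : DForm (𝓡∂ n) Z k) β = 0 := by
  rw [← zero_smul ℝ (0 : DForm (𝓡∂ n) Z k), pair_smul_left, zero_mul]

lemma pair_zero_right {k l : ℕ} (h : k + l = n) (α : DForm (𝓡∂ n) Z k) :
    X.pair h α (0 : DForm (𝓡∂ n) Z l) = 0 := by
  rw [← zero_smul ℝ (0 : DForm (𝓡∂ n) Z l), pair_smul_right, zero_mul]

lemma pair_sub_left {k l : ℕ} (h : k + l = n) {α α' : DForm (𝓡∂ n) Z k} {β : DForm (𝓡∂ n) Z l}
    (hα : SmoothForm (𝓡∂ n) α) (hα' : SmoothForm (𝓡∂ n) α') (hβ : SmoothForm (𝓡∂ n) β) :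
    X.pair h (α - α') β = X.pair h α β - X.pair h α' β := by
  rw [sub_eq_add_neg, X.pair_add_left h hα hα'.neg hβ, pair_neg_left, sub_eq_add_neg]

lemma pair_comm {k l : ℕ} (h : k + l = n) (h' : l + k = n) (α : DForm (𝓡∂ n) Z k)
    (β : DForm (𝓡∂ n) Z l) : X.pair h α β = (-1 : ℝ) ^ (k * l) * X.pair h' β α := by
  rw [pair, wedgeForm_comm h h', integralForm_smul]
  rfl

lemma pair_star_comm {k l : ℕ} (h : k + l = n) (α β : DForm (𝓡∂ n) Z k) :
    X.pair h α (X.star h β) = X.pair h β (X.star h α) := by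
  rw [pair, pair, wedgeForm_star_comm]

lemma pair_star_star {k l : ℕ} (h : k + l = n) (h' : l + k = n) (α : DForm (𝓡∂ n) Z k)
    (β : DForm (𝓡∂ n) Z l) : X.pair h' (X.star h α) (X.star h' β) = X.pair h α β := by
  rw [pair, pair, wedgeForm_star_star]

lemma hasDerivAt_pair {k l : ℕ} (h : k + l = n) {J : Set ℝ} (hJ : IsOpen J)
    {η : ℝ → DForm (𝓡∂ n) Z k} {η' : ℝ → DForm (𝓡∂ n) Z l} (hη : SmoothCurve (𝓡∂ n) J η)
    (hη' : SmoothCurve (𝓡∂ n) J η') {t : ℝ} (ht : t ∈ J) :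
    HasDerivAt (fun s => X.pair h (η s) (η' s))
      (X.pair h (timeDeriv (𝓡∂ n) η t) (η' t) + X.pair h (η t) (timeDeriv (𝓡∂ n) η' t)) t := by
  have h1 := hasDerivAt_integralForm X.orientationForm hJ (hη.wedge h hη') ht
  rw [timeDeriv_wedge h hη hη' hJ ht, integralForm_add X.orientationForm
    (((hη.timeDeriv hJ).form ht).wedge h (hη'.form ht))
    ((hη.form ht).wedge h ((hη'.timeDeriv hJ).form ht))] at h1
  exact h1

lemma eq_zero_of_forall_pair_eq_zero {k l : ℕ} (h : k + l = n) {ζ : DForm (𝓡∂ n) Z k}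
    (hζ : SmoothForm (𝓡∂ n) ζ)
    (h0 : ∀ w : DForm (𝓡∂ n) Z l, SmoothForm (𝓡∂ n) w → X.pair h ζ w = 0) : ζ = 0 :=
  eq_zero_of_forall_integralForm_wedge X.isVolumeForm X.smoothMetric X.orientationForm h hζ h0

variable [IsManifold (𝓡 (n - 1)) ∞ B] [T2Space B] [CompactSpace B]

lemma pairB_add_left {k l : ℕ} (h : k + l = n - 1) {α α' : DForm (𝓡 (n - 1)) B k}
    {β : DForm (𝓡 (n - 1)) B l} (hα : SmoothForm (𝓡 (n - 1)) α)
    (hα' : SmoothForm (𝓡 (n - 1)) α') (hβ : SmoothForm (𝓡 (n - 1)) β) :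
    X.pairB h (α + α') β = X.pairB h α β + X.pairB h α' β := by
  rw [pairB, wedgeForm_add_left, integralForm_add X.orientationForm_bdry (hα.wedge h hβ)
    (hα'.wedge h hβ)]
  rfl

lemma pairB_smul_left {k l : ℕ} (h : k + l = n - 1) (c : ℝ) (α : DForm (𝓡 (n - 1)) B k)
    (β : DForm (𝓡 (n - 1)) B l) : X.pairB h (c • α) β = c * X.pairB h α β := by
  rw [pairB, wedgeForm_smul_left, integralForm_smul]
  rfl

lemma pairB_smul_right {k l : ℕ} (h : k + l = n - 1) (c : ℝ) (α : DForm (𝓡 (n - 1)) B k)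
    (β : DForm (𝓡 (n - 1)) B l) : X.pairB h α (c • β) = c * X.pairB h α β := by
  rw [pairB, wedgeForm_smul_right, integralForm_smul]
  rfl

lemma pairB_neg_left {k l : ℕ} (h : k + l = n - 1) (α : DForm (𝓡 (n - 1)) B k)
    (β : DForm (𝓡 (n - 1)) B l) : X.pairB h (-α) β = -X.pairB h α β := by
  rw [← neg_one_smul ℝ, pairB_smul_left, neg_one_mul]

lemma pairB_neg_right {k l : ℕ} (h : k + l = n - 1) (α : DForm (𝓡 (n - 1)) B k)
    (β : DForm (𝓡 (n - 1)) B l) : X.pairB h α (-β) = -X.pairB h α β := by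
  rw [← neg_one_smul ℝ, pairB_smul_right, neg_one_mul]

lemma pairB_zero_left {k l : ℕ} (h : k + l = n - 1) (β : DForm (𝓡 (n - 1)) B l) :
    X.pairB h (0 : DForm (𝓡 (n - 1)) B k) β = 0 := by
  rw [← zero_smul ℝ (0 : DForm (𝓡 (n - 1)) B k), pairB_smul_left, zero_mul]

lemma pairB_zero_right {k l : ℕ} (h : k + l = n - 1) (α : DForm (𝓡 (n - 1)) B k) :
    X.pairB h α (0 : DForm (𝓡 (n - 1)) B l) = 0 := by
  rw [← zero_smul ℝ (0 : DForm (𝓡 (n - 1)) B l), pairB_smul_right, zero_mul]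

lemma pairB_sub_left {k l : ℕ} (h : k + l = n - 1) {α α' : DForm (𝓡 (n - 1)) B k}
    {β : DForm (𝓡 (n - 1)) B l} (hα : SmoothForm (𝓡 (n - 1)) α)
    (hα' : SmoothForm (𝓡 (n - 1)) α') (hβ : SmoothForm (𝓡 (n - 1)) β) :
    X.pairB h (α - α') β = X.pairB h α β - X.pairB h α' β := by
  rw [sub_eq_add_neg, X.pairB_add_left h hα hα'.neg hβ, pairB_neg_left, sub_eq_add_neg]

lemma pairB_comm {k l : ℕ} (h : k + l = n - 1) (h' : l + k = n - 1) (α : DForm (𝓡 (n - 1)) B k)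
    (β : DForm (𝓡 (n - 1)) B l) : X.pairB h α β = (-1 : ℝ) ^ (k * l) * X.pairB h' β α := by
  rw [pairB, wedgeForm_comm h h', integralForm_smul]
  rfl

lemma pairB_sub_right {k l : ℕ} (h : k + l = n - 1) {α : DForm (𝓡 (n - 1)) B k}
    {β β' : DForm (𝓡 (n - 1)) B l} (hα : SmoothForm (𝓡 (n - 1)) α)
    (hβ : SmoothForm (𝓡 (n - 1)) β) (hβ' : SmoothForm (𝓡 (n - 1)) β') :
    X.pairB h α (β - β') = X.pairB h α β - X.pairB h α β' := by
  have h' : l + k = n - 1 := (add_comm l k).trans h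
  rw [X.pairB_comm h h', X.pairB_sub_left h' hβ hβ' hα, X.pairB_comm h h' α β,
    X.pairB_comm h h' α β', mul_sub]

lemma pairB_starB_starB {k l : ℕ} (h : k + l = n - 1) (h' : l + k = n - 1)
    (α : DForm (𝓡 (n - 1)) B k) (β : DForm (𝓡 (n - 1)) B l) :
    X.pairB h' (X.starB h α) (X.starB h' β) = X.pairB h α β := by
  rw [pairB, pairB, wedgeForm_starB_starB]

lemma eq_zero_of_forall_pairB_eq_zero {k l : ℕ} (h : k + l = n - 1) {ζ : DForm (𝓡 (n - 1)) B k}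
    (hζ : SmoothForm (𝓡 (n - 1)) ζ)
    (h0 : ∀ w : DForm (𝓡 (n - 1)) B l, SmoothForm (𝓡 (n - 1)) w → X.pairB h ζ w = 0) : ζ = 0 :=
  eq_zero_of_forall_integralForm_wedge X.isVolumeForm_bdry X.smoothMetric_bdry
    X.orientationForm_bdry h hζ h0

lemma restrict_wedgeForm {k l : ℕ} (h : k + l = n - 1) (α : DForm (𝓡∂ n) Z k)
    (β : DForm (𝓡∂ n) Z l) : X.restrict (wedgeForm (𝓡∂ n) h α β) =
      wedgeForm (𝓡 (n - 1)) h (X.restrict α) (X.restrict β) :=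
  funext fun _ => wedge_comp h _ _ _

/-- Integration by parts. -/
lemma pair_extD_left {k l k' l' : ℕ} (hk : k + 1 = k') (hl : l + 1 = l') (h1 : k' + l = n)
    (h2 : k + l' = n) (h3 : k + l = n - 1) {η : DForm (𝓡∂ n) Z k} {η' : DForm (𝓡∂ n) Z l}
    (hη : SmoothForm (𝓡∂ n) η) (hη' : SmoothForm (𝓡∂ n) η') :
    X.pair h1 (extD (𝓡∂ n) hk η) η' =
      X.pairB h3 (X.restrict η) (X.restrict η') -
        (-1 : ℝ) ^ k * X.pair h2 η (extD (𝓡∂ n) hl η') := by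
  subst hk hl
  have hn : n - 1 + 1 = n := by omega
  have h4 := X.stokes hn (hη.wedge h3 hη')
  rw [X.restrict_wedgeForm] at h4
  have h5 : extD (𝓡∂ n) hn (wedgeForm (𝓡∂ n) h3 η η') =
      wedgeForm (𝓡∂ n) h1 (extD (𝓡∂ n) rfl η) η' +
      (-1 : ℝ) ^ k • wedgeForm (𝓡∂ n) h2 η (extD (𝓡∂ n) rfl η') :=
    extD_wedgeForm h3 hn h1 h2 hη hη'
  rw [h5, integralForm_add X.orientationForm ((hη.extD rfl).wedge h1 hη')
    ((hη.wedge h2 (hη'.extD rfl)).const_smul _), integralForm_smul] at h4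
  rw [pair, pairB, pair]
  linarith

end Pairings

end RiemannianDomain

/-! ### Variational derivatives of the mixed potential and the Hamiltonian -/

namespace SystemData

variable {n : ℕ} [NeZero n]
  {Z : Type*} [TopologicalSpace Z] [ChartedSpace (EuclideanHalfSpace n) Z]
  [IsManifold (𝓡∂ n) ∞ Z]
  {B : Type*} [TopologicalSpace B] [ChartedSpace (EuclideanSpace ℝ (Fin (n - 1))) B]
  {X : RiemannianDomain n Z B} (S : SystemData X)

/-- The field `G` as an operator on forms. -/
noncomputable abbrev opG (η : DForm (𝓡∂ n) Z (n - S.p)) : DForm (𝓡∂ n) Z (n - S.p) := fun x => S.G x (η x)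

/-- The field `R` as an operator on forms. -/
noncomputable abbrev opR (η : DForm (𝓡∂ n) Z (n - S.q)) : DForm (𝓡∂ n) Z (n - S.q) := fun x => S.R x (η x)

variable [T2Space Z] [CompactSpace Z]

lemma pair_opG_comm (α β : DForm (𝓡∂ n) Z (n - S.p)) :
    X.pair S.np_p (S.opG α) (X.star S.np_p β) = X.pair S.np_p (S.opG β) (X.star S.np_p α) := by
  have : wedgeForm (𝓡∂ n) S.np_p (S.opG α) (X.star S.np_p β) =
      wedgeForm (𝓡∂ n) S.np_p α (X.star S.np_p (S.opG β)) := funext fun x => S.G_symm x _ _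
  rw [RiemannianDomain.pair, this, X.wedgeForm_star_comm]
  rfl

lemma pair_opR_comm (α β : DForm (𝓡∂ n) Z (n - S.q)) :
    X.pair S.nq_q (S.opR α) (X.star S.nq_q β) = X.pair S.nq_q (S.opR β) (X.star S.nq_q α) := by
  have : wedgeForm (𝓡∂ n) S.nq_q (S.opR α) (X.star S.nq_q β) =
      wedgeForm (𝓡∂ n) S.nq_q α (X.star S.nq_q (S.opR β)) := funext fun x => S.R_symm x _ _
  rw [RiemannianDomain.pair, this, X.wedgeForm_star_comm]
  rfl

lemma mixedPotential_eq {ep : DForm (𝓡∂ n) Z (n - S.p)} {eq : DForm (𝓡∂ n) Z (n - S.q)}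
    (hep : SmoothForm (𝓡∂ n) ep) (heq : SmoothForm (𝓡∂ n) eq) :
    S.mixedPotential ep eq = X.pair S.nq_q eq (extD (𝓡∂ n) S.np_succ ep) +
      1 / 2 * X.pair S.nq_q (S.opR eq) (X.star S.nq_q eq) -
      1 / 2 * X.pair S.np_p (S.opG ep) (X.star S.np_p ep) := by
  have h1 := heq.wedge S.nq_q (hep.extD S.np_succ)
  have h2 := ((heq.endo S.R_smooth).wedge S.nq_q
    (X.smoothForm_star S.nq_q heq)).const_smul (1 / 2 : ℝ)
  have h3 := ((hep.endo S.G_smooth).wedge S.np_p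
    (X.smoothForm_star S.np_p hep)).const_smul (1 / 2 : ℝ)
  rw [mixedPotential, sub_eq_add_neg, integralForm_add X.orientationForm (h1.add h2) h3.neg,
    integralForm_add X.orientationForm h1 h2, ← neg_one_smul ℝ, integralForm_smul,
    integralForm_smul, integralForm_smul]
  simp only [RiemannianDomain.pair]
  ring

section

variable {J : Set ℝ} {ep : ℝ → DForm (𝓡∂ n) Z (n - S.p)} {eq : ℝ → DForm (𝓡∂ n) Z (n - S.q)}
  {t : ℝ}

lemma timeDeriv_opG (hJ : IsOpen J) (hep : SmoothCurve (𝓡∂ n) J ep) (ht : t ∈ J) :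
    timeDeriv (𝓡∂ n) (fun s => S.opG (ep s)) t = S.opG (timeDeriv (𝓡∂ n) ep t) :=
  timeDeriv_linear (I' := 𝓡∂ n) id S.G hep hJ ht

lemma timeDeriv_opR (hJ : IsOpen J) (heq : SmoothCurve (𝓡∂ n) J eq) (ht : t ∈ J) :
    timeDeriv (𝓡∂ n) (fun s => S.opR (eq s)) t = S.opR (timeDeriv (𝓡∂ n) eq t) :=
  timeDeriv_linear (I' := 𝓡∂ n) id S.R heq hJ ht

/-- The two terms arising from each quadratic part coincide by `pair_opR_comm` and `pair_opG_comm`,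
which cancels the factors `1/2`. It is stated along arbitrary curves so as to serve both for
straight-line variations and for trajectories. -/
lemma hasDerivAt_mixedPotential_aux (hJ : IsOpen J) (hep : SmoothCurve (𝓡∂ n) J ep)
    (heq : SmoothCurve (𝓡∂ n) J eq) (ht : t ∈ J) :
    HasDerivAt (fun s => S.mixedPotential (ep s) (eq s))
      (X.pair S.nq_q (timeDeriv (𝓡∂ n) eq t) (extD (𝓡∂ n) S.np_succ (ep t)) +
        X.pair S.nq_q (eq t) (extD (𝓡∂ n) S.np_succ (timeDeriv (𝓡∂ n) ep t)) +
        X.pair S.nq_q (S.opR (eq t)) (X.star S.nq_q (timeDeriv (𝓡∂ n) eq t)) -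
        X.pair S.np_p (S.opG (ep t)) (X.star S.np_p (timeDeriv (𝓡∂ n) ep t))) t := by
  have h1 := X.hasDerivAt_pair S.nq_q hJ heq (hep.extD S.np_succ hJ) ht
  have h2 := X.hasDerivAt_pair S.nq_q hJ (heq.endo S.R_smooth) (X.smoothCurve_star S.nq_q heq) ht
  have h3 := X.hasDerivAt_pair S.np_p hJ (hep.endo S.G_smooth) (X.smoothCurve_star S.np_p hep) ht
  rw [timeDeriv_extD S.np_succ hep hJ ht] at h1
  rw [S.timeDeriv_opR hJ heq ht, X.timeDeriv_star S.nq_q heq hJ ht, S.pair_opR_comm] at h2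
  rw [S.timeDeriv_opG hJ hep ht, X.timeDeriv_star S.np_p hep hJ ht, S.pair_opG_comm] at h3
  have h4 := (h1.add (h2.const_mul (1 / 2))).sub (h3.const_mul (1 / 2))
  refine (h4.congr_of_eventuallyEq ?_).congr_deriv ?_
  · filter_upwards [hJ.mem_nhds ht] with s hs
    exact S.mixedPotential_eq (hep.form hs) (heq.form hs)
  · ring

end

/-- The variational derivative of the mixed potential. -/
noncomputable def gradP (ep : DForm (𝓡∂ n) Z (n - S.p)) (eq : DForm (𝓡∂ n) Z (n - S.q)) :
    S.Effort :=
  (-((-1 : ℝ) ^ (n - S.q) • extD (𝓡∂ n) S.nq_succ eq +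
      (-1 : ℝ) ^ (S.p * (n - S.p)) • X.star S.np_p (S.opG ep)),
    (-1 : ℝ) ^ (S.q * (n - S.q)) • (extD (𝓡∂ n) S.np_succ ep + X.star S.nq_q (S.opR eq)),
    (-1 : ℝ) ^ (n - S.q) • X.restrict eq, 0)

variable [IsManifold (𝓡 (n - 1)) ∞ B]

lemma smoothEffort_gradP {ep : DForm (𝓡∂ n) Z (n - S.p)} {eq : DForm (𝓡∂ n) Z (n - S.q)}
    (hep : SmoothForm (𝓡∂ n) ep) (heq : SmoothForm (𝓡∂ n) eq) :
    S.SmoothEffort (S.gradP ep eq) :=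
  ⟨(((heq.extD _).const_smul _).add
      ((X.smoothForm_star _ (hep.endo S.G_smooth)).const_smul _)).neg,
    ((hep.extD _).add (X.smoothForm_star _ (heq.endo S.R_smooth))).const_smul _,
    (X.smoothForm_restrict heq).const_smul _, smoothForm_zero⟩

variable [T2Space B] [CompactSpace B]

/-- Integration by parts turns `d e_q ∧ w_p` into `e_q ∧ d w_p` and a boundary term, which the third
component of `gradP` cancels. The remaining signs are those of graded commutativity. The fourth
component is zero because no derivative falls on `w_q`. -/
lemma pairEF_gradP {ep : DForm (𝓡∂ n) Z (n - S.p)} {eq : DForm (𝓡∂ n) Z (n - S.q)}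
    (hep : SmoothForm (𝓡∂ n) ep) (heq : SmoothForm (𝓡∂ n) eq)
    {wp : DForm (𝓡∂ n) Z (n - S.p)} {wq : DForm (𝓡∂ n) Z (n - S.q)}
    (hwp : SmoothForm (𝓡∂ n) wp) (hwq : SmoothForm (𝓡∂ n) wq) :
    S.pairEF (S.gradP ep eq) (wp, wq, X.restrict wp, X.restrict wq) =
      X.pair S.nq_q wq (extD (𝓡∂ n) S.np_succ ep) +
        X.pair S.nq_q eq (extD (𝓡∂ n) S.np_succ wp) +
        X.pair S.nq_q (S.opR eq) (X.star S.nq_q wq) -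
        X.pair S.np_p (S.opG ep) (X.star S.np_p wp) := by
  have h1 := X.pair_extD_left S.nq_succ S.np_succ S.p_np S.nq_q S.nq_np heq hwp
  have hR := heq.endo S.R_smooth
  have hG := hep.endo S.G_smooth
  have e1 : ((-1 : ℝ) ^ (n - S.q)) * (-1 : ℝ) ^ (n - S.q) = 1 := by
    rw [← mul_pow]; simp
  simp only [pairEF, gradP]
  rw [X.pair_neg_left, X.pair_add_left S.p_np ((heq.extD _).const_smul _)
      ((X.smoothForm_star _ hG).const_smul _) hwp, X.pair_smul_left, X.pair_smul_left,
    X.pair_smul_left, X.pair_add_left S.q_nq (hep.extD _) (X.smoothForm_star _ hR) hwq,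
    X.pairB_smul_left, X.pairB_zero_left, h1,
    X.pair_star_comm S.nq_q (S.opR eq) wq, X.pair_star_comm S.np_p (S.opG ep) wp,
    X.pair_comm S.nq_q S.q_nq wq, X.pair_comm S.nq_q S.q_nq wq,
    X.pair_comm S.np_p S.p_np wp, mul_comm (n - S.q) S.q, mul_comm (n - S.p) S.p]
  linear_combination (X.pair S.nq_q eq (extD (𝓡∂ n) S.np_succ wp)) * e1

/-- The first variation of the mixed potential along a curve. -/
lemma hasDerivAt_mixedPotential {J : Set ℝ} {ep : ℝ → DForm (𝓡∂ n) Z (n - S.p)}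
    {eq : ℝ → DForm (𝓡∂ n) Z (n - S.q)} {t : ℝ} (hJ : IsOpen J) (hep : SmoothCurve (𝓡∂ n) J ep)
    (heq : SmoothCurve (𝓡∂ n) J eq) (ht : t ∈ J) :
    HasDerivAt (fun s => S.mixedPotential (ep s) (eq s))
      (S.pairEF (S.gradP (ep t) (eq t)) (S.timeDerivU ep eq t)) t := by
  rw [timeDerivU, X.timeDeriv_restrict hep hJ ht, X.timeDeriv_restrict heq hJ ht,
    S.pairEF_gradP (hep.form ht) (heq.form ht) ((hep.timeDeriv hJ).form ht)
      ((heq.timeDeriv hJ).form ht)]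
  exact S.hasDerivAt_mixedPotential_aux hJ hep heq ht

lemma isVarDeriv_gradP {ep : DForm (𝓡∂ n) Z (n - S.p)} {eq : DForm (𝓡∂ n) Z (n - S.q)}
    (hep : SmoothForm (𝓡∂ n) ep) (heq : SmoothForm (𝓡∂ n) eq) :
    S.IsVarDeriv S.mixedPotential ep eq (S.gradP ep eq) := by
  refine ⟨S.smoothEffort_gradP hep heq, fun wp wq hwp hwq => ?_⟩
  rw [S.pairEF_gradP hep heq hwp hwq]
  have h1 := S.hasDerivAt_mixedPotential_aux isOpen_univ (SmoothCurve.line hep hwp)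
    (SmoothCurve.line heq hwq) (Set.mem_univ (0 : ℝ))
  simp only [timeDeriv_line, zero_smul, add_zero] at h1
  exact h1

/-- The boundary slots of a variation are not independent of the bulk slots. Variations with zero
restriction first determine the bulk components; with these removed, restrictions of arbitrary forms
determine the boundary components. -/
lemma effort_ext {δ δ' : S.Effort} (hδ : S.SmoothEffort δ) (hδ' : S.SmoothEffort δ')
    (h : ∀ wp wq, SmoothForm (𝓡∂ n) wp → SmoothForm (𝓡∂ n) wq →
      S.pairEF δ (wp, wq, X.restrict wp, X.restrict wq) =
        S.pairEF δ' (wp, wq, X.restrict wp, X.restrict wq)) : δ = δ' := by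
  have hr0 : ∀ k, X.restrict (0 : DForm (𝓡∂ n) Z k) = 0 := fun _ => rfl
  obtain ⟨δ₁, δ₂, δ₃, δ₄⟩ := δ
  obtain ⟨δ₁', δ₂', δ₃', δ₄'⟩ := δ'
  obtain ⟨h1, h2, h3, h4⟩ := hδ
  obtain ⟨h1', h2', h3', h4'⟩ := hδ'
  dsimp only at h1 h2 h3 h4 h1' h2' h3' h4'
  simp only [pairEF] at h
  have hp : ∀ w, SmoothForm (𝓡∂ n) w → X.pair S.p_np (δ₁ - δ₁') w +
      X.pairB S.nq_np (δ₃ - δ₃') (X.restrict w) = 0 := by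
    intro w hw
    have := h w 0 hw smoothForm_zero
    simp only [hr0, X.pair_zero_right, X.pairB_zero_right, add_zero] at this
    rw [X.pair_sub_left _ h1 h1' hw, X.pairB_sub_left _ h3 h3' (X.smoothForm_restrict hw)]
    linarith
  have hq : ∀ w, SmoothForm (𝓡∂ n) w → X.pair S.q_nq (δ₂ - δ₂') w +
      X.pairB S.np_nq (δ₄ - δ₄') (X.restrict w) = 0 := by
    intro w hw
    have := h 0 w smoothForm_zero hw
    simp only [hr0, X.pair_zero_right, X.pairB_zero_right, add_zero, zero_add] at this
    rw [X.pair_sub_left _ h2 h2' hw, X.pairB_sub_left _ h4 h4' (X.smoothForm_restrict hw)]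
    linarith
  have e1 : δ₁ - δ₁' = 0 := X.eq_zero_of_forall_pair S.p_np (h1.sub h1') fun w hw hr => by
    simpa [hr, X.pairB_zero_right] using hp w hw
  have e2 : δ₂ - δ₂' = 0 := X.eq_zero_of_forall_pair S.q_nq (h2.sub h2') fun w hw hr => by
    simpa [hr, X.pairB_zero_right] using hq w hw
  have e3 : δ₃ - δ₃' = 0 := X.eq_zero_of_forall_pairB_restrict S.nq_np (h3.sub h3') fun w hw => by
    simpa [e1, X.pair_zero_left] using hp w hw
  have e4 : δ₄ - δ₄' = 0 := X.eq_zero_of_forall_pairB_restrict S.np_nq (h4.sub h4') fun w hw => by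
    simpa [e2, X.pair_zero_left] using hq w hw
  rw [sub_eq_zero.1 e1, sub_eq_zero.1 e2, sub_eq_zero.1 e3, sub_eq_zero.1 e4]

lemma IsVarDeriv.unique {Φ : DForm (𝓡∂ n) Z (n - S.p) → DForm (𝓡∂ n) Z (n - S.q) → ℝ}
    {ep : DForm (𝓡∂ n) Z (n - S.p)} {eq : DForm (𝓡∂ n) Z (n - S.q)} {δ δ' : S.Effort}
    (h : S.IsVarDeriv Φ ep eq δ) (h' : S.IsVarDeriv Φ ep eq δ') : δ = δ' :=
  S.effort_ext h.1 h'.1 fun wp wq hwp hwq => (h.2 wp wq hwp hwq).unique (h'.2 wp wq hwp hwq)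

lemma varDerivP_eq {ep : DForm (𝓡∂ n) Z (n - S.p)} {eq : DForm (𝓡∂ n) Z (n - S.q)}
    (hep : SmoothForm (𝓡∂ n) ep) (heq : SmoothForm (𝓡∂ n) eq) :
    S.varDerivP ep eq = S.gradP ep eq :=
  IsVarDeriv.unique S (Classical.epsilon_spec (p := S.IsVarDeriv S.mixedPotential ep eq)
    ⟨_, S.isVarDeriv_gradP hep heq⟩) (S.isVarDeriv_gradP hep heq)

/-- By symmetry the derivative is `ε⁻¹ ⟨α_p | ∗w_p⟩ + μ⁻¹ ⟨α_q | ∗w_q⟩`. For `α_p = ∗ε e_p` and `α_q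
= ∗μ e_q`, `pair_star_star` removes both stars and the constants cancel. -/
lemma isVarDerivH_star {ep : DForm (𝓡∂ n) Z (n - S.p)} {eq : DForm (𝓡∂ n) Z (n - S.q)}
    (hep : SmoothForm (𝓡∂ n) ep) (heq : SmoothForm (𝓡∂ n) eq) :
    S.IsVarDerivH (X.star S.np_p (S.ε • ep)) (X.star S.nq_q (S.μ • eq)) (ep, eq) := by
  refine ⟨hep, heq, fun wp wq hwp hwq => ?_⟩
  have hp := X.smoothForm_star S.np_p (hep.const_smul S.ε)
  have hq := X.smoothForm_star S.nq_q (heq.const_smul S.μ)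
  have cp := SmoothCurve.line hp hwp
  have cq := SmoothCurve.line hq hwq
  have h1 := X.hasDerivAt_pair S.p_np isOpen_univ cp (X.smoothCurve_star S.p_np cp)
    (Set.mem_univ (0 : ℝ))
  have h2 := X.hasDerivAt_pair S.q_nq isOpen_univ cq (X.smoothCurve_star S.q_nq cq)
    (Set.mem_univ (0 : ℝ))
  rw [X.timeDeriv_star S.p_np cp isOpen_univ (Set.mem_univ _), timeDeriv_line, zero_smul, add_zero,
    X.pair_star_comm S.p_np wp, X.pair_star_star S.np_p S.p_np, X.pair_smul_left] at h1
  rw [X.timeDeriv_star S.q_nq cq isOpen_univ (Set.mem_univ _), timeDeriv_line, zero_smul, add_zero,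
    X.pair_star_comm S.q_nq wq, X.pair_star_star S.nq_q S.q_nq, X.pair_smul_left] at h2
  refine (((h1.const_mul S.ε⁻¹).add (h2.const_mul S.μ⁻¹)).const_mul (1 / 2)).congr_deriv ?_
  have hε := S.hε
  have hμ := S.hμ
  field_simp
  ring

lemma isVarDerivH_star_iff {ep : DForm (𝓡∂ n) Z (n - S.p)} {eq : DForm (𝓡∂ n) Z (n - S.q)}
    (hep : SmoothForm (𝓡∂ n) ep) (heq : SmoothForm (𝓡∂ n) eq)
    (δ : DForm (𝓡∂ n) Z (n - S.p) × DForm (𝓡∂ n) Z (n - S.q)) :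
    S.IsVarDerivH (X.star S.np_p (S.ε • ep)) (X.star S.nq_q (S.μ • eq)) δ ↔ δ = (ep, eq) := by
  refine ⟨fun h => ?_, fun h => h ▸ S.isVarDerivH_star hep heq⟩
  obtain ⟨δ₁, δ₂⟩ := δ
  obtain ⟨h1, h2, h3⟩ := h
  dsimp only at h1 h2
  have key := fun wp wq hwp hwq =>
    (h3 wp wq hwp hwq).unique ((S.isVarDerivH_star hep heq).2.2 wp wq hwp hwq)
  have e1 : δ₁ - ep = 0 := X.eq_zero_of_forall_pair_eq_zero S.np_p (h1.sub hep) fun w hw => by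
    have := key w 0 hw smoothForm_zero
    simp only [X.pair_zero_right, add_zero] at this
    rw [X.pair_sub_left _ h1 hep hw, this, sub_self]
  have e2 : δ₂ - eq = 0 := X.eq_zero_of_forall_pair_eq_zero S.nq_q (h2.sub heq) fun w hw => by
    have := key 0 w smoothForm_zero hw
    simp only [X.pair_zero_right, zero_add] at this
    rw [X.pair_sub_left _ h2 heq hw, this, sub_self]
  rw [sub_eq_zero.1 e1, sub_eq_zero.1 e2]

lemma varDerivH_star {ep : DForm (𝓡∂ n) Z (n - S.p)} {eq : DForm (𝓡∂ n) Z (n - S.q)}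
    (hep : SmoothForm (𝓡∂ n) ep) (heq : SmoothForm (𝓡∂ n) eq) :
    S.varDerivH (X.star S.np_p (S.ε • ep)) (X.star S.nq_q (S.μ • eq)) = (ep, eq) :=
  (S.isVarDerivH_star_iff hep heq _).1 (Classical.epsilon_spec
    (p := S.IsVarDerivH (X.star S.np_p (S.ε • ep)) (X.star S.nq_q (S.μ • eq)))
    ⟨_, S.isVarDerivH_star hep heq⟩)

end SystemData

/-! ### The Dirac structure -/

namespace SystemData

variable {n : ℕ} [NeZero n]
  {Z : Type*} [TopologicalSpace Z] [ChartedSpace (EuclideanHalfSpace n) Z]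
  [IsManifold (𝓡∂ n) ∞ Z]
  {B : Type*} [TopologicalSpace B] [ChartedSpace (EuclideanSpace ℝ (Fin (n - 1))) B]
  [IsManifold (𝓡 (n - 1)) ∞ B]
  {X : RiemannianDomain n Z B} (S : SystemData X)

lemma neg_one_pow_mul_self (k : ℕ) : (-1 : ℝ) ^ k * (-1 : ℝ) ^ k = 1 := by
  rw [← mul_pow]; simp

/-- The defect of the defining equations of the Dirac structure. -/
noncomputable def defect (x : S.Bond) : S.Effort :=
  (x.e.1 + (-1 : ℝ) ^ (S.p * (n - S.p)) • X.star S.np_p (S.ε • x.f.1),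
    x.e.2.1 + (-1 : ℝ) ^ (S.q * (n - S.q)) • X.star S.nq_q ((-S.μ) • x.f.2.1),
    x.e.2.2.1 + (-1 : ℝ) ^ ((n - S.p) * (n - S.q)) • X.starB S.np_nq x.eu, x.e.2.2.2)

lemma smoothEffort_defect {x : S.Bond} (hx : S.SmoothBond x) : S.SmoothEffort (S.defect x) := by
  obtain ⟨⟨f1, f2, f3, f4⟩, hy, ⟨e1, e2, e3, e4⟩, hu⟩ := hx
  exact ⟨e1.add ((X.smoothForm_star _ (f1.const_smul _)).const_smul _),
    e2.add ((X.smoothForm_star _ (f2.const_smul _)).const_smul _),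
    e3.add ((X.smoothForm_starB _ hu).const_smul _), e4⟩

/-- The signs placed in `defect` are those of `∗∗`, so its star is exactly the failure of the
defining equation; as the star is injective, the two vanish together. -/
lemma starE_defect (x : S.Bond) :
    S.starE (S.defect x) = S.starE x.e + S.opB x.eu + S.opA x.f := by
  have e1 := neg_one_pow_mul_self (S.p * (n - S.p))
  have e2 := neg_one_pow_mul_self (S.q * (n - S.q))
  have e3 := neg_one_pow_mul_self ((n - S.p) * (n - S.q))
  simp only [starE, defect, opB, opA, X.star_add, X.star_smul, X.starB_add, X.starB_smul,
    X.star_star S.np_p S.p_np, X.star_star S.nq_q S.q_nq, X.starB_starB S.np_nq S.nq_np,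
    smul_smul, Prod.mk_add_mk, add_zero, mul_comm (n - S.p) S.p, mul_comm (n - S.q) S.q]
  rw [mul_right_comm, e1, mul_right_comm, e2, e3, one_mul, one_mul, one_smul]

lemma starE_injective : Function.Injective S.starE := by
  rintro ⟨a1, a2, a3, a4⟩ ⟨b1, b2, b3, b4⟩ h
  simp only [starE, Prod.mk.injEq] at h
  rw [X.star_injective _ h.1, X.star_injective _ h.2.1, X.starB_injective _ h.2.2.1,
    X.starB_injective _ h.2.2.2]

lemma starE_zero : S.starE 0 = 0 := by
  simp only [starE, Prod.fst_zero, Prod.snd_zero, X.star_zero, X.starB_zero]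
  rfl

lemma mem_dirac_iff (x : S.Bond) : x ∈ S.dirac ↔ S.SmoothBond x ∧ S.defect x = 0 ∧
    x.fy = X.starB S.np_nq (S.opBT x.f) := by
  have : -S.opA x.f = S.starE x.e + S.opB x.eu ↔ S.defect x = 0 := by
    rw [← S.starE_injective.eq_iff, S.starE_zero, S.starE_defect, eq_comm, ← sub_eq_zero,
      sub_neg_eq_add]
  rw [dirac, Set.mem_ofPred_eq, this]

variable [T2Space Z] [CompactSpace Z] [T2Space B] [CompactSpace B]

lemma pairFE_starF_opA (f f' : S.Flow) : S.pairFE f' (S.starF (S.opA f)) =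
    X.pair S.np_p f'.1 (X.star S.np_p (S.ε • f.1)) +
      X.pair S.nq_q f'.2.1 (X.star S.nq_q ((-S.μ) • f.2.1)) := by
  simp only [pairFE, starF, opA, X.starB_zero, X.pairB_zero_right, add_zero]

/-- The same signs also account for graded commutativity: pairing the defect of `x` with the flow of
`y` reproduces the terms of the bilinear form in which `y` enters through its flow only, with `∗Bᵀf`
in place of the output. -/
lemma pairEF_defect {x y : S.Bond} (hx : S.SmoothBond x) (hy : S.SmoothBond y) :
    S.pairEF (S.defect x) y.f = S.pairEF x.e y.f + S.pairFE y.f (S.starF (S.opA x.f)) +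
      X.pairB S.np_nq x.eu (X.starB S.np_nq (S.opBT y.f)) := by
  obtain ⟨⟨f1, f2, f3, f4⟩, -, ⟨e1, e2, e3, e4⟩, hu⟩ := hx
  obtain ⟨⟨g1, g2, g3, g4⟩, -⟩ := hy
  rw [pairFE_starF_opA]
  simp only [pairEF, defect, opBT]
  rw [X.pair_add_left _ e1 ((X.smoothForm_star _ (f1.const_smul _)).const_smul _) g1,
    X.pair_add_left _ e2 ((X.smoothForm_star _ (f2.const_smul _)).const_smul _) g2,
    X.pairB_add_left _ e3 ((X.smoothForm_starB _ hu).const_smul _) g3, X.pair_smul_left,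
    X.pair_smul_left, X.pairB_smul_left, 
    ← X.pairB_starB_starB S.nq_np S.np_nq (X.starB S.np_nq x.eu),
    X.starB_starB, X.pairB_smul_left, X.pair_comm S.np_p S.p_np, X.pair_comm S.nq_q S.q_nq,
    mul_comm (n - S.p) S.p, mul_comm (n - S.q) S.q]
  linear_combination (X.pairB S.np_nq x.eu (X.starB S.np_nq y.f.2.2.1)) *
    neg_one_pow_mul_self ((n - S.p) * (n - S.q))

/-- Applying `pairEF_defect` to both orders splits the form into two halves. The half with the
defect of `y` vanishes, except that it carries `∗Bᵀf` of `x` where the form has the output of `x`.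
-/
lemma bilin_eq_of_mem_dirac {x y : S.Bond} (hx : S.SmoothBond x) (hy : y ∈ S.dirac) :
    S.bilin x y = S.pairEF (S.defect x) y.f +
      X.pairB S.np_nq y.eu (x.fy - X.starB S.np_nq (S.opBT x.f)) := by
  obtain ⟨hy0, hy1, hy2⟩ := (S.mem_dirac_iff y).1 hy
  have h1 := S.pairEF_defect hy0 hx
  have h0 : S.pairEF 0 x.f = 0 := by
    simp only [pairEF, Prod.fst_zero, Prod.snd_zero, X.pair_zero_left, X.pairB_zero_left, add_zero]
  rw [hy1, h0] at h1
  have hs : SmoothForm (𝓡 (n - 1)) (X.starB S.np_nq (S.opBT x.f)) :=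
    X.smoothForm_starB _ hx.1.2.2.1
  rw [S.pairEF_defect hx hy0, X.pairB_sub_right _ hy0.2.2.2 hx.2.1 hs, bilin, hy2]
  linarith

/-- There is an element of the Dirac structure with given flow and given input. -/
lemma exists_mem_dirac {f : S.Flow} (hf : S.SmoothFlow f) {u : DForm (𝓡 (n - 1)) B (n - S.p)}
    (hu : SmoothForm (𝓡 (n - 1)) u) : ∃ y ∈ S.dirac, y.f = f ∧ y.eu = u := by
  -- The defect is the effort plus a term depending only on flow and input, so the effort can be
  -- chosen to cancel that term.
  have h1 : S.SmoothEffort (S.defect ⟨f, 0, 0, u⟩) := S.smoothEffort_defect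
    ⟨hf, smoothForm_zero, ⟨smoothForm_zero, smoothForm_zero, smoothForm_zero, smoothForm_zero⟩, hu⟩
  refine ⟨⟨f, X.starB S.np_nq (S.opBT f), -S.defect ⟨f, 0, 0, u⟩, u⟩,
    (S.mem_dirac_iff _).2 ⟨⟨hf, X.smoothForm_starB _ hf.2.2.1,
      ⟨h1.1.neg, h1.2.1.neg, h1.2.2.1.neg, h1.2.2.2.neg⟩, hu⟩, ?_, rfl⟩, rfl, rfl⟩
  have h2 : ∀ e, S.defect ⟨f, X.starB S.np_nq (S.opBT f), e, u⟩ = e + S.defect ⟨f, 0, 0, u⟩ := by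
    rintro ⟨e1, e2, e3, e4⟩
    simp only [defect, Prod.mk_add_mk, Prod.fst_zero, Prod.snd_zero, zero_add, add_zero]
  rw [h2, neg_add_cancel]

lemma effort_eq_zero {e : S.Effort} (he : S.SmoothEffort e)
    (h : ∀ f, S.SmoothFlow f → S.pairEF e f = 0) : e = 0 := by
  obtain ⟨e1, e2, e3, e4⟩ := e
  obtain ⟨h1, h2, h3, h4⟩ := he
  simp only [pairEF] at h
  have z : ∀ k, SmoothForm (𝓡∂ n) (0 : DForm (𝓡∂ n) Z k) := fun _ => smoothForm_zero
  have z' : ∀ k, SmoothForm (𝓡 (n - 1)) (0 : DForm (𝓡 (n - 1)) B k) := fun _ => smoothForm_zero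
  have r1 : e1 = 0 := X.eq_zero_of_forall_pair_eq_zero S.p_np h1 fun w hw => by
    simpa [X.pair_zero_right, X.pairB_zero_right] using h (w, 0, 0, 0) ⟨hw, z _, z' _, z' _⟩
  have r2 : e2 = 0 := X.eq_zero_of_forall_pair_eq_zero S.q_nq h2 fun w hw => by
    simpa [X.pair_zero_right, X.pairB_zero_right] using h (0, w, 0, 0) ⟨z _, hw, z' _, z' _⟩
  have r3 : e3 = 0 := X.eq_zero_of_forall_pairB_eq_zero S.nq_np h3 fun w hw => by
    simpa [X.pair_zero_right, X.pairB_zero_right] using h (0, 0, w, 0) ⟨z _, z _, hw, z' _⟩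
  have r4 : e4 = 0 := X.eq_zero_of_forall_pairB_eq_zero S.np_nq h4 fun w hw => by
    simpa [X.pair_zero_right, X.pairB_zero_right] using h (0, 0, 0, w) ⟨z _, z _, z' _, hw⟩
  rw [r1, r2, r3, r4]
  rfl

/-- `𝒟` is a Dirac structure. -/
theorem dirac_eq_orthogonal : S.dirac = S.orthogonal S.dirac := by
  ext x
  rw [orthogonal, Set.mem_ofPred_eq]
  constructor
  · intro hx
    obtain ⟨h1, h2, h3⟩ := (S.mem_dirac_iff x).1 hx
    refine ⟨h1, fun y hy => ?_⟩
    rw [S.bilin_eq_of_mem_dirac h1 hy, h2, h3, sub_self, X.pairB_zero_right, add_zero]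
    simp only [pairEF, Prod.fst_zero, Prod.snd_zero, X.pair_zero_left, X.pairB_zero_left, add_zero]
  · rintro ⟨h1, h2⟩
    have hf0 : S.SmoothFlow 0 :=
      ⟨smoothForm_zero, smoothForm_zero, smoothForm_zero, smoothForm_zero⟩
    -- Flow and input of the test element range independently over all smooth forms; setting one of
    -- them to zero isolates each of the two conditions.
    have key : ∀ f u, S.SmoothFlow f → SmoothForm (𝓡 (n - 1)) u → S.pairEF (S.defect x) f +
        X.pairB S.np_nq u (x.fy - X.starB S.np_nq (S.opBT x.f)) = 0 := by
      intro f u hf hu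
      obtain ⟨y, hy, rfl, rfl⟩ := S.exists_mem_dirac hf hu
      rw [← S.bilin_eq_of_mem_dirac h1 hy, h2 y hy]
    refine (S.mem_dirac_iff x).2 ⟨h1, S.effort_eq_zero (S.smoothEffort_defect h1) fun f hf => ?_,
      sub_eq_zero.1 ?_⟩
    · simpa [X.pairB_zero_left] using key f 0 hf smoothForm_zero
    · refine X.eq_zero_of_forall_pairB_eq_zero S.nq_np
        (h1.2.1.sub (X.smoothForm_starB _ h1.1.2.2.1)) fun u hu => ?_
      have := key 0 u hf0 hu
      simp only [pairEF, Prod.fst_zero, Prod.snd_zero, X.pair_zero_right, X.pairB_zero_right,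
        add_zero, zero_add] at this
      rw [X.pairB_comm S.nq_np S.np_nq, this, mul_zero]

end SystemData

/-! ### Trajectories and power balance -/

namespace SystemData

variable {n : ℕ} [NeZero n]
  {Z : Type*} [TopologicalSpace Z] [ChartedSpace (EuclideanHalfSpace n) Z]
  [IsManifold (𝓡∂ n) ∞ Z] [T2Space Z] [CompactSpace Z]
  {B : Type*} [TopologicalSpace B] [ChartedSpace (EuclideanSpace ℝ (Fin (n - 1))) B]
  [IsManifold (𝓡 (n - 1)) ∞ B] [T2Space B] [CompactSpace B]
  {X : RiemannianDomain n Z B} (S : SystemData X)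
  {J : Set ℝ} {ep : ℝ → DForm (𝓡∂ n) Z (n - S.p)} {eq : ℝ → DForm (𝓡∂ n) Z (n - S.q)}
  {fb : ℝ → DForm (𝓡 (n - 1)) B (n - S.p)} {eb : ℝ → DForm (𝓡 (n - 1)) B (n - S.q)} {t : ℝ}

lemma smoothFlow_timeDerivU (hJ : IsOpen J) (hep : SmoothCurve (𝓡∂ n) J ep)
    (heq : SmoothCurve (𝓡∂ n) J eq) (ht : t ∈ J) : S.SmoothFlow (S.timeDerivU ep eq t) :=
  ⟨(hep.timeDeriv hJ).form ht, (heq.timeDeriv hJ).form ht,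
    ((X.smoothCurve_restrict hep).timeDeriv hJ).form ht,
    ((X.smoothCurve_restrict heq).timeDeriv hJ).form ht⟩

lemma smoothBond_bondOf (hJ : IsOpen J) (hep : SmoothCurve (𝓡∂ n) J ep)
    (heq : SmoothCurve (𝓡∂ n) J eq) (hfb : SmoothCurve (𝓡 (n - 1)) J fb)
    (heb : SmoothCurve (𝓡 (n - 1)) J eb) (ht : t ∈ J) :
    S.SmoothBond (S.bondOf ep eq fb eb t) := by
  obtain ⟨h1, h2, h3, h4⟩ := S.smoothFlow_timeDerivU hJ hep heq ht
  have h5 := S.smoothEffort_gradP (hep.form ht) (heq.form ht)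
  rw [← S.varDerivP_eq (hep.form ht) (heq.form ht)] at h5
  exact ⟨⟨h1.neg, h2.neg, h3.neg, h4.neg⟩,
    (X.smoothForm_starB _ ((hfb.timeDeriv hJ).form ht)).neg, h5,
    X.smoothForm_starB _ (heb.form ht)⟩

/-- The Brayton–Moser equations in terms of the Dirac structure. -/
lemma isBraytonMoser_iff (hJ : IsOpen J) (hep : SmoothCurve (𝓡∂ n) J ep)
    (heq : SmoothCurve (𝓡∂ n) J eq) (hfb : SmoothCurve (𝓡 (n - 1)) J fb)
    (heb : SmoothCurve (𝓡 (n - 1)) J eb) :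
    S.IsBraytonMoser J ep eq fb eb ↔ ∀ t ∈ J, S.bondOf ep eq fb eb t ∈ S.dirac := by
  refine forall₂_congr fun t ht => ?_
  have h1 : -S.opA (-S.timeDerivU ep eq t) = S.opA (S.timeDerivU ep eq t) := by
    simp only [opA, Prod.fst_neg, Prod.snd_neg, smul_neg, Prod.neg_mk, neg_neg, neg_zero]
  have h2 : -X.starB S.np_nq (timeDeriv (𝓡 (n - 1)) fb t) =
      X.starB S.np_nq (S.opBT (-S.timeDerivU ep eq t)) ↔
      timeDeriv (𝓡 (n - 1)) fb t = S.opBT (S.timeDerivU ep eq t) := by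
    rw [show S.opBT (-S.timeDerivU ep eq t) = -S.opBT (S.timeDerivU ep eq t) from rfl, X.starB_neg,
      neg_inj, (X.starB_injective S.np_nq).eq_iff]
  rw [dirac, Set.mem_ofPred_eq, ← h2, ← h1]
  -- The smoothness required of elements of `𝒟` is automatic along a smooth curve.
  exact ⟨fun h => ⟨S.smoothBond_bondOf hJ hep heq hfb heb ht, h⟩, fun h => h.2⟩

/-- The power balance, along arbitrary curves. -/
lemma bilin_bondOf (hep : SmoothCurve (𝓡∂ n) J ep)
    (heq : SmoothCurve (𝓡∂ n) J eq) (ht : t ∈ J) :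
    S.bilin (S.bondOf ep eq fb eb t) (S.bondOf ep eq fb eb t) =
      2 * (S.power ep eq fb eb t -
        S.pairEF (S.gradP (ep t) (eq t)) (S.timeDerivU ep eq t)) := by
  have h1 : ∀ e f, S.pairEF e (-f) = -S.pairEF e f := by
    intro e f
    simp only [pairEF, Prod.fst_neg, Prod.snd_neg, X.pair_neg_right, X.pairB_neg_right]
    ring
  -- With the flow `-U_t`, the term quadratic in `f` keeps its sign and the pairing with `δ_U P`
  -- changes it. The stars cancel in the pairing of `∗e_b` with `-∗ḟ_b`.
  simp only [bilin, bondOf, pairFE_starF_opA, h1]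
  rw [S.varDerivP_eq (hep.form ht) (heq.form ht), X.pairB_neg_right,
    X.pairB_starB_starB S.nq_np S.np_nq, power]
  simp only [Prod.fst_neg, Prod.snd_neg, smul_neg, X.star_neg, X.pair_neg_left, X.pair_neg_right,
    neg_neg, timeDerivU]
  ring

/-- Put `p = a + 1` and `q = b + 1`; then `n - p = b` and `n - q = a`, and the exponents differ by
two. This is the origin of `r = pq + 1`. -/
lemma neg_one_pow_degrees :
    (-1 : ℝ) ^ (S.p * (n - S.p)) * (-1 : ℝ) ^ (n - S.q) = (-1 : ℝ) ^ (S.p * S.q + 1) := by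
  obtain ⟨a, ha⟩ : ∃ a, S.p = a + 1 := ⟨n - S.q, by have := S.hq; have := S.hpq; omega⟩
  obtain ⟨b, hb⟩ : ∃ b, S.q = b + 1 := ⟨n - S.p, by have := S.hp; have := S.hpq; omega⟩
  have h1 : n - S.p = b := by have := S.hpq; omega
  have h2 : n - S.q = a := by have := S.hpq; omega
  rw [h1, h2, ha, hb, ← pow_add, show (a + 1) * (b + 1) + 1 = (a + 1) * b + a + 2 by ring,
    pow_add _ _ 2]
  norm_num

/-- The components of the first Brayton–Moser equation. -/
lemma braytonMoser_components (up : DForm (𝓡∂ n) Z (n - S.p)) (uq : DForm (𝓡∂ n) Z (n - S.q))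
    (vp : DForm (𝓡 (n - 1)) B (n - S.p)) (vq wq : DForm (𝓡 (n - 1)) B (n - S.q))
    (ep : DForm (𝓡∂ n) Z (n - S.p)) (eq : DForm (𝓡∂ n) Z (n - S.q)) :
    S.opA (up, uq, vp, vq) = S.starE (S.gradP ep eq) + S.opB (X.starB S.nq_np wq) ↔
      -X.star S.np_p (S.ε • up) = X.star S.np_p (S.opG ep) +
          (-1 : ℝ) ^ (S.p * S.q + 1) • extD (𝓡∂ n) S.nq_succ eq ∧
      -X.star S.nq_q (S.μ • uq) = extD (𝓡∂ n) S.np_succ ep + X.star S.nq_q (S.opR eq) ∧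
      wq = (-(-1 : ℝ) ^ (n - S.q)) • X.restrict eq := by
  simp only [opA, starE, gradP, opB, Prod.mk_add_mk, Prod.mk.injEq, add_zero, X.starB_zero, and_true]
  refine and_congr ?_ (and_congr ?_ ?_)
  -- Applying the star to both sides is an equivalence; the sign of `∗∗` cancels the sign carried by
  -- `gradP` on the dissipative term and combines with the one on `d e_q`.
  · rw [← (X.star_injective S.np_p).eq_iff, X.star_star S.p_np S.np_p, smul_neg, smul_add,
      smul_smul, smul_smul, neg_one_pow_mul_self, one_smul, S.neg_one_pow_degrees,
      eq_neg_iff_add_eq_zero, neg_eq_iff_add_eq_zero, add_comm (X.star S.np_p (S.opG ep))]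
  · rw [← (X.star_injective S.nq_q).eq_iff, X.star_star S.q_nq S.nq_q, smul_smul,
      neg_one_pow_mul_self, one_smul,
      form_neg_smul, X.star_neg]
  · rw [← X.starB_add, ← X.starB_zero S.nq_np, (X.starB_injective S.nq_np).eq_iff,
      form_neg_smul, eq_neg_iff_add_eq_zero, eq_comm, add_comm]

/-- The port-Hamiltonian system in terms of the Brayton–Moser equations. -/
lemma isPortHamiltonian_iff (hJ : IsOpen J) (hep : SmoothCurve (𝓡∂ n) J ep)
    (heq : SmoothCurve (𝓡∂ n) J eq) :
    S.IsPortHamiltonian J (fun t => X.star S.np_p (S.ε • ep t))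
        (fun t => X.star S.nq_q (S.μ • eq t)) fb eb ↔
      S.IsBraytonMoser J ep eq fb eb ∧ ∀ t ∈ J, fb t = X.restrict (ep t) := by
  have key : ∀ t ∈ J, (-timeDeriv (𝓡∂ n) (fun t => X.star S.np_p (S.ε • ep t)) t =
        X.star S.np_p (S.opG (ep t)) +
          (-1 : ℝ) ^ (S.p * S.q + 1) • extD (𝓡∂ n) S.nq_succ (eq t) ∧
      -timeDeriv (𝓡∂ n) (fun t => X.star S.nq_q (S.μ • eq t)) t =
        extD (𝓡∂ n) S.np_succ (ep t) + X.star S.nq_q (S.opR (eq t)) ∧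
      eb t = (-(-1 : ℝ) ^ (n - S.q)) • X.restrict (eq t)) ↔
      S.opA (S.timeDerivU ep eq t) =
        S.starE (S.varDerivP (ep t) (eq t)) + S.opB (X.starB S.nq_np (eb t)) := by
    intro t ht
    have e1 : timeDeriv (𝓡∂ n) (fun t => S.ε • ep t) t = S.ε • timeDeriv (𝓡∂ n) ep t :=
      timeDeriv_linear (I' := 𝓡∂ n) id (fun _ => S.ε • LinearMap.id) hep hJ ht
    have e2 : timeDeriv (𝓡∂ n) (fun t => S.μ • eq t) t = S.μ • timeDeriv (𝓡∂ n) eq t :=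
      timeDeriv_linear (I' := 𝓡∂ n) id (fun _ => S.μ • LinearMap.id) heq hJ ht
    rw [S.varDerivP_eq (hep.form ht) (heq.form ht), timeDerivU, S.braytonMoser_components,
      X.timeDeriv_star S.np_p (hep.const_smul S.ε) hJ ht,
      X.timeDeriv_star S.nq_q (heq.const_smul S.μ) hJ ht, e1, e2]
  have hH : ∀ t ∈ J, S.varDerivH (X.star S.np_p (S.ε • ep t)) (X.star S.nq_q (S.μ • eq t)) =
      (ep t, eq t) := fun t ht => S.varDerivH_star (hep.form ht) (heq.form ht)
  constructor
  · intro h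
    have hfb : ∀ t ∈ J, fb t = X.restrict (ep t) := fun t ht => by
      have := (h t ht).2.2.1
      rwa [hH t ht] at this
    -- The second Brayton–Moser equation is the time derivative of `f_b = e_p|_{∂Z}`, which holds on
    -- the open set `J`.
    refine ⟨fun t ht => ⟨(key t ht).1 ?_, timeDeriv_congr hJ hfb ht⟩, hfb⟩
    obtain ⟨h1, h2, -, h4⟩ := h t ht
    rw [hH t ht] at h1 h2 h4
    exact ⟨h1, h2, h4⟩
  · rintro ⟨h, hfb⟩ t ht
    obtain ⟨h1, h2, h4⟩ := (key t ht).2 (h t ht).1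
    rw [hH t ht]
    exact ⟨h1, h2, hfb t ht, h4⟩

end SystemData

theorem mainTheorem11 {n : ℕ} [NeZero n]
    {Z : Type*} [TopologicalSpace Z] [ChartedSpace (EuclideanHalfSpace n) Z]
    [IsManifold (𝓡∂ n) ∞ Z] [T2Space Z] [CompactSpace Z]
    {B : Type*} [TopologicalSpace B] [ChartedSpace (EuclideanSpace ℝ (Fin (n - 1))) B]
    [IsManifold (𝓡 (n - 1)) ∞ B] [T2Space B] [CompactSpace B]
    (X : RiemannianDomain n Z B) (S : SystemData X) :
    -- the variational derivatives of `P` and `H` exist and are unique, and `δH = (e_p, e_q)`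
    (∀ ep eq, SmoothForm (𝓡∂ n) ep → SmoothForm (𝓡∂ n) eq →
      (∃! δ, S.IsVarDeriv S.mixedPotential ep eq δ) ∧
      (∀ δ, S.IsVarDerivH (X.star S.np_p (S.ε • ep)) (X.star S.nq_q (S.μ • eq)) δ ↔
        δ = (ep, eq))) ∧
    -- `𝒟` is a Dirac structure
    S.dirac = S.orthogonal S.dirac ∧
    -- the trajectories
    ∀ (J : Set ℝ), IsOpen J → ∀ ep eq fb eb,
      SmoothCurve (𝓡∂ n) J ep → SmoothCurve (𝓡∂ n) J eq →
      SmoothCurve (𝓡 (n - 1)) J fb → SmoothCurve (𝓡 (n - 1)) J eb →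
      (S.IsPortHamiltonian J (fun t => X.star S.np_p (S.ε • ep t))
          (fun t => X.star S.nq_q (S.μ • eq t)) fb eb ↔
        S.IsBraytonMoser J ep eq fb eb ∧ ∀ t ∈ J, fb t = X.restrict (ep t)) ∧
      (S.IsBraytonMoser J ep eq fb eb ↔ ∀ t ∈ J, S.bondOf ep eq fb eb t ∈ S.dirac) ∧
      (∀ t ∈ J, ∃ P' : ℝ, HasDerivAt (fun s => S.mixedPotential (ep s) (eq s)) P' t ∧
        S.bilin (S.bondOf ep eq fb eb t) (S.bondOf ep eq fb eb t) =
          2 * (S.power ep eq fb eb t - P')) ∧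
      (S.IsBraytonMoser J ep eq fb eb → ∀ t ∈ J,
        S.bilin (S.bondOf ep eq fb eb t) (S.bondOf ep eq fb eb t) = 0 ∧
        HasDerivAt (fun s => S.mixedPotential (ep s) (eq s)) (S.power ep eq fb eb t) t) := by
  refine ⟨fun ep eq hep heq => ⟨⟨S.gradP ep eq, S.isVarDeriv_gradP hep heq, fun δ hδ =>
    SystemData.IsVarDeriv.unique S hδ (S.isVarDeriv_gradP hep heq)⟩,
    S.isVarDerivH_star_iff hep heq⟩, S.dirac_eq_orthogonal,
    fun J hJ ep eq fb eb hep heq hfb heb => ?_⟩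
  have hD := S.isBraytonMoser_iff hJ hep heq hfb heb
  refine ⟨S.isPortHamiltonian_iff hJ hep heq, hD, fun t ht =>
    ⟨_, S.hasDerivAt_mixedPotential hJ hep heq ht, S.bilin_bondOf hep heq ht⟩, fun h t ht => ?_⟩
  have h1 := hD.1 h t ht
  -- A point of `𝒟` lies in `𝒟^⊥` and is thus orthogonal to itself; with `bilin_bondOf` this becomes
  -- the power balance.
  have h2 : S.bilin (S.bondOf ep eq fb eb t) (S.bondOf ep eq fb eb t) = 0 := by
    have h3 := h1
    rw [S.dirac_eq_orthogonal] at h3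
    exact h3.2 _ h1
  refine ⟨h2, (S.hasDerivAt_mixedPotential hJ hep heq ht).congr_deriv ?_⟩
  rw [S.bilin_bondOf hep heq ht] at h2
  linarith
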